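/- For $n\ge 1$ let $OP_n$ be the CNF formula in the variables $P_{i,j}$ ($1\le i,j\le n$, $i\ne j$) with the clauses $\neg P_{i,j}\vee\neg P_{j,k}\vee P_{i,k}$ for pairwise distinct $i,j,k$, the clauses $\neg P_{i,j}\vee\neg P_{j,i}$ for $i\ne j$, and the clauses $\bigvee_{i\ne j}P_{i,j}$ for $1\le j\le n$. Let $0<\delta\le 1/2$ be rational, and consider the deterministic CDCL solver with the following configuration. Its branching heuristic is VSIDS with decay factor $\delta$: all scores are $0$ at the start, and after each conflict the score $q(x)$ of every variable $x$ is replaced by $b(x)+\delta q(x)$, where $b(x)=1$ if $x$ occurs in the learned clause and $b(x)=0$ otherwise; the solver branches on an unassigned variable with the highest score, and breaks ties by a fixed order of the variables, which on $OP_n$ is the column-major order $P_{2,1},\dots,P_{n,1},P_{1,2},P_{3,2},\dots,P_{n-1,n}$. Decisions always set the variable to false; unit propagation is breadth-first (each literal is propagated to saturation before the literals that it implies are propagated, and propagation ends when a clause is falsified); the learned clause is the 1UIP clause; the solver restarts after every conflict and never deletes a clause. This solver has an exponential separation from every solver that is polynomially equivalent to tree-like resolution, and the formulas $OP_n$ witness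 it: 1. There is a polynomial $p$ such that for all $n\ge 6$ the CDCL solver refutes $OP_n$ in time at most $p(n)$. 2. There is $\varepsilon>0$ such that for all sufficiently large $n$ every tree-like resolution refutation of $OP_n$ has size at least $2^{\varepsilon n}$. 3. Let $S$ be any (possibly nondeterministic) solver that is polynomially equivalent to tree-like resolution; that is, there is a polynomial $q$ such that for every CNF formula $F$ of size $|F|$, each run of $S$ that refutes $F$ in time $t$ gives rise to a tree-like resolution refutation of $F$ of size at most $q(|F|+t)$, and whenever $F$ has a tree-like resolution refutation of size $s$, some run of $S$ refutes $F$ in time at most $q(|F|+s)$. Then there is $\varepsilon>0$ such that for all sufficiently large $n$ every run of $S$ that refutes $OP_n$ takes time at least $2^{\varepsilon n}$. 4. DPLL with unit propagation and nondeterministic branching, its time being the number of its steps (conflicts, propagations and branchings), is such a solver. -/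

import Mathlib

namespace SatSep

/-! ### CNF formulas -/

/-- A literal: a variable together with its polarity (`true` for `x`, `false` for `¬ x`). -/
abbrev Lit := ℕ × Bool

/-- The complementary literal. -/
def neg (l : Lit) : Lit := (l.1, !l.2)

/-- A clause is the disjunction of the literals of a list. -/
abbrev Clause := List Lit

/-- A CNF formula is the conjunction of the clauses of a list. -/
abbrev CNF := List Clause

/-- The size of a formula: its literal occurrences plus its clauses. -/
def size (F : CNF) : ℕ := (F.map fun C => C.length + 1).sum

/-! ### The ordering principle -/

/-- The variable `P_{i,j}` of the ordering principle on the elements `0, …, n - 1`. For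
`i, j < n` this numbering is injective, and its order is the column-major order. -/
def opVar (n i j : ℕ) : ℕ := j * n + i

/-- Transitivity: `¬ P_{i,j} ∨ ¬ P_{j,k} ∨ P_{i,k}` for pairwise distinct `i, j, k`. -/
def opTrans (n : ℕ) : CNF :=
  (List.range n).flatMap fun i => (List.range n).flatMap fun j => (List.range n).flatMap fun k =>
    if i ≠ j ∧ k ≠ i ∧ j ≠ k then
      [[(opVar n i j, false), (opVar n j k, false), (opVar n i k, true)]]
    else []

/-- Antisymmetry: `¬ P_{i,j} ∨ ¬ P_{j,i}` for distinct `i, j`. -/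
def opAnti (n : ℕ) : CNF :=
  (List.range n).flatMap fun i => (List.range n).flatMap fun j =>
    if i ≠ j then [[(opVar n i j, false), (opVar n j i, false)]] else []

/-- Non-minimality: for every `j`, the disjunction of all `P_{i,j}` with `i ≠ j`. -/
def opNonMin (n : ℕ) : CNF :=
  (List.range n).map fun j =>
    ((List.range n).filter fun i => i ≠ j).map fun i => (opVar n i j, true)

/-- The ordering principle formula on `n` elements. Its size is of the order of `n ^ 3`. -/
def OP (n : ℕ) : CNF := opTrans n ++ opAnti n ++ opNonMin n

/-! ### Tree-like resolution -/

/-- `TreeRes F C s`: the clause `C` (as a set of literals) has a tree-like resolution derivation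
from the clauses of `F` whose tree has `s` nodes. -/
inductive TreeRes (F : CNF) : Finset Lit → ℕ → Prop
  | leaf (C : Clause) (hC : C ∈ F) : TreeRes F C.toFinset 1
  | resolve (x : ℕ) (C D : Finset Lit) (s t : ℕ) (hx : (x, true) ∈ C) (hx' : (x, false) ∈ D)
      (hC : TreeRes F C s) (hD : TreeRes F D t) :
      TreeRes F (C.erase (x, true) ∪ D.erase (x, false)) (s + t + 1)

/-- `F` has a tree-like resolution refutation of size `s`. -/
def TreeRefutes (F : CNF) (s : ℕ) : Prop := TreeRes F ∅ s

/-! ### Solvers -/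

/-- A (possibly nondeterministic) solver: a transition system that is started on a formula, whose
steps `step s c s'` carry a cost `c`, and that reports unsatisfiability in some of its states. -/
structure Solver where
  State : Type
  init : CNF → State
  step : State → ℕ → State → Prop
  refuted : State → Prop

namespace Solver

/-- `S.Run s t s'`: some run of `S` from `s` to `s'` has total cost `t`. -/
inductive Run (S : Solver) : S.State → ℕ → S.State → Prop
  | refl (s : S.State) : Run S s 0 s
  | head (s s' s'' : S.State) (c t : ℕ) (h : S.step s c s') (hr : Run S s' t s'') :
      Run S s (c + t) s''

/-- Some run of `S` on `F` reports unsatisfiability after time `t`. -/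
def Refutes (S : Solver) (F : CNF) (t : ℕ) : Prop :=
  ∃ s, S.Run (S.init F) t s ∧ S.refuted s

/-- Every state has at most one successor, and the solver halts when it reports
unsatisfiability. So there is only one maximal run on each formula. -/
def Deterministic (S : Solver) : Prop :=
  (∀ s c₁ s₁ c₂ s₂, S.step s c₁ s₁ → S.step s c₂ s₂ → c₁ = c₂ ∧ s₁ = s₂) ∧
  (∀ s c s₁, S.refuted s → ¬ S.step s c s₁)

/-- Polynomial equivalence with tree-like resolution: refuting runs of `S` yield tree-like
resolution refutations with polynomial overhead, and conversely. The overhead may also depend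
polynomially on the size of the formula. -/
def PolyEquivTreeLike (S : Solver) : Prop :=
  (∃ p : Polynomial ℕ, ∀ F t, S.Refutes F t →
    ∃ s, s ≤ p.eval (size F + t) ∧ TreeRefutes F s) ∧
  (∃ p : Polynomial ℕ, ∀ F s, TreeRefutes F s →
    ∃ t, t ≤ p.eval (size F + s) ∧ S.Refutes F t)

end Solver

/-! ### DPLL with nondeterministic branching -/

/-- The partial assignment `ρ` (the list of its true literals) falsifies `C`. -/
def Falsifies (ρ : List Lit) (C : Clause) : Prop := ∀ l ∈ C, neg l ∈ ρ

/-- Under `ρ` the literal `l` of `C` is unassigned and every other literal of `C` is false. -/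
def UnitUnder (ρ : List Lit) (C : Clause) (l : Lit) : Prop :=
  l ∈ C ∧ l ∉ ρ ∧ neg l ∉ ρ ∧ ∀ l' ∈ C, l' ≠ l → neg l' ∈ ρ

/-- One step of DPLL. The state is the formula with the stack of partial assignments that are
still to be explored. A conflict closes the current branch; otherwise unit propagation takes
place as long as possible; otherwise the solver branches on any unassigned variable of the
formula, with any first value. -/
inductive DPLLStep : CNF × List (List Lit) → CNF × List (List Lit) → Prop
  | conflict (F : CNF) (ρ : List Lit) (R : List (List Lit)) (C : Clause) (hC : C ∈ F)
      (h : Falsifies ρ C) : DPLLStep (F, ρ :: R) (F, R)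
  | propagate (F : CNF) (ρ : List Lit) (R : List (List Lit)) (C : Clause) (l : Lit) (hC : C ∈ F)
      (hno : ∀ D ∈ F, ¬ Falsifies ρ D) (h : UnitUnder ρ C l) :
      DPLLStep (F, ρ :: R) (F, (l :: ρ) :: R)
  | branch (F : CNF) (ρ : List Lit) (R : List (List Lit)) (C : Clause) (l : Lit) (hC : C ∈ F)
      (hl : l ∈ C ∨ neg l ∈ C) (hno : ∀ D ∈ F, ¬ Falsifies ρ D)
      (hnu : ∀ D ∈ F, ∀ m, ¬ UnitUnder ρ D m) (h : l ∉ ρ) (h' : neg l ∉ ρ) :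
      DPLLStep (F, ρ :: R) (F, (l :: ρ) :: (neg l :: ρ) :: R)

/-- DPLL with nondeterministic branching. Its time is the number of its steps (conflicts,
propagations and branchings); it reports unsatisfiability when all branches are closed. -/
def dpll : Solver where
  State := CNF × List (List Lit)
  init F := (F, [[]])
  step s c s' := c = 1 ∧ DPLLStep s s'
  refuted s := s.2 = []

/-! ### Computations with a step count -/

/-- A value together with the number of elementary operations spent on computing it. -/
structure Timed (α : Type) where
  val : α
  cost : ℕ

namespace Timed

/-- Spend `c` elementary operations. -/
def tick (c : ℕ) : Timed Unit := ⟨(), c⟩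

instance : Monad Timed where
  pure a := ⟨a, 0⟩
  bind x f := ⟨(f x.val).val, x.cost + (f x.val).cost⟩

end Timed

open Timed

/-! ### CDCL

One unit of cost pays for visiting one list cell, which includes comparing variables or literals
and allocating a cell. Rational arithmetic is charged by the bit lengths of its operands. -/

/-- A literal on the trail, with its decision level and the clause that implied it (`none` for a
decision). -/
structure Entry where
  lit : Lit
  level : ℕ
  reason : Option Clause

/-- The value of a literal under a trail, `none` if it is unassigned. -/
def litValue : List Entry → Lit → Timed (Option Bool)
  | [], _ => do
    tick 1
    pure none
  | e :: tr, l => do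
    tick 1
    if e.lit.1 = l.1 then pure (some (e.lit.2 == l.2)) else litValue tr l

/-- The decision level of the variable of a literal under a trail, `none` if it is unassigned. -/
def litLevel : List Entry → Lit → Timed (Option ℕ)
  | [], _ => do
    tick 1
    pure none
  | e :: tr, l => do
    tick 1
    if e.lit.1 = l.1 then pure (some e.level) else litLevel tr l

/-- The status of a clause under a partial assignment; `unit l` means that `l` is unassigned and
all other literals are false. -/
inductive Status
  | satisfied
  | falsified
  | unit (l : Lit)
  | undetermined

/-- The status of a clause under a trail. -/
def clauseStatus (tr : List Entry) : Clause → Timed Status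
  | [] => do
    tick 1
    pure .falsified
  | l :: C => do
    tick 1
    let v ← litValue tr l
    match v with
    | some true => pure .satisfied
    | some false => clauseStatus tr C
    | none =>
      let r ← clauseStatus tr C
      match r with
      | .falsified => pure (.unit l)
      | .unit m => if l = m then pure (.unit l) else pure .undetermined
      | .satisfied => pure .satisfied
      | .undetermined => pure .undetermined

/-- The first falsified clause of the database, if there is one. -/
def findConflict (tr : List Entry) : List Clause → Timed (Option Clause)
  | [] => do
    tick 1
    pure none
  | C :: Γ => do
    tick 1
    let r ← clauseStatus tr C
    match r with
    | .falsified => pure (some C)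
    | _ => findConflict tr Γ

/-- Whether a literal occurs in a clause. -/
def litMem (l : Lit) : Clause → Timed Bool
  | [] => do
    tick 1
    pure false
  | m :: C => do
    tick 1
    if m = l then pure true else litMem l C

/-- Whether a variable occurs in a clause. -/
def varMem (x : ℕ) : Clause → Timed Bool
  | [] => do
    tick 1
    pure false
  | m :: C => do
    tick 1
    if m.1 = x then pure true else varMem x C

/-- Whether a clause has to be visited: with `none`, always; when the literal `l` is propagated,
if `¬ l` occurs in it. -/
def concerns (p : Option Lit) (C : Clause) : Timed Bool :=
  match p with
  | none => pure true
  | some l => litMem (neg l) C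

/-- Propagate one literal to saturation: go once through the database in order, and put the
implied literal of each visited clause that is unit on the trail, at the given level. With `none`
all clauses are visited. The result is the new trail and the implied literals, oldest first. -/
def saturate (p : Option Lit) (lvl : ℕ) :
    List Clause → List Entry → Timed (List Entry × List Lit)
  | [], tr => do
    tick 1
    pure (tr, [])
  | C :: Γ, tr => do
    tick 1
    let b ← concerns p C
    if b then
      let r ← clauseStatus tr C
      match r with
      | .unit l =>
        let q ← saturate p lvl Γ (⟨l, lvl, some C⟩ :: tr)
        pure (q.1, l :: q.2)
      | _ => saturate p lvl Γ tr
    else saturate p lvl Γ tr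

/-- The bit length of a rational number. -/
def bits (q : ℚ) : ℕ := q.num.natAbs.size + q.den.size

/-- The charge for one arithmetic operation or comparison of `q` and `r` (schoolbook arithmetic,
including the reduction to lowest terms). -/
def arithCost (q r : ℚ) : ℕ := (bits q + bits r + 1) ^ 2

/-- The VSIDS decision: among the unassigned variables, one with the highest score, and the least
one among these. The second list argument is the best candidate so far. -/
def pickBranch (tr : List Entry) : List (ℕ × ℚ) → Option (ℕ × ℚ) → Timed (Option ℕ)
  | [], best => do
    tick 1
    pure (best.map Prod.fst)
  | (x, q) :: sc, best => do
    tick 1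
    let v ← litValue tr (x, true)
    match v with
    | some _ => pickBranch tr sc best
    | none =>
      match best with
      | none => pickBranch tr sc (some (x, q))
      | some (y, r) => do
        tick (arithCost q r)
        if r < q ∨ (r = q ∧ x < y) then pickBranch tr sc (some (x, q))
        else pickBranch tr sc (some (y, r))

/-- The VSIDS update after learning `C`: the score `q` of a variable becomes `b + δ q`, where `b`
is `1` if the variable occurs in `C` and `0` otherwise. -/
def updateScores (δ : ℚ) (C : Clause) : List (ℕ × ℚ) → Timed (List (ℕ × ℚ))
  | [] => do
    tick 1
    pure []
  | (x, q) :: sc => do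
    tick 1
    let m ← varMem x C
    tick (arithCost δ q)
    tick (arithCost 1 (δ * q))
    let sc' ← updateScores δ C sc
    pure ((x, (if m then 1 else 0) + δ * q) :: sc')

/-- The number of literals of a clause that were assigned at a given level. -/
def countLevel (tr : List Entry) (lvl : ℕ) : Clause → Timed ℕ
  | [] => do
    tick 1
    pure 0
  | l :: C => do
    tick 1
    let v ← litLevel tr l
    let k ← countLevel tr lvl C
    pure (if v = some lvl then k + 1 else k)

/-- Remove a literal from a clause. -/
def removeLit (l : Lit) : Clause → Timed Clause
  | [] => do
    tick 1
    pure []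
  | m :: C => do
    tick 1
    let C' ← removeLit l C
    pure (if m = l then C' else m :: C')

/-- The union of two clauses, without repetitions if the second one has none. -/
def unionLits : Clause → Clause → Timed Clause
  | [], D => do
    tick 1
    pure D
  | l :: C, D => do
    tick 1
    let E ← unionLits C D
    let b ← litMem l E
    pure (if b then E else l :: E)

/-- Conflict analysis with the 1UIP scheme: walk down the trail from the newest literal. Whenever
the clause contains the complement of the current literal, resolve it with the reason of that
literal. Stop as soon as the clause has only one literal of the conflict level. -/
def analyze (full : List Entry) (lvl : ℕ) : List Entry → Clause → Timed Clause
  | [], C => do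
    tick 1
    pure C
  | e :: tr, C => do
    tick 1
    let k ← countLevel full lvl C
    if k ≤ 1 then pure C
    else
      let b ← litMem (neg e.lit) C
      match b, e.reason with
      | true, some D =>
        let C' ← removeLit (neg e.lit) C
        let D' ← removeLit e.lit D
        let E ← unionLits D' C'
        analyze full lvl tr E
      | _, _ => analyze full lvl tr C

/-- The data of a CDCL solver during the search. -/
structure Search where
  /-- the input clauses followed by the learned clauses, in the order of learning -/
  db : List Clause
  /-- the variables with their VSIDS scores -/
  scores : List (ℕ × ℚ)
  /-- the current decision level -/
  level : ℕ
  /-- the assigned literals, newest first -/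
  trail : List Entry
  /-- the assigned literals that are still to be propagated, oldest first -/
  queue : List Lit

/-- The states of a CDCL solver. -/
inductive CDCLState
  | start (F : CNF)
  | search (s : Search)
  | sat
  | unsat

/-- Begin again at level `0` with an empty trail, and put the unit clauses on the trail. -/
def restart (db : List Clause) (sc : List (ℕ × ℚ)) : Timed CDCLState := do
  let q ← saturate none 0 db []
  pure (.search ⟨db, sc, 0, q.1, q.2⟩)

/-- Add a variable with score `0` to the list unless it is there already. -/
def addVar (x : ℕ) : List (ℕ × ℚ) → Timed (List (ℕ × ℚ))
  | [] => do
    tick 1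
    pure [(x, 0)]
  | y :: sc => do
    tick 1
    if y.1 = x then pure (y :: sc)
    else
      let sc' ← addVar x sc
      pure (y :: sc')

/-- Add the variables of a clause. -/
def addClauseVars : Clause → List (ℕ × ℚ) → Timed (List (ℕ × ℚ))
  | [], sc => do
    tick 1
    pure sc
  | l :: C, sc => do
    tick 1
    let sc' ← addVar l.1 sc
    addClauseVars C sc'

/-- Add the variables of a formula. -/
def addVars : CNF → List (ℕ × ℚ) → Timed (List (ℕ × ℚ))
  | [], sc => do
    tick 1
    pure sc
  | C :: F, sc => do
    tick 1
    let sc' ← addClauseVars C sc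
    addVars F sc'

/-- One step of the search. If a clause is falsified, then report unsatisfiability at level `0`,
and otherwise learn the 1UIP clause, update the scores and restart. If no clause is falsified,
then propagate the oldest literal of the queue to saturation. If the queue is empty, then decide
a variable, and set it to false. -/
def searchStep (δ : ℚ) (s : Search) : Timed CDCLState := do
  tick 1
  let conf ← findConflict s.trail s.db
  match conf with
  | some C =>
    if s.level = 0 then pure .unsat
    else
      let C₀ ← unionLits C []
      let L ← analyze s.trail s.level s.trail C₀
      let sc ← updateScores δ L s.scores
      tick s.db.length
      restart (s.db ++ [L]) sc
  | none =>
    match s.queue with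
    | l :: rest =>
      let q ← saturate (some l) s.level s.db s.trail
      tick rest.length
      pure (.search ⟨s.db, s.scores, s.level, q.1, rest ++ q.2⟩)
    | [] =>
      let x ← pickBranch s.trail s.scores none
      match x with
      | none => pure .sat
      | some x =>
        pure (.search ⟨s.db, s.scores, s.level + 1,
          ⟨(x, false), s.level + 1, none⟩ :: s.trail, [(x, false)]⟩)

/-- The next state of the CDCL solver with the cost of the step; there is none after an answer.
The first step lists the variables of the formula, with scores `0`. -/
def cdclNext (δ : ℚ) : CDCLState → Option (Timed CDCLState)
  | .start F => some do
      let sc ← addVars F []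
      restart F sc
  | .search s => some (searchStep δ s)
  | .sat => none
  | .unsat => none

/-- The CDCL solver with VSIDS branching (decay factor `δ`, ties broken by the order of the
variables), decisions always set to false, 1UIP clause learning, a restart after every conflict,
and no clause deletion. -/
def cdcl (δ : ℚ) : Solver where
  State := CDCLState
  init := CDCLState.start
  step s c s' := cdclNext δ s = some ⟨s', c⟩
  refuted s := s = CDCLState.unsat

end SatSep

namespace SatSep

open Timed

/-! ### Indices and the clauses of the ordering principle -/

/-! Lower bound. Walk a tree-like refutation from its root towards the leaves while maintaining a
partial linear order that falsifies the current clause: ranked elements are compared by rank,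
unranked ones lie below all of them and are not compared with each other. If the resolved variable
has no value yet, it compares two unranked elements. Ranking the one or the other just below all
ranked elements gives the variable the one or the other value, so each premise is falsified after
the loss of one unranked element, and both subtrees must be large. No axiom is falsified while two
elements are unranked, which yields `2 ^ (n - 1)` nodes (`TreeRes.pow_le`). Polynomial simulation
carries this over to solvers (`Solver.exponential_of_treeLike`). DPLL is such a solver: its closed
branches assemble into a tree-like refutation, and it can branch along a given refutation.

Upper bound. Write (j, m) for the disjunction of the P_{x,j} with x ≤ m, x ≠ j. With elements
numbered from 0, the non-minimality clauses are the (j, n-1), and every learned clause is again some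
(j, m). Between two conflicts the solver decides ¬P_{x,k} for increasing x in one column k, until
the shortest clause (k, m) leaves only P_{p,k}, where p is the largest element other than k up to m.
Transitivity and antisymmetry then give ¬P_{x,p} for the excluded x and for x = k. There are two
outcomes. (a) These literals falsify (p, p) if it is known; if p = n-2, they imply P_{n-1,p}, which
falsifies the column n-1. Analysis leads back to column k, the last decision is the only literal of
its level, and (k, p-1) is learned (`learns_learned`, `learns_second`). (b) If column p has only its
input clause and p < n-2, the solver goes on deciding in column k up to ¬P_{n-2,k}. Each decision is
copied to column p, until P_{n-1,p} is implied and column n-1 is falsified. Analysis now stops in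
column p, since only one literal there has the newest level, and (p, n-2) is learned
(`learns_jump`): the solver changes to column p.

So it learns (0, n-2), (0, n-3), then (k, n-2), …, (k, k) for k = n-3, …, 1. Now (1, 1) is the unit
clause P_{0,1}, and with its help (0, n-4), …, (0, 2) are learned, after which propagation at level
0 gives a conflict. There are at most `n ^ 2` conflicts.

VSIDS behaves as claimed because δ ≤ 1/2 keeps all scores below 2: the variables of the newest
clause score at least 1 and all others less than 1. As learned clauses are initial segments of
columns, scores never increase along a column, and ties are broken in the same direction
(`Scores.prefers_bump`, `Prefers.bump`).

Two tools make the runs tractable. `saturate_spec` determines the assignment after a pass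
irrespective of the order of the clauses, so a run can be described by explicit assignments.
`analyze_layer` resolves away a whole batch of literals implied by one common literal, whatever
their order on the trail. -/

theorem opVar_mod {n i j : ℕ} (hi : i < n) : opVar n i j % n = i := by
  unfold opVar; rw [Nat.add_comm, Nat.add_mul_mod_self_right, Nat.mod_eq_of_lt hi]

theorem opVar_div {n i j : ℕ} (hi : i < n) : opVar n i j / n = j := by
  unfold opVar
  rw [Nat.add_comm, Nat.add_mul_div_right _ _ (by omega), Nat.div_eq_of_lt hi, Nat.zero_add]

theorem mem_opTrans {n : ℕ} {C : Clause} : C ∈ opTrans n ↔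
    ∃ i j k, i < n ∧ j < n ∧ k < n ∧ i ≠ j ∧ k ≠ i ∧ j ≠ k ∧
      C = [(opVar n i j, false), (opVar n j k, false), (opVar n i k, true)] := by
  simp only [opTrans, List.mem_flatMap, List.mem_range]
  constructor
  · rintro ⟨i, hi, j, hj, k, hk, h⟩
    split_ifs at h with hc
    · exact ⟨i, j, k, hi, hj, hk, hc.1, hc.2.1, hc.2.2, by simpa using h⟩
    · simp at h
  · rintro ⟨i, j, k, hi, hj, hk, h1, h2, h3, rfl⟩
    refine ⟨i, hi, j, hj, k, hk, ?_⟩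
    rw [if_pos ⟨h1, h2, h3⟩]; simp

theorem mem_opAnti {n : ℕ} {C : Clause} : C ∈ opAnti n ↔
    ∃ i j, i < n ∧ j < n ∧ i ≠ j ∧ C = [(opVar n i j, false), (opVar n j i, false)] := by
  simp only [opAnti, List.mem_flatMap, List.mem_range]
  constructor
  · rintro ⟨i, hi, j, hj, h⟩
    split_ifs at h with hc
    · exact ⟨i, j, hi, hj, hc, by simpa using h⟩
    · simp at h
  · rintro ⟨i, j, hi, hj, h1, rfl⟩
    refine ⟨i, hi, j, hj, ?_⟩
    rw [if_pos h1]; simp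

theorem mem_opNonMin {n : ℕ} {C : Clause} : C ∈ opNonMin n ↔
    ∃ j, j < n ∧ C = ((List.range n).filter fun i => i ≠ j).map fun i => (opVar n i j, true) := by
  simp [opNonMin, eq_comm]

theorem mem_OP {n : ℕ} {C : Clause} :
    C ∈ OP n ↔ C ∈ opTrans n ∨ C ∈ opAnti n ∨ C ∈ opNonMin n := by
  simp [OP]

theorem size_append (F G : CNF) : size (F ++ G) = size F + size G := by
  simp [size]

theorem size_flatMap_le {α : Type*} (L : List α) (f : α → CNF) (b : ℕ)
    (h : ∀ a ∈ L, size (f a) ≤ b) : size (L.flatMap f) ≤ L.length * b := by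
  induction L with
  | nil => simp [size]
  | cons a L ih =>
    have h1 := h a (by simp)
    have h2 := ih fun a ha => h a (by simp [ha])
    rw [List.flatMap_cons, size_append, List.length_cons, Nat.succ_mul]
    omega

theorem size_OP_le (n : ℕ) : size (OP n) ≤ 4 * n ^ 3 + 4 * n ^ 2 + n := by
  have hT : size (opTrans n) ≤ n * (n * (n * 4)) := by
    have := size_flatMap_le (List.range n) (fun i => (List.range n).flatMap fun j =>
      (List.range n).flatMap fun k => if i ≠ j ∧ k ≠ i ∧ j ≠ k then
      [[(opVar n i j, false), (opVar n j k, false), (opVar n i k, true)]] else []) (n * (n * 4)) ?_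
    · simpa [opTrans] using this
    intro i _
    have := size_flatMap_le (List.range n) (fun j =>
      (List.range n).flatMap fun k => if i ≠ j ∧ k ≠ i ∧ j ≠ k then
      [[(opVar n i j, false), (opVar n j k, false), (opVar n i k, true)]] else []) (n * 4) ?_
    · simpa using this
    intro j _
    have := size_flatMap_le (List.range n) (fun k => if i ≠ j ∧ k ≠ i ∧ j ≠ k then
      [[(opVar n i j, false), (opVar n j k, false), (opVar n i k, true)]] else []) 4 ?_
    · simpa using this
    intro k _
    split_ifs <;> simp [size]
  have hA : size (opAnti n) ≤ n * (n * 3) := by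
    have := size_flatMap_le (List.range n) (fun i => (List.range n).flatMap fun j =>
      if i ≠ j then [[(opVar n i j, false), (opVar n j i, false)]] else []) (n * 3) ?_
    · simpa [opAnti] using this
    intro i _
    have := size_flatMap_le (List.range n) (fun j =>
      if i ≠ j then [[(opVar n i j, false), (opVar n j i, false)]] else []) 3 ?_
    · simpa using this
    intro j _
    split_ifs <;> simp [size]
  have hN : size (opNonMin n) ≤ n * (n + 1) := by
    have h : opNonMin n = (List.range n).flatMap fun j =>
        [((List.range n).filter fun i => i ≠ j).map fun i => (opVar n i j, true)] := by
      exact List.map_eq_flatMap ..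
    rw [h]
    have := size_flatMap_le (List.range n) (fun j =>
        [((List.range n).filter fun i => i ≠ j).map fun i => (opVar n i j, true)]) (n + 1) ?_
    · simpa using this
    intro j _
    simp only [size, List.map_cons, List.map_nil, List.sum_cons, List.sum_nil, List.length_map]
    have := List.length_filter_le (fun i => decide (i ≠ j)) (List.range n)
    simp only [List.length_range] at this
    omega
  rw [OP, size_append, size_append]
  nlinarith

/-! ### The lower bound for tree-like resolution -/

/-- The value of a variable of `OP n` under the ranks `f`, where an element of rank `0` is free:
it lies below all elements of positive rank, and free elements are not compared. -/
def rankVal (n : ℕ) (f : ℕ → ℕ) (x : ℕ) : Option Bool :=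
  -- The value on numbers that encode no variable is arbitrary. Being defined there ensures that an
  -- undetermined `x` always names two distinct elements below `n`.
  if x % n = x / n ∨ n ≤ x / n then some true
  else if f (x % n) < f (x / n) then some true
  else if f (x / n) < f (x % n) then some false
  else none

theorem rankVal_opVar {n : ℕ} {f : ℕ → ℕ} {i j : ℕ} (hi : i < n) (hj : j < n) (hij : i ≠ j) :
    rankVal n f (opVar n i j) =
      if f i < f j then some true else if f j < f i then some false else none := by
  rw [rankVal, opVar_mod hi, opVar_div hi, if_neg (by omega)]

/-- The new rank `m - 1` is positive and below all existing ranks, so the newly ranked element keeps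
its position relative to all ranked elements. Only its comparisons with unranked elements change,
and these had no value. -/
theorem rankVal_update {n : ℕ} {f : ℕ → ℕ} {m a x : ℕ} {b : Bool} (hn : 0 < n) (ha : f a = 0)
    (hf : ∀ i < n, f i ≠ 0 → m ≤ f i) (hm : 2 ≤ m) (h : rankVal n f x = some b) :
    rankVal n (Function.update f a (m - 1)) x = some b := by
  have hx := Nat.mod_lt x hn
  unfold rankVal at h ⊢
  split_ifs at h with h1 h2 h3
  · rw [if_pos h1]; exact h
  · rw [if_neg h1, if_pos, h]
    have := hf (x / n) (by omega) (by omega)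
    simp only [Function.update_apply]
    split_ifs with h4 h5 <;> try omega
    all_goals (subst_vars; omega)
  · rw [if_neg h1, if_neg, if_pos, h]
    all_goals
      have := hf (x % n) (by omega) (by omega)
      simp only [Function.update_apply]
      split_ifs with h4 h5 <;> try omega
    all_goals (subst_vars; omega)

/-- Adversary argument by induction on the tree. The number `m` is a lower bound both for the ranks
in use and for the count of unranked elements, so that `m - 1` is always available as the next rank.
An undetermined variable costs one unranked element and doubles the bound; a determined one passes
the bound to the premise that it falsifies. -/
theorem TreeRes.pow_le {n : ℕ} (hn : 0 < n) {C : Finset Lit} {s : ℕ} (h : TreeRes (OP n) C s) :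
    ∀ (m : ℕ) (f : ℕ → ℕ), (∀ i < n, ∀ j < n, f i = f j → f i ≠ 0 → i = j) →
      (∀ i < n, f i ≠ 0 → m ≤ f i) → m ≤ ((Finset.range n).filter fun i => f i = 0).card →
      (∀ l ∈ C, rankVal n f l.1 = some (!l.2)) → 2 ^ (m - 1) ≤ s := by
  induction h with
  | leaf C hC =>
    intro m f hinj hf hcard hfalse
    by_cases hm : m ≤ 1
    · have : m - 1 = 0 := by omega
      simp [this]
    exfalso
    have key : ∀ i j b, i < n → j < n → i ≠ j → (opVar n i j, b) ∈ C →
        if b then f j < f i else f i < f j := by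
      intro i j b hi hj hij hl
      have := hfalse _ (List.mem_toFinset.2 hl)
      rw [rankVal_opVar hi hj hij] at this
      split_ifs at this with h1 h2 <;> cases b <;> simp_all
    rcases mem_OP.1 hC with h | h | h
    · obtain ⟨i, j, k, hi, hj, hk, h1, h2, h3, rfl⟩ := mem_opTrans.1 h
      have a := key i j false hi hj h1 (by simp)
      have b := key j k false hj hk h3 (by simp)
      have c := key i k true hi hk (Ne.symm h2) (by simp)
      simp at a b c
      omega
    · obtain ⟨i, j, hi, hj, h1, rfl⟩ := mem_opAnti.1 h
      have a := key i j false hi hj h1 (by simp)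
      have b := key j i false hj hi (Ne.symm h1) (by simp)
      simp at a b
      omega
    · obtain ⟨j, hj, rfl⟩ := mem_opNonMin.1 h
      -- If the non-minimality clause of `j` is false, then every other element is ranked above `j`,
      -- hence only `j` can be unranked.
      have : ((Finset.range n).filter fun i => f i = 0).card ≤ ({j} : Finset ℕ).card := by
        apply Finset.card_le_card
        intro i hi
        simp only [Finset.mem_filter, Finset.mem_range] at hi
        by_contra hij
        rw [Finset.mem_singleton] at hij
        have a := key i j true hi.1 hj hij (List.mem_map.2 ⟨i, by simp [hi.1, hij], rfl⟩)
        simp at a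
        omega
      rw [Finset.card_singleton] at this
      omega
  | resolve x C D s t hx hx' hC hD ihC ihD =>
    intro m f hinj hf hcard hfalse
    have hC' : ∀ l ∈ C, l ≠ (x, true) → rankVal n f l.1 = some (!l.2) := fun l hl hne =>
      hfalse l (Finset.mem_union_left _ (Finset.mem_erase.2 ⟨hne, hl⟩))
    have hD' : ∀ l ∈ D, l ≠ (x, false) → rankVal n f l.1 = some (!l.2) := fun l hl hne =>
      hfalse l (Finset.mem_union_right _ (Finset.mem_erase.2 ⟨hne, hl⟩))
    by_cases hm : m ≤ 1
    · have : m - 1 = 0 := by omega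
      simp [this]
    rcases hv : rankVal n f x with _ | _ | _
    · set i := x % n with hi
      set j := x / n with hj
      have hin : i < n := Nat.mod_lt x hn
      have hxe : x = opVar n i j := by
        rw [opVar, hi, hj, Nat.mul_comm]; exact (Nat.div_add_mod x n).symm
      have hv' := hv
      rw [rankVal, ← hi, ← hj] at hv'
      split_ifs at hv' with h1 h2 h3
      have hjn : j < n := by omega
      have hij : i ≠ j := by omega
      have hi0 : f i = 0 := by
        by_contra h0
        exact hij (hinj i hin j hjn (by omega) h0)
      have hj0 : f j = 0 := by omega
      -- Ranking one unranked element with `m - 1` reestablishes the invariant for `m - 1`.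
      have step : ∀ a, a < n → f a = 0 → ∀ E : Finset Lit,
          (∀ l ∈ E, rankVal n (Function.update f a (m - 1)) l.1 = some (!l.2)) → ∀ u,
          (∀ (m : ℕ) (f : ℕ → ℕ), (∀ i < n, ∀ j < n, f i = f j → f i ≠ 0 → i = j) →
            (∀ i < n, f i ≠ 0 → m ≤ f i) →
            m ≤ ((Finset.range n).filter fun i => f i = 0).card →
            (∀ l ∈ E, rankVal n f l.1 = some (!l.2)) → 2 ^ (m - 1) ≤ u) →
          2 ^ (m - 1 - 1) ≤ u := by
        intro a ha ha0 E hE u ih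
        refine ih (m - 1) (Function.update f a (m - 1)) ?_ ?_ ?_ hE
        · intro p hp q hq
          have h1 := hinj p hp q hq
          have h2 := hf p hp
          have h3 := hf q hq
          simp only [Function.update_apply]
          split_ifs with h4 h5 <;> intro h6 h7 <;> omega
        · intro p hp
          have h2 := hf p hp
          simp only [Function.update_apply]
          split_ifs with h4 <;> omega
        · have : ((Finset.range n).filter fun i => f i = 0).erase a ⊆
              (Finset.range n).filter fun i => Function.update f a (m - 1) i = 0 := by
            intro p hp
            simp only [Finset.mem_erase, Finset.mem_filter] at hp ⊢
            refine ⟨hp.2.1, ?_⟩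
            rw [Function.update_of_ne hp.1, hp.2.2]
          have h2 := Finset.card_le_card this
          rw [Finset.card_erase_of_mem (by simp [ha, ha0])] at h2
          omega
      -- Ranking `i` puts it above the still unranked `j` and makes `x` false, which falsifies the
      -- premise with the positive literal. Ranking `j` instead, below, serves the other premise.
      have e1 := step i hin hi0 C (fun l hl => by
        by_cases hlx : l = (x, true)
        · subst hlx
          simp only [Bool.not_true]
          rw [hxe, rankVal_opVar hin hjn hij, Function.update_self,
            Function.update_of_ne (Ne.symm hij), if_neg (by omega), if_pos (by omega)]
        · exact rankVal_update hn hi0 hf (by omega) (hC' l hl hlx)) s ihC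
      have e2 := step j hjn hj0 D (fun l hl => by
        by_cases hlx : l = (x, false)
        · subst hlx
          simp only [Bool.not_false]
          rw [hxe, rankVal_opVar hin hjn hij, Function.update_self,
            Function.update_of_ne hij, if_pos (by omega)]
        · exact rankVal_update hn hj0 hf (by omega) (hD' l hl hlx)) t ihD
      have : m - 1 = (m - 1 - 1) + 1 := by omega
      rw [this, pow_succ]
      omega
    · have := ihC m f hinj hf hcard fun l hl => by
        by_cases hlx : l = (x, true)
        · subst hlx; simpa using hv
        · exact hC' l hl hlx
      omega
    · have := ihD m f hinj hf hcard fun l hl => by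
        by_cases hlx : l = (x, false)
        · subst hlx; simpa using hv
        · exact hD' l hl hlx
      omega

theorem TreeRefutes.pow_le {n s : ℕ} (hn : 0 < n) (h : TreeRefutes (OP n) s) :
    2 ^ (n - 1) ≤ s := by
  refine TreeRes.pow_le hn h n (fun _ => 0) ?_ ?_ ?_ ?_ <;> simp

theorem treeLike_exponential : ∃ ε : ℝ, 0 < ε ∧ ∀ᶠ n : ℕ in Filter.atTop, ∀ s : ℕ,
    TreeRefutes (OP n) s → (2 : ℝ) ^ (ε * (n : ℝ)) ≤ (s : ℝ) := by
  refine ⟨1 / 2, by norm_num, ?_⟩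
  filter_upwards [Filter.eventually_ge_atTop 2] with n hn s hs
  have h1 := hs.pow_le (by omega)
  have h2 : (2 : ℝ) ^ (1 / 2 * (n : ℝ)) ≤ (2 : ℝ) ^ ((n - 1 : ℕ) : ℝ) := by
    apply Real.rpow_le_rpow_of_exponent_le (by norm_num)
    have : (2 : ℝ) ≤ n := by exact_mod_cast hn
    rw [Nat.cast_sub (by omega)]
    push_cast
    linarith
  rw [Real.rpow_natCast] at h2
  exact h2.trans (by exact_mod_cast h1)

/-! ### Solvers equivalent to tree-like resolution -/

theorem eval_le_pow (p : Polynomial ℕ) (y : ℕ) :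
    p.eval y ≤ p.eval 1 * (y + 1) ^ p.natDegree := by
  rw [Polynomial.eval_eq_sum_range, Polynomial.eval_eq_sum_range, Finset.sum_mul]
  refine Finset.sum_le_sum fun i hi => ?_
  rw [one_pow, mul_one]
  refine Nat.mul_le_mul_left _ ?_
  exact (Nat.pow_le_pow_left (Nat.le_succ y) i).trans
    (Nat.pow_le_pow_right (Nat.succ_pos y) (Finset.mem_range_succ_iff.1 hi))

theorem eventually_poly_le_rpow {ε : ℝ} (hε : 0 < ε) (k : ℕ) (c : ℝ) :
    ∀ᶠ n : ℕ in Filter.atTop, c * (n : ℝ) ^ k ≤ (2 : ℝ) ^ (ε * (n : ℝ)) := by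
  have h1 : (1 : ℝ) < 2 ^ ε := Real.one_lt_rpow (by norm_num) hε
  have h2 := (isLittleO_pow_const_const_pow_of_one_lt (R := ℝ) k h1).def
    (c := 1 / (|c| + 1)) (by positivity)
  filter_upwards [h2] with n hn
  rw [Real.norm_of_nonneg (by positivity), Real.norm_of_nonneg (by positivity)] at hn
  rw [Real.rpow_mul (by norm_num), Real.rpow_natCast]
  calc c * (n : ℝ) ^ k ≤ (|c| + 1) * (n : ℝ) ^ k := by
        gcongr; linarith [le_abs_self c]
    _ ≤ (|c| + 1) * (1 / (|c| + 1) * ((2 : ℝ) ^ ε) ^ n) := by gcongr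
    _ = _ := by field_simp

/-- If the time were below `2 ^ (ε n)`, the extracted refutation would have size at most a constant
times the `d`-th power of that, where `d` is the degree of the overhead; for small `ε` this is less
than `2 ^ (n - 1)`. -/
theorem Solver.exponential_of_treeLike (S : Solver) (hS : S.PolyEquivTreeLike) :
    ∃ ε : ℝ, 0 < ε ∧ ∀ᶠ n : ℕ in Filter.atTop, ∀ t : ℕ,
      S.Refutes (OP n) t → (2 : ℝ) ^ (ε * (n : ℝ)) ≤ (t : ℝ) := by
  obtain ⟨⟨p, hp⟩, -⟩ := hS
  set d := p.natDegree with hd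
  -- With this choice the `d`-th power of `2 ^ (ε n)` is at most `2 ^ (n / 4)`. A second factor `2 ^
  -- (n / 4)` absorbs the constant `p.eval 1 * 2 ^ d`, and the product `2 ^ (n / 2)` is still below
  -- `2 ^ (n - 1)`.
  set ε : ℝ := 1 / (4 * (d + 1)) with hε
  have hε0 : 0 < ε := by positivity
  refine ⟨ε, hε0, ?_⟩
  filter_upwards [Filter.eventually_ge_atTop 4, eventually_poly_le_rpow hε0 3 10,
    eventually_poly_le_rpow (ε := 1 / 4) (by norm_num) 0 (p.eval 1 * 2 ^ d + 1 : ℕ)]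
    with n hn h1 h2 t ht
  by_contra hlt
  rw [not_le] at hlt
  obtain ⟨s, hs, hs'⟩ := hp _ _ ht
  have hlow := hs'.pow_le (by omega)
  have hsize := size_OP_le n
  have hn1 : 1 ≤ n := by omega
  have hsz : ((size (OP n) : ℕ) : ℝ) + 1 ≤ 2 ^ (ε * (n : ℝ)) := by
    refine le_trans ?_ h1
    have : size (OP n) + 1 ≤ 10 * n ^ 3 := by nlinarith [pow_pos (show 0 < n by omega) 2]
    exact_mod_cast this
  have hy : ((size (OP n) + t + 1 : ℕ) : ℝ) ≤ 2 * 2 ^ (ε * (n : ℝ)) := by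
    push_cast; linarith
  have hup : ((2 : ℝ) ^ (n - 1)) ≤ ((p.eval 1 : ℕ) : ℝ) * (2 * (2 : ℝ) ^ (ε * (n : ℝ))) ^ d := by
    calc ((2 : ℝ) ^ (n - 1)) ≤ (s : ℝ) := by exact_mod_cast hlow
      _ ≤ ((p.eval 1 * (size (OP n) + t + 1) ^ d : ℕ) : ℝ) := by
          exact_mod_cast hs.trans (eval_le_pow p _)
      _ = p.eval 1 * ((size (OP n) + t + 1 : ℕ) : ℝ) ^ d := by push_cast; rfl
      _ ≤ _ := by gcongr
  have hd1 : ((2 : ℝ) ^ (ε * (n : ℝ))) ^ d ≤ 2 ^ (1 / 4 * (n : ℝ)) := by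
    rw [← Real.rpow_natCast, ← Real.rpow_mul (by norm_num)]
    apply Real.rpow_le_rpow_of_exponent_le (by norm_num)
    have : ε * d ≤ 1 / 4 := by
      rw [hε, div_mul_eq_mul_div, div_le_div_iff₀ (by positivity) (by norm_num)]
      linarith
    nlinarith [(Nat.cast_nonneg n : (0 : ℝ) ≤ n)]
  have hc : ((p.eval 1 : ℕ) : ℝ) * 2 ^ d < 2 ^ (1 / 4 * (n : ℝ)) := by
    push_cast at h2
    simp at h2 ⊢
    linarith
  have hfin : ((2 : ℝ) ^ (n - 1)) < 2 ^ (1 / 4 * (n : ℝ)) * 2 ^ (1 / 4 * (n : ℝ)) := by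
    calc _ ≤ ((p.eval 1 : ℕ) : ℝ) * (2 * (2 : ℝ) ^ (ε * (n : ℝ))) ^ d := hup
      _ = (((p.eval 1 : ℕ) : ℝ) * (2 : ℝ) ^ d) * ((2 : ℝ) ^ (ε * (n : ℝ))) ^ d := by
          rw [mul_pow]; ring
      _ ≤ (((p.eval 1 : ℕ) : ℝ) * (2 : ℝ) ^ d) * (2 : ℝ) ^ (1 / 4 * (n : ℝ)) := by gcongr
      _ < _ := by gcongr
  rw [← Real.rpow_add (by norm_num), ← Real.rpow_natCast,
    Real.rpow_lt_rpow_left_iff (by norm_num), Nat.cast_sub hn1] at hfin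
  have : (4 : ℝ) ≤ n := by exact_mod_cast hn
  push_cast at hfin
  linarith

/-! ### DPLL and tree-like resolution -/

theorem neg_neg_lit (l : Lit) : neg (neg l) = l := by simp [neg]

theorem neg_ne (l : Lit) : neg l ≠ l := by
  obtain ⟨x, b⟩ := l
  cases b <;> simp [neg]

theorem neg_injective : Function.Injective neg := fun a b h => by
  rw [← neg_neg_lit a, h, neg_neg_lit]

/-- Resolution on a literal of either sign. -/
theorem TreeRes.resolve_lit {F : CNF} {C D : Finset Lit} {s t : ℕ} (l : Lit)
    (hl : l ∈ C) (hl' : neg l ∈ D) (hC : TreeRes F C s) (hD : TreeRes F D t) :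
    TreeRes F (C.erase l ∪ D.erase (neg l)) (s + t + 1) := by
  obtain ⟨x, b⟩ := l
  cases b
  · have := TreeRes.resolve x D C t s hl' hl hD hC
    rw [Finset.union_comm, Nat.add_comm t s] at this
    exact this
  · exact TreeRes.resolve x C D s t hl hl' hC hD

/-- `ρ` has a derivation of size at most `s` of a clause that it falsifies. -/
def Closed (F : CNF) (ρ : List Lit) (s : ℕ) : Prop :=
  ∃ C u, u ≤ s ∧ TreeRes F C u ∧ ∀ l ∈ C, neg l ∈ ρ

/-- Resolve the two clauses on the branching variable if both contain it; otherwise one of them is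
already falsified without the branching literal. -/
theorem Closed.branch {F : CNF} {ρ : List Lit} {l : Lit} {s t : ℕ} (h₁ : Closed F (l :: ρ) s)
    (h₂ : Closed F (neg l :: ρ) t) : Closed F ρ (s + t + 1) := by
  obtain ⟨C, u, hu, hC, hCρ⟩ := h₁
  obtain ⟨D, v, hv, hD, hDρ⟩ := h₂
  by_cases hl : neg l ∈ C
  · by_cases hl' : l ∈ D
    · refine ⟨_, _, ?_, TreeRes.resolve_lit l hl' hl hD hC, ?_⟩
      · omega
      · intro m hm
        simp only [Finset.mem_union, Finset.mem_erase] at hm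
        rcases hm with ⟨hne, hm⟩ | ⟨hne, hm⟩
        · rcases List.mem_cons.1 (hDρ m hm) with h | h
          · exact absurd (neg_injective h) hne
          · exact h
        · rcases List.mem_cons.1 (hCρ m hm) with h | h
          · exact absurd (by rw [← h, neg_neg_lit]) hne
          · exact h
    · refine ⟨D, v, by omega, hD, fun m hm => ?_⟩
      rcases List.mem_cons.1 (hDρ m hm) with h | h
      · exact absurd (neg_injective h ▸ hm) hl'
      · exact h
  · refine ⟨C, u, by omega, hC, fun m hm => ?_⟩
    rcases List.mem_cons.1 (hCρ m hm) with h | h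
    · exact absurd (by rw [← h, neg_neg_lit]; exact hm) hl
    · exact h

/-- Read the run backwards: every assignment on the stack has a derived clause that it falsifies,
and `L` lists bounds for the derivation sizes. A conflict contributes 1, a branching 1, and a
propagation 2, since it amounts to a branching whose other side is closed by the unit clause. Hence
the factor 2. -/
theorem dpll_run_closed {s s' : dpll.State} {t : ℕ} (h : dpll.Run s t s')
    (hs' : s'.2 = []) : ∃ L : List ℕ, List.Forall₂ (Closed s.1) s.2 L ∧ L.sum ≤ 2 * t := by
  induction h with
  | refl s => exact ⟨[], by rw [show s.2 = [] from hs']; exact List.Forall₂.nil, by simp⟩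
  | head s s₁ s₂ c t hstep hrun ih =>
    obtain ⟨L, hL, hsum⟩ := ih hs'
    obtain ⟨rfl, hstep⟩ := hstep
    cases hstep with
    | conflict F ρ R C hC hf =>
      refine ⟨1 :: L, List.Forall₂.cons ?_ hL, by simp; omega⟩
      exact ⟨_, 1, le_rfl, TreeRes.leaf C hC, fun l hl => hf l (List.mem_toFinset.1 hl)⟩
    | propagate F ρ R C l hC hno hu =>
      cases hL with
      | cons h1 h2 =>
        rename_i a L
        refine ⟨(a + 1 + 1) :: L, List.Forall₂.cons ?_ h2, ?_⟩
        · refine Closed.branch h1 ⟨_, 1, le_rfl, TreeRes.leaf C hC, fun m hm => ?_⟩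
          by_cases hml : m = l
          · rw [hml]; simp
          · exact List.mem_cons_of_mem _ (hu.2.2.2 m (List.mem_toFinset.1 hm) hml)
        · simp at hsum ⊢; omega
    | branch F ρ R C l hC hl hno hnu h h' =>
      cases hL with
      | cons h1 h2 =>
        cases h2 with
        | cons h2 h3 =>
          rename_i L
          exact ⟨(_ + _ + 1) :: L, List.Forall₂.cons (Closed.branch h1 h2) h3, by
            simp at hsum ⊢; omega⟩

theorem treeRes_vars {F : CNF} {C : Finset Lit} {s : ℕ} (h : TreeRes F C s) :
    ∀ l ∈ C, ∃ D ∈ F, l ∈ D := by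
  induction h with
  | leaf C hC => exact fun l hl => ⟨C, hC, List.mem_toFinset.1 hl⟩
  | resolve x C D s t hx hx' hC hD ihC ihD =>
    intro l hl
    rcases Finset.mem_union.1 hl with h | h
    · exact ihC l (Finset.mem_of_mem_erase h)
    · exact ihD l (Finset.mem_of_mem_erase h)

theorem TreeRes.pos {F : CNF} {C : Finset Lit} {s : ℕ} (h : TreeRes F C s) : 0 < s := by
  cases h <;> omega

/-- The literals over the variables of `F` that are not assigned by `ρ`. -/
def freeVars (F : CNF) (ρ : List Lit) : Finset ℕ :=
  (F.flatten.map Prod.fst).toFinset.filter fun x => (x, true) ∉ ρ ∧ (x, false) ∉ ρ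

theorem freeVars_card_lt {F : CNF} {ρ : List Lit} {l : Lit} {C : Clause} (hC : C ∈ F)
    (hl : l ∈ C ∨ neg l ∈ C) (h : l ∉ ρ) (h' : neg l ∉ ρ) (m : Lit) (hm : m.1 = l.1) :
    (freeVars F (m :: ρ)).card < (freeVars F ρ).card := by
  apply Finset.card_lt_card
  rw [Finset.ssubset_iff_of_subset]
  · refine ⟨l.1, ?_, ?_⟩
    · simp only [freeVars, Finset.mem_filter, List.mem_toFinset, List.mem_map, List.mem_flatten]
      refine ⟨?_, ?_⟩
      · rcases hl with hl | hl
        · exact ⟨l, ⟨C, hC, hl⟩, rfl⟩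
        · exact ⟨neg l, ⟨C, hC, hl⟩, rfl⟩
      · obtain ⟨x, b⟩ := l
        cases b <;> simp_all [neg]
    · obtain ⟨x, b⟩ := m
      simp only at hm
      subst hm
      cases b <;> simp [freeVars]
  · intro x
    simp only [freeVars, Finset.mem_filter, List.mem_cons, not_or]
    tauto

/-- DPLL follows the refutation tree from the root, keeping the current clause falsified. Conflicts
and forced propagations may interrupt at any node but only help: the clause remains falsified, and a
propagation uses up a free variable, which explains the factor `card + 1`. The induction is on tree
size plus number of free variables, since a propagation does not shrink the tree. -/
theorem dpll_run_of_treeRes {F : CNF} : ∀ (N s : ℕ) (C : Finset Lit) (ρ : List Lit),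
    TreeRes F C s → s + (freeVars F ρ).card ≤ N → (∀ l ∈ C, neg l ∈ ρ) →
    (∀ l ∈ ρ, neg l ∉ ρ) → ∀ (R : List (List Lit)) (t : ℕ) (s' : CNF × List (List Lit)),
    dpll.Run (F, R) t s' → ∃ t', t' ≤ t + s * ((freeVars F ρ).card + 1) ∧
      dpll.Run (F, ρ :: R) t' s' := by
  intro N
  induction N with
  | zero => intro s C ρ h hN; have := h.pos; omega
  | succ N ihN =>
    intro s C ρ hT hN hC hρ R t s' hR
    have hs := hT.pos
    have hmul : s ≤ s * ((freeVars F ρ).card + 1) := Nat.le_mul_of_pos_right s (by omega)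
    by_cases hconf : ∃ D ∈ F, Falsifies ρ D
    · obtain ⟨D, hD, hDf⟩ := hconf
      exact ⟨1 + t, by omega, Solver.Run.head (S := dpll) _ _ _ 1 t
        ⟨rfl, DPLLStep.conflict F ρ R D hD hDf⟩ hR⟩
    push Not at hconf
    have hcons : ∀ l, l ∉ ρ → neg l ∉ ρ → ∀ m ∈ l :: ρ, neg m ∉ l :: ρ := by
      intro l h h' m hm
      simp only [List.mem_cons, not_or] at hm ⊢
      rcases hm with rfl | hm
      · exact ⟨neg_ne _, h'⟩
      · refine ⟨fun h => ?_, hρ m hm⟩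
        rw [← h, neg_neg_lit] at h'
        exact h' hm
    by_cases hunit : ∃ D ∈ F, ∃ l, UnitUnder ρ D l
    · obtain ⟨D, hD, l, hu⟩ := hunit
      have hlt := freeVars_card_lt hD (Or.inl hu.1) hu.2.1 hu.2.2.1 l rfl
      obtain ⟨t', ht', hrun⟩ := ihN s C (l :: ρ) hT (by omega)
        (fun m hm => List.mem_cons_of_mem _ (hC m hm)) (hcons l hu.2.1 hu.2.2.1) R t s' hR
      refine ⟨1 + t', ?_, Solver.Run.head (S := dpll) _ _ _ 1 t'
        ⟨rfl, DPLLStep.propagate F ρ R D l hD hconf hu⟩ hrun⟩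
      have : s * ((freeVars F (l :: ρ)).card + 1) ≤ s * (freeVars F ρ).card :=
        Nat.mul_le_mul_left _ (by omega)
      rw [Nat.mul_succ]
      omega
    push Not at hunit
    cases hT with
    | leaf C hC' =>
      exact absurd (fun l hl => hC l (List.mem_toFinset.2 hl)) (hconf C hC')
    | resolve x C D s t₂ hx hx' hCd hDd =>
      have hC1 : ∀ l ∈ C, l ≠ (x, true) → neg l ∈ ρ := fun l hl hne =>
        hC l (Finset.mem_union_left _ (Finset.mem_erase.2 ⟨hne, hl⟩))
      have hD1 : ∀ l ∈ D, l ≠ (x, false) → neg l ∈ ρ := fun l hl hne =>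
        hC l (Finset.mem_union_right _ (Finset.mem_erase.2 ⟨hne, hl⟩))
      have hsC := hCd.pos
      have hsD := hDd.pos
      set c := (freeVars F ρ).card with hc
      have hexp : (s + t₂ + 1) * (c + 1) = s * (c + 1) + t₂ * (c + 1) + (c + 1) := by ring
      -- If the resolved variable is assigned already, one premise is falsified, and the descent to
      -- it costs no step of DPLL.
      by_cases h1 : (x, false) ∈ ρ
      · obtain ⟨t', ht', hrun⟩ := ihN s C ρ hCd (by omega) (fun l hl => by
          by_cases hlx : l = (x, true)
          · rw [hlx]; exact h1
          · exact hC1 l hl hlx) hρ R t s' hR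
        rw [← hc] at ht'
        exact ⟨t', by omega, hrun⟩
      by_cases h2 : (x, true) ∈ ρ
      · obtain ⟨t', ht', hrun⟩ := ihN t₂ D ρ hDd (by omega) (fun l hl => by
          by_cases hlx : l = (x, false)
          · rw [hlx]; exact h2
          · exact hD1 l hl hlx) hρ R t s' hR
        rw [← hc] at ht'
        exact ⟨t', by omega, hrun⟩
      obtain ⟨E, hE, hxE⟩ := treeRes_vars hCd _ hx
      have hn : neg (x, true) = (x, false) := rfl
      have hn' : neg (x, false) = (x, true) := rfl
      have lt1 := freeVars_card_lt hE (Or.inl hxE) h2 (by rw [hn]; exact h1) (x, true) rfl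
      have lt2 := freeVars_card_lt hE (Or.inl hxE) h2 (by rw [hn]; exact h1) (x, false) rfl
      -- The continuation is built from its end: the branch lower on the stack, with `x` false, is
      -- treated first, and its run becomes the continuation of the branch with `x` true.
      obtain ⟨t', ht', hrun⟩ := ihN s C ((x, false) :: ρ) hCd (by omega) (fun l hl => by
          by_cases hlx : l = (x, true)
          · rw [hlx]; simp [neg]
          · exact List.mem_cons_of_mem _ (hC1 l hl hlx))
          (hcons _ h1 (by rw [hn']; exact h2)) R t s' hR
      obtain ⟨t'', ht'', hrun'⟩ := ihN t₂ D ((x, true) :: ρ) hDd (by omega) (fun l hl => by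
          by_cases hlx : l = (x, false)
          · rw [hlx]; simp [neg]
          · exact List.mem_cons_of_mem _ (hD1 l hl hlx))
          (hcons _ h2 (by rw [hn]; exact h1)) _ t' s' hrun
      refine ⟨1 + t'', ?_, Solver.Run.head (S := dpll) _ _ _ 1 t'' ⟨rfl,
        DPLLStep.branch F ρ R E (x, true) hE (Or.inl hxE) hconf hunit h2 h1⟩ hrun'⟩
      have e1 : s * ((freeVars F ((x, false) :: ρ)).card + 1) ≤ s * (c + 1) :=
        Nat.mul_le_mul_left _ (by omega)
      have e2 : t₂ * ((freeVars F ((x, true) :: ρ)).card + 1) ≤ t₂ * (c + 1) :=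
        Nat.mul_le_mul_left _ (by omega)
      omega

theorem freeVars_card_le_size (F : CNF) (ρ : List Lit) : (freeVars F ρ).card ≤ size F := by
  refine (Finset.card_filter_le _ _).trans ((List.toFinset_card_le _).trans ?_)
  rw [List.length_map, List.length_flatten, size]
  induction F with
  | nil => simp
  | cons C F ih => simp at ih ⊢; omega

theorem dpll_polyEquivTreeLike : dpll.PolyEquivTreeLike := by
  refine ⟨⟨2 * Polynomial.X, ?_⟩, ⟨Polynomial.X * (Polynomial.X + 1), ?_⟩⟩
  · rintro F t ⟨s, hrun, hs⟩
    obtain ⟨L, hL, hsum⟩ := dpll_run_closed hrun hs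
    change List.Forall₂ (Closed F) [[]] L at hL
    cases hL with
    | cons h1 h2 =>
      cases h2
      obtain ⟨C, u, hu, hC, hCe⟩ := h1
      have : C = ∅ := Finset.eq_empty_of_forall_notMem fun l hl => by simpa using hCe l hl
      subst this
      refine ⟨u, ?_, hC⟩
      simp at hsum ⊢
      omega
  · intro F s hs
    obtain ⟨t, ht, hrun⟩ := dpll_run_of_treeRes _ s ∅ [] hs le_rfl (by simp) (by simp) [] 0 _
      (Solver.Run.refl (S := dpll) (F, []))
    refine ⟨t, ?_, _, hrun, rfl⟩
    have := freeVars_card_le_size F []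
    simp only [Polynomial.eval_mul, Polynomial.eval_X, Polynomial.eval_add, Polynomial.eval_one]
    calc t ≤ s * ((freeVars F []).card + 1) := by omega
      _ ≤ (size F + s) * (size F + s + 1) := Nat.mul_le_mul (by omega) (by omega)

/-! ### Determinism -/

theorem cdcl_deterministic (δ : ℚ) : (cdcl δ).Deterministic := by
  constructor
  · intro s c₁ s₁ c₂ s₂ h₁ h₂
    have h : some (⟨s₁, c₁⟩ : Timed CDCLState) = some ⟨s₂, c₂⟩ := h₁.symm.trans h₂
    cases h
    exact ⟨rfl, rfl⟩
  · rintro s c s₁ hs h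
    have hs : s = CDCLState.unsat := hs
    subst hs
    cases h

/-! ### Values of the timed computations -/

@[simp] theorem val_bind {α β : Type} (x : Timed α) (f : α → Timed β) :
    (x >>= f).val = (f x.val).val := rfl

@[simp] theorem cost_bind {α β : Type} (x : Timed α) (f : α → Timed β) :
    (x >>= f).cost = x.cost + (f x.val).cost := rfl

@[simp] theorem val_pure {α : Type} (a : α) : (pure a : Timed α).val = a := rfl

@[simp] theorem cost_pure {α : Type} (a : α) : (pure a : Timed α).cost = 0 := rfl

@[simp] theorem cost_tick (c : ℕ) : (tick c).cost = c := rfl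

/-! ### Trails as partial assignments, and the status of clauses -/

/-- The literals of a trail. -/
abbrev lits (tr : List Entry) : List Lit := tr.map Entry.lit

theorem lits_append (tr tr' : List Entry) : lits (tr ++ tr') = lits tr ++ lits tr' :=
  List.map_append

/-- No variable is assigned twice. -/
def NodupVars (tr : List Entry) : Prop := (tr.map fun e => e.lit.1).Nodup

theorem eq_or_eq_neg {l m : Lit} (h : l.1 = m.1) : l = m ∨ l = neg m := by
  obtain ⟨x, b⟩ := l
  obtain ⟨y, c⟩ := m
  simp only at h
  subst h
  cases b <;> cases c <;> simp [neg]

theorem NodupVars.notMem {e : Entry} {tr : List Entry} (h : NodupVars (e :: tr)) {l : Lit}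
    (hl : e.lit.1 = l.1) : l ∉ lits tr ∧ neg l ∉ lits tr := by
  rw [NodupVars, List.map_cons, List.nodup_cons] at h
  constructor <;>
  · intro hm
    obtain ⟨e', he', h'⟩ := List.mem_map.1 hm
    exact h.1 (List.mem_map.2 ⟨e', he', by simp [h', hl, neg]⟩)

theorem NodupVars.tail {e : Entry} {tr : List Entry} (h : NodupVars (e :: tr)) :
    NodupVars tr := (List.nodup_cons.1 h).2

theorem NodupVars.consistent {tr : List Entry} (h : NodupVars tr) {l : Lit} (hl : l ∈ lits tr) :
    neg l ∉ lits tr := by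
  induction tr with
  | nil => simp
  | cons e tr ih =>
    rcases List.mem_cons.1 hl with hl' | hl'
    · intro h'
      rcases List.mem_cons.1 h' with h' | h'
      · exact neg_ne l (h'.trans hl'.symm)
      · exact (h.notMem (l := l) (by rw [hl'])).2 h'
    · intro h'
      rcases List.mem_cons.1 h' with h' | h'
      · exact (h.notMem (l := l) (by rw [← h']; rfl)).1 hl'
      · exact ih h.tail hl' h'

theorem litValue_val {tr : List Entry} (h : NodupVars tr) (l : Lit) :
    (litValue tr l).val =
      if l ∈ lits tr then some true else if neg l ∈ lits tr then some false else none := by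
  induction tr with
  | nil => simp [litValue]
  | cons e tr ih =>
    simp only [litValue, val_bind]
    split_ifs with h1 h2 h3 h2 h3
    · rcases eq_or_eq_neg h1 with he | he
      · simp [he]
      · exact absurd ((List.mem_cons.1 h2).resolve_right (h.notMem h1).1)
          (by rw [he]; exact (neg_ne l).symm)
    · rcases eq_or_eq_neg h1 with he | he
      · exact absurd (by rw [← he]; simp) h2
      · rw [he]; obtain ⟨x, b⟩ := l; cases b <;> simp [neg]
    · rcases eq_or_eq_neg h1 with he | he
      · exact absurd (by rw [← he]; simp) h2
      · exact absurd (by rw [← he]; simp) h3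
    · rw [ih h.tail, if_pos]
      exact (List.mem_cons.1 h2).resolve_left fun h' => h1 (by rw [h'])
    · rw [ih h.tail, if_neg, if_pos]
      · exact (List.mem_cons.1 h3).resolve_left fun h' => h1 (by rw [← h']; rfl)
      · exact fun h' => h2 (List.mem_cons_of_mem _ h')
    · rw [ih h.tail, if_neg, if_neg]
      · exact fun h' => h3 (List.mem_cons_of_mem _ h')
      · exact fun h' => h2 (List.mem_cons_of_mem _ h')

/-- The four outcomes are recorded by properties that exclude each other on a consistent trail, so
that the converse implications can be recovered. For `undetermined` it suffices to have two distinct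
literals that are not false; the recursion compares literals, hence a repeated literal does not hide
a unit clause. -/
theorem clauseStatus_spec {tr : List Entry} (h : NodupVars tr) (C : Clause) :
    match (clauseStatus tr C).val with
    | .satisfied => ∃ l ∈ C, l ∈ lits tr
    | .falsified => Falsifies (lits tr) C
    | .unit l => UnitUnder (lits tr) C l
    | .undetermined => (∃ l ∈ C, ∃ m ∈ C, l ≠ m ∧ neg l ∉ lits tr ∧ neg m ∉ lits tr) := by
  induction C with
  | nil => simp [clauseStatus, Falsifies]
  | cons l C ih =>
    simp only [clauseStatus, val_bind, litValue_val h]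
    by_cases h1 : l ∈ lits tr
    · simp only [if_pos h1, val_pure]
      exact ⟨l, by simp, h1⟩
    by_cases h2 : neg l ∈ lits tr
    · simp only [if_neg h1, if_pos h2]
      generalize (clauseStatus tr C).val = r at ih ⊢
      cases r with
      | satisfied => exact ih.imp fun m hm => ⟨by simp [hm.1], hm.2⟩
      | falsified => exact fun m hm => (List.mem_cons.1 hm).elim (fun h => h ▸ h2) (ih m)
      | unit u =>
        exact ⟨by simp [ih.1], ih.2.1, ih.2.2.1, fun m hm hne => (List.mem_cons.1 hm).elim
          (fun h => h ▸ h2) fun hm => ih.2.2.2 m hm hne⟩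
      | undetermined =>
        obtain ⟨m, hm, m', hm', h⟩ := ih
        exact ⟨m, by simp [hm], m', by simp [hm'], h⟩
    · simp only [if_neg h1, if_neg h2, val_bind]
      generalize (clauseStatus tr C).val = r at ih ⊢
      cases r with
      | satisfied => exact ih.imp fun m hm => ⟨by simp [hm.1], hm.2⟩
      | falsified =>
        exact ⟨by simp, h1, h2, fun m hm hne => ih m ((List.mem_cons.1 hm).resolve_left hne)⟩
      | unit u =>
        by_cases hlu : l = u
        · simp only [if_pos hlu, val_pure]
          subst hlu
          exact ⟨by simp, h1, h2, fun m hm hne =>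
            ih.2.2.2 m ((List.mem_cons.1 hm).resolve_left hne) hne⟩
        · simp only [if_neg hlu, val_pure]
          exact ⟨l, by simp, u, by simp [ih.1], hlu, h2, ih.2.2.1⟩
      | undetermined =>
        obtain ⟨m, hm, m', hm', h⟩ := ih
        exact ⟨m, by simp [hm], m', by simp [hm'], h⟩

theorem clauseStatus_falsified {tr : List Entry} (h : NodupVars tr) {C : Clause} :
    (clauseStatus tr C).val = .falsified ↔ Falsifies (lits tr) C := by
  have := clauseStatus_spec h C
  constructor
  · intro h'; rwa [h'] at this
  · intro hf
    generalize (clauseStatus tr C).val = r at this ⊢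
    cases r with
    | satisfied => obtain ⟨l, hl, hl'⟩ := this; exact absurd (hf l hl) (h.consistent hl')
    | falsified => rfl
    | unit u => exact absurd (hf u this.1) this.2.2.1
    | undetermined => obtain ⟨l, hl, m, hm, hne, h1, h2⟩ := this; exact absurd (hf l hl) h1

theorem clauseStatus_unit {tr : List Entry} (h : NodupVars tr) {C : Clause} {u : Lit} :
    (clauseStatus tr C).val = .unit u ↔ UnitUnder (lits tr) C u := by
  have := clauseStatus_spec h C
  constructor
  · intro h'; rwa [h'] at this
  · intro hu
    generalize (clauseStatus tr C).val = r at this ⊢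
    cases r with
    | satisfied =>
      obtain ⟨l, hl, hl'⟩ := this
      by_cases hlu : l = u
      · exact absurd hl' (hlu ▸ hu.2.1)
      · exact absurd (hu.2.2.2 l hl hlu) (h.consistent hl')
    | falsified => exact absurd (this u hu.1) hu.2.2.1
    | unit v =>
      by_cases hvu : u = v
      · rw [hvu]
      · exact absurd (this.2.2.2 u hu.1 hvu) hu.2.2.1
    | undetermined =>
      obtain ⟨l, hl, m, hm, hne, h1, h2⟩ := this
      by_cases hlu : l = u
      · exact absurd (hu.2.2.2 m hm fun h => hne (hlu.trans h.symm)) h2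
      · exact absurd (hu.2.2.2 l hl hlu) h1

theorem findConflict_none {tr : List Entry} (h : NodupVars tr) {Γ : List Clause}
    (hΓ : ∀ C ∈ Γ, ¬ Falsifies (lits tr) C) : (findConflict tr Γ).val = none := by
  induction Γ with
  | nil => simp [findConflict]
  | cons C Γ ih =>
    have h1 := mt (clauseStatus_falsified h).1 (hΓ C (by simp))
    simp only [findConflict, val_bind]
    generalize (clauseStatus tr C).val = r at h1 ⊢
    cases r <;> simp_all

theorem findConflict_some {tr : List Entry} (h : NodupVars tr) {Γ : List Clause}
    (hΓ : ∃ C ∈ Γ, Falsifies (lits tr) C) :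
    ∃ C ∈ Γ, Falsifies (lits tr) C ∧ (findConflict tr Γ).val = some C := by
  induction Γ with
  | nil => simp at hΓ
  | cons C Γ ih =>
    by_cases hC : Falsifies (lits tr) C
    · refine ⟨C, by simp, hC, ?_⟩
      simp [findConflict, (clauseStatus_falsified h).2 hC]
    · obtain ⟨D, hD, hf, hs⟩ := ih (by simpa [hC] using hΓ)
      refine ⟨D, by simp [hD], hf, ?_⟩
      have h1 := mt (clauseStatus_falsified h).1 hC
      simp only [findConflict, val_bind]
      generalize (clauseStatus tr C).val = r at h1 ⊢
      cases r <;> simp_all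

theorem litMem_val (l : Lit) (C : Clause) : (litMem l C).val = decide (l ∈ C) := by
  induction C with
  | nil => simp [litMem]
  | cons m C ih =>
    simp only [litMem, val_bind]
    split_ifs with h
    · simp [h]
    · rw [ih]; simp [Ne.symm h]

theorem varMem_val (x : ℕ) (C : Clause) : (varMem x C).val = decide (∃ l ∈ C, l.1 = x) := by
  induction C with
  | nil => simp [varMem]
  | cons m C ih =>
    simp only [varMem, val_bind]
    split_ifs with h
    · simp [h]
    · rw [ih]; simp [h]

/-! ### Unit propagation in one pass -/

/-- The clauses that are visited when `p` is propagated. -/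
def Visits (p : Option Lit) (C : Clause) : Prop := ∀ l ∈ p, neg l ∈ C

theorem concerns_val (p : Option Lit) (C : Clause) : (concerns p C).val = true ↔ Visits p C := by
  cases p <;> simp [concerns, Visits, litMem_val]

/-- One pass through the database from the assignment `S` puts on the trail only literals from `W`,
provided that under all assignments between `S` and `S ∪ W` only literals of `W` are implied. -/
theorem saturate_spec_aux (p : Option Lit) (lvl : ℕ) (S W : Lit → Prop) :
    ∀ (Γ : List Clause) (tr : List Entry), NodupVars tr → (∀ l ∈ lits tr, S l ∨ W l) →
    (∀ l, S l → l ∈ lits tr) →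
    (∀ C ∈ Γ, Visits p C → ∀ w ∈ C, (∀ l ∈ C, l ≠ w → S (neg l) ∨ W (neg l)) →
      S w ∨ S (neg w) ∨ W w) →
    ∃ new, (saturate p lvl Γ tr).val = (new ++ tr, (lits new).reverse) ∧ NodupVars (new ++ tr) ∧
      (∀ l ∈ lits new, W l) ∧
      (∀ e ∈ new, e.level = lvl ∧ ∃ C ∈ Γ, e.reason = some C ∧ Visits p C ∧ e.lit ∈ C ∧
        ∀ l ∈ C, l ≠ e.lit → S (neg l) ∨ W (neg l)) ∧
      (∀ C ∈ Γ, Visits p C → ∀ w ∈ C, neg w ∉ lits (new ++ tr) →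
        (∀ l ∈ C, l ≠ w → S (neg l)) → w ∈ lits (new ++ tr)) := by
  intro Γ
  induction Γ with
  | nil =>
    intro tr hnd hSW hS hsound
    exact ⟨[], by simp [saturate], by simpa using hnd, by simp, by simp, by simp⟩
  | cons C Γ ih =>
    intro tr hnd hSW hS hsound
    have hsound' : ∀ D ∈ Γ, Visits p D → ∀ w ∈ D,
        (∀ l ∈ D, l ≠ w → S (neg l) ∨ W (neg l)) → S w ∨ S (neg w) ∨ W w :=
      fun D hD => hsound D (List.mem_cons_of_mem _ hD)
    have skip : (saturate p lvl (C :: Γ) tr).val = (saturate p lvl Γ tr).val →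
        (Visits p C → ∀ w, ¬ UnitUnder (lits tr) C w) → ∃ new,
        (saturate p lvl (C :: Γ) tr).val = (new ++ tr, (lits new).reverse) ∧
        NodupVars (new ++ tr) ∧ (∀ l ∈ lits new, W l) ∧
        (∀ e ∈ new, e.level = lvl ∧ ∃ D ∈ C :: Γ, e.reason = some D ∧ Visits p D ∧ e.lit ∈ D ∧
          ∀ l ∈ D, l ≠ e.lit → S (neg l) ∨ W (neg l)) ∧
        (∀ D ∈ C :: Γ, Visits p D → ∀ w ∈ D, neg w ∉ lits (new ++ tr) →
          (∀ l ∈ D, l ≠ w → S (neg l)) → w ∈ lits (new ++ tr)) := by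
      intro heq hnu
      obtain ⟨new, h1, h2, h3, h4, h5⟩ := ih tr hnd hSW hS hsound'
      refine ⟨new, heq.trans h1, h2, h3, fun e he => ?_, fun D hD hv w hw hnw hfal => ?_⟩
      · obtain ⟨h, D, hD, h'⟩ := h4 e he
        exact ⟨h, D, List.mem_cons_of_mem _ hD, h'⟩
      · rcases List.mem_cons.1 hD with rfl | hD
        -- A literal `w` still unassigned at the end was unassigned when this clause was reached.
        -- The other literals were false from the start, so the clause would have been unit at that
        -- time.
        · by_contra hcon
          simp only [List.map_append, List.mem_append, not_or] at hnw hcon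
          exact hnu hv w ⟨hw, hcon.2, hnw.2, fun l hl hne => hS _ (hfal l hl hne)⟩
        · exact h5 D hD hv w hw hnw hfal
    by_cases hv : Visits p C
    · have hv' := (concerns_val p C).2 hv
      by_cases hu : ∃ u, UnitUnder (lits tr) C u
      · obtain ⟨u, hu⟩ := hu
        -- The trail lies between `S` and `S ∪ W`, so the soundness hypothesis applies to this unit
        -- clause.
        have hWu : W u := by
          rcases hsound C (by simp) hv u hu.1 fun l hl hne => hSW _ (hu.2.2.2 l hl hne) with
            h | h | h
          · exact absurd (hS _ h) hu.2.1
          · exact absurd (hS _ h) hu.2.2.1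
          · exact h
        have hnd' : NodupVars (⟨u, lvl, some C⟩ :: tr) := by
          refine List.nodup_cons.2 ⟨fun hm => ?_, hnd⟩
          obtain ⟨e, he, heq⟩ := List.mem_map.1 hm
          rcases eq_or_eq_neg heq with h | h
          · exact hu.2.1 (List.mem_map.2 ⟨e, he, h⟩)
          · exact hu.2.2.1 (List.mem_map.2 ⟨e, he, h⟩)
        obtain ⟨new, h1, h2, h3, h4, h5⟩ := ih (⟨u, lvl, some C⟩ :: tr) hnd'
          (by
            intro l hl
            rcases List.mem_cons.1 hl with rfl | hl
            · exact Or.inr hWu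
            · exact hSW l hl)
          (fun l hl => List.mem_cons_of_mem _ (hS l hl)) hsound'
        refine ⟨new ++ [⟨u, lvl, some C⟩], ?_, ?_, ?_, ?_, ?_⟩
        · simp [saturate, hv', (clauseStatus_unit hnd).2 hu, h1]
        · simpa using h2
        · intro l hl
          simp only [List.map_append, List.mem_append, List.map_cons, List.map_nil,
            List.mem_singleton] at hl
          rcases hl with hl | rfl
          · exact h3 l hl
          · exact hWu
        · intro e he
          rcases List.mem_append.1 he with he | he
          · obtain ⟨h, D, hD, h'⟩ := h4 e he
            exact ⟨h, D, List.mem_cons_of_mem _ hD, h'⟩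
          · rw [List.mem_singleton] at he
            subst he
            exact ⟨rfl, C, by simp, rfl, hv, hu.1, fun l hl hne => hSW _ (hu.2.2.2 l hl hne)⟩
        · intro D hD hvD w hw hnw hfal
          rcases List.mem_cons.1 hD with rfl | hD
          · by_cases hwu : w = u
            · simp [hwu]
            · have := hu.2.2.2 w hw hwu
              exact absurd (by simp [this]) hnw
          · have := h5 D hD hvD w hw (by simpa using hnw) hfal
            simpa using this
      · refine skip ?_ fun _ w hw => hu ⟨w, hw⟩
        have h1 : ∀ u, (clauseStatus tr C).val ≠ .unit u := fun u h' =>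
          hu ⟨u, (clauseStatus_unit hnd).1 h'⟩
        simp only [saturate, val_bind, hv', if_true]
    · refine skip ?_ fun h => absurd h hv
      have hv' := mt (concerns_val p C).1 hv
      simp [saturate, hv']

theorem NodupVars.append_right {tr tr' : List Entry} (h : NodupVars (tr ++ tr')) :
    NodupVars tr' := by
  rw [NodupVars, List.map_append] at h
  exact h.of_append_right

/-- One pass through the database puts exactly the literals of `W` on the trail. -/
theorem saturate_spec {p : Option Lit} {lvl : ℕ} {Γ : List Clause} {tr : List Entry}
    (W : Lit → Prop) (hnd : NodupVars tr)
    (hW : ∀ w, W w → neg w ∉ lits tr ∧ ¬ W (neg w))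
    (hsound : ∀ C ∈ Γ, Visits p C → ∀ w ∈ C,
      (∀ l ∈ C, l ≠ w → neg l ∈ lits tr ∨ W (neg l)) → w ∈ lits tr ∨ neg w ∈ lits tr ∨ W w)
    (hcomp : ∀ w, W w → ∃ C ∈ Γ, Visits p C ∧ w ∈ C ∧ ∀ l ∈ C, l ≠ w → neg l ∈ lits tr) :
    ∃ new, (saturate p lvl Γ tr).val = (new ++ tr, (lits new).reverse) ∧ NodupVars (new ++ tr) ∧
      (∀ l, l ∈ lits (new ++ tr) ↔ l ∈ lits tr ∨ W l) ∧ (∀ l ∈ lits new, W l) ∧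
      (∀ e ∈ new, e.level = lvl ∧ ∃ C ∈ Γ, e.reason = some C ∧ Visits p C ∧ e.lit ∈ C ∧
        ∀ l ∈ C, l ≠ e.lit → neg l ∈ lits tr ∨ W (neg l)) := by
  obtain ⟨new, h1, h2, h3, h4, h5⟩ := saturate_spec_aux p lvl (· ∈ lits tr) W Γ tr hnd
    (fun l hl => Or.inl hl) (fun l hl => hl) hsound
  refine ⟨new, h1, h2, fun l => ⟨fun hl => ?_, fun hl => ?_⟩, h3, h4⟩
  · rw [lits_append, List.mem_append] at hl
    exact hl.symm.imp id (h3 l)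
  · rcases hl with hl | hl
    · rw [lits_append]; exact List.mem_append_right _ hl
    · obtain ⟨C, hC, hv, hlC, hf⟩ := hcomp l hl
      refine h5 C hC hv l hlC (fun hn => ?_) hf
      rw [lits_append, List.mem_append] at hn
      rcases hn with hn | hn
      · exact (hW l hl).2 (h3 _ hn)
      · exact (hW l hl).1 hn

/-! ### Branching and scores -/

/-- The VSIDS order: a higher score, or the same score and a smaller index. -/
def Better (sc : ℕ → ℚ) (x y : ℕ) : Prop := sc y < sc x ∨ (sc y = sc x ∧ x < y)

/-- Invariant of the scan: the candidate is `x` itself, or `x` is still to come and the candidate is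
absent or worse than `x`. No order or absence of repetitions is needed for the list of variables. -/
theorem pickBranch_val {tr : List Entry} (h : NodupVars tr) (sc : ℕ → ℚ) {x : ℕ}
    (hx : (x, true) ∉ lits tr ∧ (x, false) ∉ lits tr) (vars : List ℕ) :
    ∀ best : Option (ℕ × ℚ), (∀ y ∈ vars, y ≠ x → (y, true) ∉ lits tr → (y, false) ∉ lits tr →
      Better sc x y) → ((best = none ∧ x ∈ vars) ∨ best = some (x, sc x) ∨
      (x ∈ vars ∧ ∃ y, best = some (y, sc y) ∧ Better sc x y)) →
    (pickBranch tr (vars.map fun y => (y, sc y)) best).val = some x := by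
  induction vars with
  | nil => intro best _ hb; rcases hb with h | rfl | h <;> simp_all [pickBranch]
  | cons z vars ih =>
    intro best hbest hb
    have ih' := fun best => ih best fun y hy => hbest y (List.mem_cons_of_mem _ hy)
    have hneg : neg (z, true) = (z, false) := rfl
    simp only [List.map_cons, pickBranch, val_bind, litValue_val h, hneg]
    by_cases hzx : z = x
    · subst hzx
      rw [if_neg hx.1, if_neg hx.2]
      rcases hb with ⟨rfl, -⟩ | rfl | ⟨-, y, rfl, hy⟩
      · exact ih' _ (Or.inr (Or.inl rfl))
      · simp only [val_bind, lt_self_iff_false, true_and, or_self, if_false]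
        exact ih' _ (Or.inr (Or.inl rfl))
      · simp only [val_bind]
        rw [if_pos (by unfold Better at hy; exact hy)]
        exact ih' _ (Or.inr (Or.inl rfl))
    · have hb' : (best = none ∧ x ∈ vars) ∨ best = some (x, sc x) ∨
          (x ∈ vars ∧ ∃ y, best = some (y, sc y) ∧ Better sc x y) := by
        have hxz : x ≠ z := fun h => hzx h.symm
        simpa [hxz] using hb
      split_ifs with h1 h2
      · exact ih' _ hb'
      · exact ih' _ hb'
      · have hz := hbest z (by simp) hzx h1 h2
        rcases hb' with ⟨rfl, hxv⟩ | rfl | ⟨hxv, y, rfl, hy⟩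
        · exact ih' _ (Or.inr (Or.inr ⟨hxv, z, rfl, hz⟩))
        · simp only [val_bind]
          rw [if_neg]
          · exact ih' _ (Or.inr (Or.inl rfl))
          · rintro (hlt | ⟨heq, hlt⟩) <;> rcases hz with hz | ⟨hz, hz'⟩
            · exact lt_asymm hlt hz
            · rw [hz] at hlt; exact lt_irrefl _ hlt
            · rw [heq] at hz; exact lt_irrefl _ hz
            · omega
        · simp only [val_bind]
          split_ifs
          · exact ih' _ (Or.inr (Or.inr ⟨hxv, z, rfl, hz⟩))
          · exact ih' _ (Or.inr (Or.inr ⟨hxv, y, rfl, hy⟩))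

/-- The VSIDS scores after learning `C`. -/
def bump (δ : ℚ) (C : Clause) (sc : ℕ → ℚ) (x : ℕ) : ℚ :=
  (if ∃ l ∈ C, l.1 = x then 1 else 0) + δ * sc x

theorem updateScores_val (δ : ℚ) (C : Clause) (sc : ℕ → ℚ) (vars : List ℕ) :
    (updateScores δ C (vars.map fun y => (y, sc y))).val =
      vars.map fun y => (y, bump δ C sc y) := by
  induction vars with
  | nil => rfl
  | cons x vars ih => simp [updateScores, ih, varMem_val, bump]

theorem addVar_val (x : ℕ) (vars : List ℕ) :
    (addVar x (vars.map fun y => (y, (0 : ℚ)))).val =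
      (if x ∈ vars then vars else vars ++ [x]).map fun y => (y, (0 : ℚ)) := by
  induction vars with
  | nil => rfl
  | cons y vars ih =>
    simp only [List.map_cons, addVar, val_bind]
    by_cases h : y = x
    · simp [h]
    · simp only [if_neg h, val_bind, ih, val_pure, List.mem_cons, Ne.symm h, false_or]
      split_ifs <;> simp

theorem addClauseVars_val (C : Clause) : ∀ vars : List ℕ, ∃ vars' : List ℕ,
    (addClauseVars C (vars.map fun y => (y, (0 : ℚ)))).val = vars'.map (fun y => (y, (0 : ℚ))) ∧
    (∀ x, x ∈ vars' ↔ x ∈ vars ∨ ∃ l ∈ C, l.1 = x) ∧ vars'.length ≤ vars.length + C.length := by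
  induction C with
  | nil => exact fun vars => ⟨vars, by simp [addClauseVars]⟩
  | cons l C ih =>
    intro vars
    obtain ⟨vars', h1, h2, h3⟩ := ih (if l.1 ∈ vars then vars else vars ++ [l.1])
    refine ⟨vars', ?_, fun x => ?_, ?_⟩
    · simp only [addClauseVars, val_bind, addVar_val, h1]
    · rw [h2]
      split_ifs with h
      · simp only [List.mem_cons, exists_eq_or_imp]
        constructor
        · tauto
        · rintro (h' | rfl | h') <;> tauto
      · simp only [List.mem_append, List.mem_cons, exists_eq_or_imp, List.not_mem_nil, or_false]
        constructor
        · rintro ((h' | rfl) | h') <;> tauto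
        · rintro (h' | rfl | h') <;> tauto
    · split_ifs at h3 <;> simp at h3 ⊢ <;> omega

theorem addVars_val (F : CNF) : ∀ vars : List ℕ, ∃ vars' : List ℕ,
    (addVars F (vars.map fun y => (y, (0 : ℚ)))).val = vars'.map (fun y => (y, (0 : ℚ))) ∧
    (∀ x, x ∈ vars' ↔ x ∈ vars ∨ ∃ C ∈ F, ∃ l ∈ C, l.1 = x) ∧
    vars'.length ≤ vars.length + size F := by
  induction F with
  | nil => exact fun vars => ⟨vars, by simp [addVars]⟩
  | cons C F ih =>
    intro vars
    obtain ⟨vars₁, h1, h2, h3⟩ := addClauseVars_val C vars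
    obtain ⟨vars', h1', h2', h3'⟩ := ih vars₁
    refine ⟨vars', ?_, fun x => ?_, ?_⟩
    · simp only [addVars, val_bind, h1, h1']
    · rw [h2', h2]; simp [or_assoc]
    · simp [size] at h3' ⊢; omega

/-! ### Conflict analysis -/

/-- The variable of `l` was assigned at level `lvl`. -/
def AtLevel (tr : List Entry) (lvl : ℕ) (l : Lit) : Prop :=
  ∃ e ∈ tr, e.lit.1 = l.1 ∧ e.level = lvl

theorem litLevel_val {tr : List Entry} (h : NodupVars tr) (l : Lit) (lvl : ℕ) :
    (litLevel tr l).val = some lvl ↔ AtLevel tr lvl l := by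
  induction tr with
  | nil => simp [litLevel, AtLevel]
  | cons e tr ih =>
    simp only [litLevel, val_bind]
    split_ifs with h1
    · simp only [val_pure, Option.some.injEq, AtLevel, List.mem_cons, exists_eq_or_imp, h1,
        true_and, iff_self_or]
      rintro ⟨e', he', h2, -⟩
      exact absurd (List.mem_map.2 ⟨e', he', h2.trans h1.symm⟩) (List.nodup_cons.1 h).1
    · rw [ih h.tail]
      simp [AtLevel, h1]

theorem countLevel_val (tr : List Entry) (lvl : ℕ) (C : Clause) :
    (countLevel tr lvl C).val =
      C.countP fun l => decide ((litLevel tr l).val = some lvl) := by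
  induction C with
  | nil => rfl
  | cons l C ih =>
    simp only [countLevel, val_bind, val_pure, ih, List.countP_cons]
    split_ifs <;> simp_all

theorem countLevel_ge_two {tr : List Entry} (h : NodupVars tr) {lvl : ℕ} {C : Clause} {a b : Lit}
    (ha : a ∈ C) (hb : b ∈ C) (hab : a ≠ b) (hla : AtLevel tr lvl a) (hlb : AtLevel tr lvl b) :
    ¬ (countLevel tr lvl C).val ≤ 1 := by
  rw [countLevel_val, List.countP_eq_length_filter]
  intro hle
  have ha' : a ∈ C.filter fun l => decide ((litLevel tr l).val = some lvl) := by
    simp [ha, litLevel_val h, hla]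
  have hb' : b ∈ C.filter fun l => decide ((litLevel tr l).val = some lvl) := by
    simp [hb, litLevel_val h, hlb]
  generalize (C.filter fun l => decide ((litLevel tr l).val = some lvl)) = L at hle ha' hb'
  match L, hle with
  | [], _ => simp at ha'
  | [c], _ => simp at ha' hb'; exact hab (ha'.trans hb'.symm)

theorem countLevel_le_one {tr : List Entry} (h : NodupVars tr) {lvl : ℕ} {C : Clause}
    (hC : C.Nodup) {a : Lit} (hb : ∀ b ∈ C, AtLevel tr lvl b → b = a) :
    (countLevel tr lvl C).val ≤ 1 := by
  rw [countLevel_val, List.countP_eq_length_filter]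
  have hnd := hC.filter fun l => decide ((litLevel tr l).val = some lvl)
  have hsub : (C.filter fun l => decide ((litLevel tr l).val = some lvl)) ⊆ [a] := by
    intro l hl
    simp only [List.mem_filter, decide_eq_true_eq, litLevel_val h] at hl
    simp [hb l hl.1 hl.2]
  exact (List.Nodup.subperm hnd hsub).length_le

theorem removeLit_val (l : Lit) (C : Clause) : (removeLit l C).val = C.filter fun m => m ≠ l := by
  induction C with
  | nil => rfl
  | cons m C ih =>
    simp only [removeLit, val_bind, val_pure, ih, List.filter_cons]
    split_ifs <;> simp_all

theorem unionLits_val (C D : Clause) (hD : D.Nodup) : ((unionLits C D).val).Nodup ∧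
    ∀ l, l ∈ (unionLits C D).val ↔ l ∈ C ∨ l ∈ D := by
  induction C with
  | nil => simp [unionLits, hD]
  | cons m C ih =>
    simp only [unionLits, val_bind, val_pure, litMem_val]
    by_cases h : m ∈ (unionLits C D).val
    · rw [if_pos (by simpa using h)]
      refine ⟨ih.1, fun l => ?_⟩
      rw [ih.2, List.mem_cons]
      constructor
      · tauto
      · rintro ((rfl | h') | h')
        · exact (ih.2 _).1 h
        · tauto
        · tauto
    · rw [if_neg (by simpa using h)]
      refine ⟨List.nodup_cons.2 ⟨h, ih.1⟩, fun l => ?_⟩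
      rw [List.mem_cons, ih.2, List.mem_cons, or_assoc]

theorem analyze_stop {full tr : List Entry} {lvl : ℕ} {C : Clause}
    (hC : (countLevel full lvl C).val ≤ 1) : (analyze full lvl tr C).val = C := by
  cases tr with
  | nil => rfl
  | cons e tr => simp [analyze, hC]

theorem analyze_skip {full tr : List Entry} {lvl : ℕ} {C : Clause} {e : Entry}
    (hC : ¬ (countLevel full lvl C).val ≤ 1) (he : neg e.lit ∉ C) :
    (analyze full lvl (e :: tr) C).val = (analyze full lvl tr C).val := by
  simp [analyze, hC, litMem_val, he]

theorem analyze_resolve {full tr : List Entry} {lvl : ℕ} {C D : Clause} {e : Entry}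
    (hC : ¬ (countLevel full lvl C).val ≤ 1) (hnd : C.Nodup) (he : neg e.lit ∈ C)
    (hD : e.reason = some D) : ∃ E : Clause, E.Nodup ∧
      (∀ l, l ∈ E ↔ (l ∈ D ∧ l ≠ e.lit) ∨ (l ∈ C ∧ l ≠ neg e.lit)) ∧
      (analyze full lvl (e :: tr) C).val = (analyze full lvl tr E).val := by
  obtain ⟨h1, h2⟩ := unionLits_val (D.filter fun m => m ≠ e.lit)
    (C.filter fun m => m ≠ neg e.lit) (hnd.filter _)
  refine ⟨_, h1, fun l => ?_, ?_⟩
  · rw [h2]; simp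
  · simp [analyze, hC, litMem_val, he, hD, removeLit_val]

/-- Analysis through one layer of implied literals. The literals of the current clause are those
of `B`; each of them is false by a reason that consists, apart from it, of `neg ep.lit` and of the
literals of `G b`, which were false before `ep`. -/
theorem analyze_layer {full tr₀ : List Entry} {lvl : ℕ} {ep : Entry} {X : Clause}
    (hfull : NodupVars full) (hX : ep.reason = some X) (hepl : AtLevel full lvl (neg ep.lit))
    (B : Lit → Prop) (G : Lit → Lit → Prop) (hBl : ∀ b, B b → AtLevel full lvl b)
    {b₁ b₂ : Lit} (hb₁ : B b₁) (hb₂ : B b₂) (hb : b₁ ≠ b₂)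
    (hG : ∀ b l, B b → G b l → neg l ∈ lits tr₀)
    {b₀ y : Lit} (hb₀ : B b₀) (hy : G b₀ y) (hyl : AtLevel full lvl y) :
    ∀ (tr₁ : List Entry) (E : Clause), NodupVars (tr₁ ++ ep :: tr₀) →
    (∀ e ∈ tr₁, B (neg e.lit) →
      ∃ D, e.reason = some D ∧ ∀ l, (l ∈ D ∧ l ≠ e.lit) ↔ l = neg ep.lit ∨ G (neg e.lit) l) →
    E.Nodup →
    (∀ l, l ∈ E ↔ (B l ∧ neg l ∈ lits tr₁) ∨
      ∃ b, B b ∧ neg b ∉ lits tr₁ ∧ (l = neg ep.lit ∨ G b l)) →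
    ∃ E' : Clause, E'.Nodup ∧ (∀ l, l ∈ E' ↔ (l ∈ X ∧ l ≠ ep.lit) ∨ ∃ b, B b ∧ G b l) ∧
      (analyze full lvl (tr₁ ++ ep :: tr₀) E).val = (analyze full lvl tr₀ E').val := by
  -- The literals of `G` were false before `ep` was put on the trail, so they differ from `neg
  -- ep.lit` and survive the resolution on `ep`.
  have hyep : ∀ {tr₁}, NodupVars (tr₁ ++ ep :: tr₀) → ∀ b l, B b → G b l → l ≠ neg ep.lit := by
    intro tr₁ hnd b l hb hl h
    have h1 := hG b l hb hl
    rw [h, neg_neg_lit] at h1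
    exact (hnd.append_right.notMem (l := ep.lit) rfl).1 h1
  intro tr₁
  induction tr₁ with
  | nil =>
    intro E hnd _ hE hEm
    have hEm' : ∀ l, l ∈ E ↔ l = neg ep.lit ∨ ∃ b, B b ∧ G b l := by
      intro l
      rw [hEm]
      simp only [List.map_nil, List.not_mem_nil, and_false, false_or, not_false_eq_true, true_and]
      constructor
      · rintro ⟨b, hb, h | h⟩
        · exact Or.inl h
        · exact Or.inr ⟨b, hb, h⟩
      · rintro (h | ⟨b, hb, h⟩)
        · exact ⟨b₀, hb₀, Or.inl h⟩
        · exact ⟨b, hb, Or.inr h⟩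
    have hc := countLevel_ge_two hfull ((hEm' _).2 (Or.inl rfl)) ((hEm' y).2 (Or.inr ⟨_, hb₀, hy⟩))
      (hyep hnd _ _ hb₀ hy).symm hepl hyl
    obtain ⟨E', h1, h2, h3⟩ := analyze_resolve (tr := tr₀) hc hE ((hEm' _).2 (Or.inl rfl)) hX
    refine ⟨E', h1, fun l => ?_, h3⟩
    rw [h2, hEm']
    constructor
    · rintro (h | ⟨h | h, h'⟩)
      · exact Or.inl h
      · exact absurd h h'
      · exact Or.inr h
    · rintro (h | ⟨b, hb, h⟩)
      · exact Or.inl h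
      · exact Or.inr ⟨Or.inr ⟨b, hb, h⟩, hyep hnd b l hb h⟩
  | cons e tr₁ ih =>
    intro E hnd hr hE hEm
    have hnd' : NodupVars (tr₁ ++ ep :: tr₀) := hnd.tail
    have hr' : ∀ e ∈ tr₁, B (neg e.lit) → ∃ D, e.reason = some D ∧
        ∀ l, (l ∈ D ∧ l ≠ e.lit) ↔ l = neg ep.lit ∨ G (neg e.lit) l :=
      fun e he => hr e (List.mem_cons_of_mem _ he)
    have hene : ∀ l, e.lit.1 = l.1 → l ∉ lits tr₁ ∧ l ≠ ep.lit ∧ l ∉ lits tr₀ := by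
      intro l hl
      have h := (NodupVars.notMem (e := e) (tr := tr₁ ++ ep :: tr₀) hnd hl).1
      simp only [List.map_append, List.map_cons, List.mem_append, List.mem_cons, not_or] at h
      exact h
    -- The analysis cannot stop inside the layer, since two literals of the conflict level are
    -- always present: two from `B` if none has been resolved yet, one from `B` together with `neg
    -- ep.lit` in between, and `neg ep.lit` together with `y` at the end.
    have hc : ¬ (countLevel full lvl E).val ≤ 1 := by
      by_cases hall : ∀ b, B b → neg b ∈ lits (e :: tr₁)
      · exact countLevel_ge_two hfull ((hEm _).2 (Or.inl ⟨hb₁, hall _ hb₁⟩))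
          ((hEm _).2 (Or.inl ⟨hb₂, hall _ hb₂⟩)) hb (hBl _ hb₁) (hBl _ hb₂)
      push Not at hall
      obtain ⟨b, hb, hbm⟩ := hall
      by_cases hone : ∃ c, B c ∧ neg c ∈ lits (e :: tr₁)
      · obtain ⟨c, hc, hcm⟩ := hone
        refine countLevel_ge_two hfull ((hEm _).2 (Or.inl ⟨hc, hcm⟩))
          ((hEm _).2 (Or.inr ⟨b, hb, hbm, Or.inl rfl⟩)) ?_ (hBl _ hc) hepl
        rintro rfl
        rw [neg_neg_lit] at hcm
        have := (List.disjoint_of_nodup_append (l₁ := (e :: tr₁).map fun e => e.lit.1)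
          (l₂ := (ep :: tr₀).map fun e => e.lit.1) (by rw [← List.map_append]; exact hnd))
        obtain ⟨e', he', heq⟩ := List.mem_map.1 hcm
        exact this (a := ep.lit.1) (List.mem_map.2 ⟨e', he', by rw [heq]⟩) (by simp)
      · push Not at hone
        refine countLevel_ge_two hfull ((hEm _).2 (Or.inr ⟨b, hb, hbm, Or.inl rfl⟩))
          ((hEm y).2 (Or.inr ⟨b₀, hb₀, hone b₀ hb₀, Or.inr hy⟩))
          (hyep hnd' _ _ hb₀ hy).symm hepl hyl
    -- Entries of `tr₁` that falsify no literal of `B` do not occur in the clause and are skipped.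
    -- This is why the order of the layer is irrelevant.
    by_cases hB : B (neg e.lit)
    · obtain ⟨D, hD, hDm⟩ := hr e (by simp) hB
      obtain ⟨E₁, h1, h2, h3⟩ := analyze_resolve (tr := tr₁ ++ ep :: tr₀) hc hE
        ((hEm _).2 (Or.inl ⟨hB, by rw [neg_neg_lit]; simp⟩)) hD
      obtain ⟨E', h1', h2', h3'⟩ := ih E₁ hnd' hr' h1 (by
        intro l
        rw [h2, hDm, hEm]
        have hnm : neg (neg e.lit) ∉ lits tr₁ := by
          rw [neg_neg_lit]; exact (hene e.lit rfl).1
        constructor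
        · rintro (h | ⟨⟨h, h'⟩ | ⟨b, hb, hbm, h⟩, hne⟩)
          · exact Or.inr ⟨_, hB, hnm, h⟩
          · refine Or.inl ⟨h, (List.mem_cons.1 h').resolve_left fun h => hne ?_⟩
            rw [← h, neg_neg_lit]
          · exact Or.inr ⟨b, hb, fun h' => hbm (List.mem_cons_of_mem _ h'), h⟩
        · rintro (⟨h, h'⟩ | ⟨b, hb, hbm, h⟩)
          · refine Or.inr ⟨Or.inl ⟨h, List.mem_cons_of_mem _ h'⟩, ?_⟩
            rintro rfl
            exact hnm h'
          · by_cases hbe : b = neg e.lit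
            · subst hbe; exact Or.inl h
            · refine Or.inr ⟨Or.inr ⟨b, hb, fun h' => ?_, h⟩, ?_⟩
              · rcases List.mem_cons.1 h' with h' | h'
                · exact hbe (by rw [← h', neg_neg_lit])
                · exact hbm h'
              · rintro rfl
                rcases h with h | h
                · exact (hene e.lit rfl).2.1 (neg_injective h)
                · have := hG _ _ hb h
                  rw [neg_neg_lit] at this
                  exact (hene e.lit rfl).2.2 this)
      exact ⟨E', h1', h2', h3.trans h3'⟩
    · have hnE : neg e.lit ∉ E := by
        rw [hEm]
        rintro (⟨h, -⟩ | ⟨b, hb, -, h | h⟩)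
        · exact hB h
        · exact (hene e.lit rfl).2.1 (neg_injective h)
        · have := hG _ _ hb h
          rw [neg_neg_lit] at this
          exact (hene e.lit rfl).2.2 this
      obtain ⟨E', h1', h2', h3'⟩ := ih E hnd' hr' hE (by
        intro l
        rw [hEm]
        have key : ∀ b, B b → (neg b ∈ lits (e :: tr₁) ↔ neg b ∈ lits tr₁) := by
          intro b hb
          refine ⟨fun h => (List.mem_cons.1 h).resolve_left fun h => hB ?_,
            fun h => List.mem_cons_of_mem _ h⟩
          rw [← h, neg_neg_lit]; exact hb
        constructor
        · rintro (⟨h, h'⟩ | ⟨b, hb, hbm, h⟩)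
          · exact Or.inl ⟨h, (key l h).1 h'⟩
          · exact Or.inr ⟨b, hb, mt (key b hb).2 hbm, h⟩
        · rintro (⟨h, h'⟩ | ⟨b, hb, hbm, h⟩)
          · exact Or.inl ⟨h, (key l h).2 h'⟩
          · exact Or.inr ⟨b, hb, mt (key b hb).1 hbm, h⟩)
      exact ⟨E', h1', h2', (analyze_skip (tr := tr₁ ++ ep :: tr₀) hc hnE).trans h3'⟩

/-! ### Costs -/

theorem litValue_cost (tr : List Entry) (l : Lit) : (litValue tr l).cost ≤ tr.length + 1 := by
  induction tr with
  | nil => simp [litValue]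
  | cons e tr ih =>
    simp only [litValue, cost_bind, cost_tick, List.length_cons]
    split_ifs <;> (try simp only [cost_pure]) <;> omega

theorem litLevel_cost (tr : List Entry) (l : Lit) : (litLevel tr l).cost ≤ tr.length + 1 := by
  induction tr with
  | nil => simp [litLevel]
  | cons e tr ih =>
    simp only [litLevel, cost_bind, cost_tick, List.length_cons]
    split_ifs <;> (try simp only [cost_pure]) <;> omega

theorem clauseStatus_cost (tr : List Entry) (C : Clause) :
    (clauseStatus tr C).cost ≤ (C.length + 1) * (tr.length + 2) := by
  induction C with
  | nil => simp [clauseStatus]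
  | cons l C ih =>
    have h1 := litValue_cost tr l
    have h2 : (l :: C).length + 1 = (C.length + 1) + 1 := by simp
    rw [h2, Nat.succ_mul]
    simp only [clauseStatus, cost_bind, cost_tick]
    cases (litValue tr l).val with
    | none =>
      simp only [cost_bind]
      cases (clauseStatus tr C).val with
      | unit m => simp only []; split_ifs <;> simp only [cost_pure] <;> omega
      | _ => simp only [cost_pure]; omega
    | some b => cases b <;> simp only [cost_pure] <;> omega

theorem clauseStatus_cost_le {tr : List Entry} {C : Clause} {D : ℕ} (hC : C.length + 1 ≤ D)
    (htr : tr.length + 2 ≤ D) : (clauseStatus tr C).cost ≤ D * D :=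
  (clauseStatus_cost tr C).trans (Nat.mul_le_mul hC htr)

theorem findConflict_cost {tr : List Entry} {D : ℕ} (htr : tr.length + 2 ≤ D) (Γ : List Clause)
    (hΓ : ∀ C ∈ Γ, C.length + 1 ≤ D) :
    (findConflict tr Γ).cost ≤ (Γ.length + 1) * (1 + D * D) := by
  induction Γ with
  | nil => simp [findConflict]
  | cons C Γ ih =>
    have h1 := clauseStatus_cost_le (hΓ C (by simp)) htr
    have h2 := ih fun D hD => hΓ D (by simp [hD])
    have h3 : (C :: Γ).length + 1 = (Γ.length + 1) + 1 := by simp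
    rw [h3, Nat.succ_mul]
    simp only [findConflict, cost_bind, cost_tick]
    cases (clauseStatus tr C).val <;> simp only [cost_pure] <;> omega

theorem litMem_cost (l : Lit) (C : Clause) : (litMem l C).cost ≤ C.length + 1 := by
  induction C with
  | nil => simp [litMem]
  | cons m C ih =>
    simp only [litMem, cost_bind, cost_tick, List.length_cons]
    split_ifs <;> (try simp only [cost_pure]) <;> omega

theorem varMem_cost (x : ℕ) (C : Clause) : (varMem x C).cost ≤ C.length + 1 := by
  induction C with
  | nil => simp [varMem]
  | cons m C ih =>
    simp only [varMem, cost_bind, cost_tick, List.length_cons]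
    split_ifs <;> (try simp only [cost_pure]) <;> omega

theorem concerns_cost (p : Option Lit) (C : Clause) : (concerns p C).cost ≤ C.length + 1 := by
  cases p with
  | none => simp [concerns]
  | some l => exact litMem_cost _ _

theorem saturate_cost (p : Option Lit) (lvl : ℕ) {D : ℕ} (Γ : List Clause)
    (hΓ : ∀ C ∈ Γ, C.length + 1 ≤ D) : ∀ tr : List Entry, tr.length + Γ.length + 2 ≤ D →
    (saturate p lvl Γ tr).cost ≤ (Γ.length + 1) * (1 + D + D * D) := by
  induction Γ with
  | nil => intro tr _; simp [saturate]; nlinarith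
  | cons C Γ ih =>
    intro tr htr
    have hlen : (C :: Γ).length = Γ.length + 1 := rfl
    have h1 := clauseStatus_cost_le (tr := tr) (hΓ C (by simp)) (by omega)
    have h2 := (concerns_cost p C).trans (hΓ C (by simp))
    have ih' := ih fun D hD => hΓ D (by simp [hD])
    rw [hlen, Nat.succ_mul]
    simp only [saturate, cost_bind, cost_tick]
    have h3 := ih' tr (by omega)
    split_ifs
    · simp only [cost_bind]
      cases (clauseStatus tr C).val with
      | unit l =>
        simp only [cost_bind, cost_pure]
        have := ih' (⟨l, lvl, some C⟩ :: tr) (by simp; omega)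
        omega
      | _ => simp only []; omega
    · omega

theorem arithCost_le {q r : ℚ} {D : ℕ} (hq : bits q ≤ D) (hr : bits r ≤ D) :
    arithCost q r ≤ (2 * D + 1) ^ 2 :=
  Nat.pow_le_pow_left (by omega) 2

theorem pickBranch_cost {tr : List Entry} {D : ℕ} (htr : tr.length + 2 ≤ D)
    (sc : List (ℕ × ℚ)) (hsc : ∀ p ∈ sc, bits p.2 ≤ D) :
    ∀ best : Option (ℕ × ℚ), (∀ p ∈ best, bits p.2 ≤ D) →
    (pickBranch tr sc best).cost ≤ (sc.length + 1) * (1 + D + (2 * D + 1) ^ 2) := by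
  induction sc with
  | nil => intro best _; simp [pickBranch]; nlinarith
  | cons p sc ih =>
    obtain ⟨x, q⟩ := p
    intro best hbest
    have hq : bits q ≤ D := hsc (x, q) (by simp)
    have hlen : ((x, q) :: sc).length = sc.length + 1 := rfl
    have ih' := ih fun p hp => hsc p (by simp [hp])
    have h1 := litValue_cost tr (x, true)
    rw [hlen, Nat.succ_mul]
    simp only [pickBranch, cost_bind, cost_tick]
    cases (litValue tr (x, true)).val with
    | some b => simp only []; have := ih' best hbest; omega
    | none =>
      cases best with
      | none =>
        simp only []
        have := ih' (some (x, q)) (by simpa using hq)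
        omega
      | some p =>
        obtain ⟨y, r⟩ := p
        have hr : bits r ≤ D := hbest (y, r) (by simp)
        have h2 := arithCost_le hq hr
        simp only [cost_bind, cost_tick]
        split_ifs
        · have := ih' (some (x, q)) (by simpa using hq); omega
        · have := ih' (some (y, r)) (by simpa using hr); omega

theorem updateScores_cost {δ : ℚ} {C : Clause} {D : ℕ} (hC : C.length + 1 ≤ D)
    (hδ : bits δ ≤ D) (h1 : bits 1 ≤ D) (sc : List (ℕ × ℚ))
    (hsc : ∀ p ∈ sc, bits p.2 ≤ D ∧ bits (δ * p.2) ≤ D) :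
    (updateScores δ C sc).cost ≤ (sc.length + 1) * (1 + D + 2 * (2 * D + 1) ^ 2) := by
  induction sc with
  | nil => simp [updateScores]; nlinarith
  | cons p sc ih =>
    obtain ⟨x, q⟩ := p
    have hq := hsc (x, q) (by simp)
    have hlen : ((x, q) :: sc).length = sc.length + 1 := rfl
    have ih' := ih fun p hp => hsc p (by simp [hp])
    have h2 := (varMem_cost x C).trans hC
    have h3 : arithCost δ q ≤ _ := arithCost_le hδ hq.1
    have h4 : arithCost 1 (δ * q) ≤ _ := arithCost_le h1 hq.2
    rw [hlen, Nat.succ_mul]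
    simp only [updateScores, cost_bind, cost_tick, cost_pure]
    omega

theorem countLevel_cost (tr : List Entry) (lvl : ℕ) (C : Clause) :
    (countLevel tr lvl C).cost ≤ (C.length + 1) * (tr.length + 2) := by
  induction C with
  | nil => simp [countLevel]
  | cons l C ih =>
    have h1 := litLevel_cost tr l
    have h2 : (l :: C).length + 1 = (C.length + 1) + 1 := by simp
    rw [h2, Nat.succ_mul]
    simp only [countLevel, cost_bind, cost_tick, cost_pure]
    omega

theorem removeLit_cost (l : Lit) (C : Clause) : (removeLit l C).cost ≤ C.length + 1 := by
  induction C with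
  | nil => simp [removeLit]
  | cons m C ih => simp only [removeLit, cost_bind, cost_tick, cost_pure, List.length_cons]; omega

theorem unionLits_length (C D : Clause) : (unionLits C D).val.length ≤ C.length + D.length := by
  induction C with
  | nil => simp [unionLits]
  | cons l C ih =>
    simp only [unionLits, val_bind, val_pure, List.length_cons]
    split_ifs <;> (try simp only [List.length_cons]) <;> omega

theorem unionLits_cost (C D : Clause) :
    (unionLits C D).cost ≤ (C.length + 1) * (C.length + D.length + 2) := by
  induction C with
  | nil => simp [unionLits]
  | cons l C ih =>
    have h1 := litMem_cost l (unionLits C D).val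
    have h2 := unionLits_length C D
    simp only [unionLits, cost_bind, cost_tick, cost_pure, List.length_cons]
    nlinarith

/-- A bound for one round of conflict analysis with clauses of length at most `M`. -/
def roundCost (D M : ℕ) : ℕ := 1 + (M + 1) * D + 2 * (M + 1) + D + D * (D + M + 2)

/-- Each round lengthens the clause by less than `D`, so initial length plus remaining rounds times
`D` never grows and bounds all clauses by `M`. -/
theorem analyze_cost {full : List Entry} {lvl D M : ℕ} (hfull : full.length + 2 ≤ D) :
    ∀ (tr : List Entry) (C : Clause), (∀ e ∈ tr, ∀ E ∈ e.reason, E.length + 1 ≤ D) →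
    C.length + tr.length * D ≤ M →
    (analyze full lvl tr C).cost ≤ (tr.length + 1) * roundCost D M := by
  intro tr
  induction tr with
  | nil => intro C _ _; simp [analyze, roundCost]; omega
  | cons e tr ih =>
    intro C hr hC
    have hr' : ∀ e ∈ tr, ∀ E ∈ e.reason, E.length + 1 ≤ D :=
      fun e he => hr e (List.mem_cons_of_mem _ he)
    have hlen : (e :: tr).length = tr.length + 1 := rfl
    rw [hlen, Nat.succ_mul] at hC
    have h1 : (countLevel full lvl C).cost ≤ (M + 1) * D :=
      (countLevel_cost full lvl C).trans (Nat.mul_le_mul (by omega) hfull)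
    have h2 := litMem_cost (neg e.lit) C
    rw [hlen, Nat.succ_mul]
    simp only [analyze, cost_bind, cost_tick]
    split_ifs
    · simp only [cost_pure, roundCost]; omega
    · simp only [cost_bind]
      split
      · rename_i E _ hE
        have hE' := hr e (by simp) E (by simpa using hE)
        have l1 : (removeLit (neg e.lit) C).val.length ≤ C.length := by
          rw [removeLit_val]; exact List.length_filter_le _ _
        have l2 : (removeLit e.lit E).val.length ≤ E.length := by
          rw [removeLit_val]; exact List.length_filter_le _ _
        have l3 := unionLits_length (removeLit e.lit E).val (removeLit (neg e.lit) C).val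
        have c1 := removeLit_cost (neg e.lit) C
        have c2 := removeLit_cost e.lit E
        have c3 : (unionLits (removeLit e.lit E).val (removeLit (neg e.lit) C).val).cost ≤
            D * (D + M + 2) :=
          (unionLits_cost _ _).trans (Nat.mul_le_mul (by omega) (by omega))
        have c4 := ih _ hr' (show (unionLits (removeLit e.lit E).val
          (removeLit (neg e.lit) C).val).val.length + tr.length * D ≤ M by omega)
        simp only [cost_bind]
        have hround : roundCost D M =
          1 + (M + 1) * D + 2 * (M + 1) + D + D * (D + M + 2) := rfl
        omega
      · have c4 := ih C hr' (by omega)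
        have hround : roundCost D M =
          1 + (M + 1) * D + 2 * (M + 1) + D + D * (D + M + 2) := rfl
        omega

theorem addVar_cost (x : ℕ) (sc : List (ℕ × ℚ)) : (addVar x sc).cost ≤ sc.length + 1 ∧
    (addVar x sc).val.length ≤ sc.length + 1 := by
  induction sc with
  | nil => simp [addVar]
  | cons y sc ih =>
    simp only [addVar, cost_bind, cost_tick, val_bind, List.length_cons]
    split_ifs <;> (try simp only [cost_pure, val_pure, List.length_cons, cost_bind, val_bind]) <;>
      omega

theorem addClauseVars_cost (C : Clause) : ∀ sc : List (ℕ × ℚ),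
    (addClauseVars C sc).cost ≤ (C.length + 1) * (C.length + sc.length + 2) ∧
    (addClauseVars C sc).val.length ≤ sc.length + C.length := by
  induction C with
  | nil => intro sc; simp [addClauseVars]
  | cons l C ih =>
    intro sc
    have h1 := addVar_cost l.1 sc
    have h2 := ih (addVar l.1 sc).val
    simp only [addClauseVars, cost_bind, cost_tick, val_bind, List.length_cons]
    constructor
    · have : (C.length + 1) * (C.length + (addVar l.1 sc).val.length + 2) ≤
        (C.length + 1) * (C.length + 1 + sc.length + 2) := Nat.mul_le_mul_left _ (by omega)
      have h3 : (C.length + 1 + 1) * (C.length + 1 + sc.length + 2) =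
        (C.length + 1) * (C.length + 1 + sc.length + 2) + (C.length + 1 + sc.length + 2) := by ring
      omega
    · omega

theorem addVars_cost (F : CNF) : ∀ sc : List (ℕ × ℚ),
    (addVars F sc).cost ≤ (F.length + 1) * ((size F + 1) * (size F + sc.length + 3)) := by
  induction F with
  | nil => intro sc; simp [addVars, size]
  | cons C F ih =>
    intro sc
    have h1 := addClauseVars_cost C sc
    have h2 := ih (addClauseVars C sc).val
    have hs : size (C :: F) = C.length + 1 + size F := by simp [size]
    simp only [addVars, cost_bind, cost_tick, List.length_cons]
    have h3 : (F.length + 1) * ((size F + 1) * (size F + (addClauseVars C sc).val.length + 3)) ≤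
        (F.length + 1) * ((size (C :: F) + 1) * (size (C :: F) + sc.length + 3)) :=
      Nat.mul_le_mul_left _ (Nat.mul_le_mul (by omega) (by omega))
    have h4 : (C.length + 1) * (C.length + sc.length + 2) + 1 ≤
        (size (C :: F) + 1) * (size (C :: F) + sc.length + 3) := by
      have : (C.length + 1) * (C.length + sc.length + 2) + (C.length + 1) ≤
        (C.length + 1) * (C.length + sc.length + 3) := by rw [← Nat.mul_succ]
      have : (C.length + 1) * (C.length + sc.length + 3) ≤
        (size (C :: F) + 1) * (size (C :: F) + sc.length + 3) :=
        Nat.mul_le_mul (by omega) (by omega)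
      omega
    rw [Nat.succ_mul (F.length + 1)]
    omega

/-! ### The cost of one search step -/

/-- All sizes in a search state are below `D`. -/
structure Bounded (δ : ℚ) (D : ℕ) (s : Search) : Prop where
  db : ∀ C ∈ s.db, C.length + 2 ≤ D
  len : s.trail.length + s.db.length + 4 ≤ D
  queue : s.queue.length ≤ D
  reason : ∀ e ∈ s.trail, ∀ C ∈ e.reason, C.length + 1 ≤ D
  scores : s.scores.length + 1 ≤ D
  bits_δ : bits δ ≤ D
  bits_scores : ∀ p ∈ s.scores, bits p.2 ≤ D ∧ bits (δ * p.2) ≤ D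

/-- A bound for the cost of a step of a search state whose sizes are below `D`. -/
def stepCost (D : ℕ) : ℕ := 200 * (D + 1) ^ 5

theorem roundCost_le (D : ℕ) : (D + 1) * roundCost D (D + D * D) ≤ 40 * (D + 1) ^ 5 := by
  unfold roundCost
  ring_nf
  linarith [Nat.zero_le D, Nat.zero_le (D ^ 2), Nat.zero_le (D ^ 3), Nat.zero_le (D ^ 4),
    Nat.zero_le (D ^ 5)]

/-- The length of the learned clause is a hypothesis, because the general bound for analysis is only
quadratic in `D` and would grow from conflict to conflict. For the ordering principle the clauses
are known to stay short. -/
theorem searchStep_cost {δ : ℚ} {D : ℕ} {s : Search} (h : Bounded δ D s)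
    (hL : s.level ≠ 0 → ∀ C, (findConflict s.trail s.db).val = some C →
      (analyze s.trail s.level s.trail (unionLits C []).val).val.length + 2 ≤ D) :
    (searchStep δ s).cost ≤ stepCost D := by
  have hb := h.len
  have hD : 4 ≤ D := by omega
  have h1 : (findConflict s.trail s.db).cost ≤ D * (1 + D * D) :=
    (findConflict_cost (by omega) s.db fun C hC => by have := h.db C hC; omega).trans
      (Nat.mul_le_mul_right _ (by omega))
  have hsat : ∀ p lvl (db : List Clause) (tr : List Entry), tr.length + db.length + 2 ≤ D →
      (∀ C ∈ db, C.length + 1 ≤ D) →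
      (saturate p lvl db tr).cost ≤ D * (1 + D + D * D) := fun p lvl db tr hl hdb =>
    (saturate_cost p lvl db hdb tr hl).trans (Nat.mul_le_mul_right _ (by omega))
  have hsc := h.scores
  have hfin : 1 + D * (1 + D * D) + 3 * D + D * (1 + D + D * D) + D * (1 + D + (2 * D + 1) ^ 2) +
      D * (D + 2) + D * (1 + D + 2 * (2 * D + 1) ^ 2) + 40 * (D + 1) ^ 5 ≤ stepCost D := by
    unfold stepCost
    ring_nf
    linarith [Nat.zero_le D, Nat.zero_le (D ^ 2), Nat.zero_le (D ^ 3), Nat.zero_le (D ^ 4),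
      Nat.zero_le (D ^ 5)]
  simp only [searchStep, cost_bind, cost_tick]
  split
  · rename_i C hC
    have hCm : C ∈ s.db := by
      have : ∀ Γ : List Clause, (findConflict s.trail Γ).val = some C → C ∈ Γ := by
        intro Γ
        induction Γ with
        | nil => simp [findConflict]
        | cons E Γ ih =>
          simp only [findConflict, val_bind]
          cases (clauseStatus s.trail E).val with
          | falsified => simp +contextual
          | _ => exact fun h => List.mem_cons_of_mem _ (ih h)
      exact this _ hC
    split_ifs with hlvl
    · simp only [cost_pure]; omega
    · have hLC := hL hlvl C hC
      simp only [cost_bind, cost_tick, restart, cost_pure]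
      have c1 : (unionLits C []).cost ≤ D * (D + 2) := by
        have := h.db C hCm
        exact (unionLits_cost C []).trans (Nat.mul_le_mul (by omega) (by simp; omega))
      have l1 := unionLits_length C []
      have c2 : (analyze s.trail s.level s.trail (unionLits C []).val).cost ≤
          40 * (D + 1) ^ 5 := by
        refine le_trans ?_ (roundCost_le D)
        refine (analyze_cost (D := D) (M := D + D * D) (by omega) _ _ h.reason ?_).trans
          (Nat.mul_le_mul_right _ (by omega))
        have := h.db C hCm
        have : s.trail.length * D ≤ D * D := Nat.mul_le_mul_right _ (by omega)
        simp at l1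
        omega
      have c3 := updateScores_cost (δ := δ)
        (C := (analyze s.trail s.level s.trail (unionLits C []).val).val) (D := D) (by omega)
        h.bits_δ (show bits 1 ≤ D by
          have : bits 1 = 2 := by rfl
          omega) s.scores h.bits_scores
      have c3' := c3.trans (Nat.mul_le_mul_right _ hsc)
      have c4 := hsat none 0
        (s.db ++ [(analyze s.trail s.level s.trail (unionLits C []).val).val]) []
        (by simp; omega) (by
          intro E hE
          rcases List.mem_append.1 hE with hE | hE
          · have := h.db E hE; omega
          · rw [List.mem_singleton] at hE; rw [hE]; omega)
      omega
  · split
    · rename_i l rest hq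
      have hql := h.queue
      rw [hq] at hql
      simp at hql
      simp only [cost_bind, cost_tick, cost_pure]
      have c1 := hsat (some l) s.level s.db s.trail (by omega)
        fun C hC => by have := h.db C hC; omega
      omega
    · have c1 := (pickBranch_cost (tr := s.trail) (D := D) (by omega) s.scores
        (fun p hp => (h.bits_scores p hp).1) none (by simp)).trans (Nat.mul_le_mul_right _ hsc)
      simp only [cost_bind]
      split <;> simp only [cost_pure] <;> omega

/-! ### Runs between two conflicts -/

/-- The part of the search state that changes between two conflicts. -/
abbrev Local := ℕ × List Entry × List Lit

/-- The search state with given clauses and scores. -/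
def mkSearch (db : List Clause) (sc : List (ℕ × ℚ)) (s : Local) : Search :=
  ⟨db, sc, s.1, s.2.1, s.2.2⟩

/-- Steps without a conflict, each of cost at most `K`. -/
inductive Steps (δ : ℚ) (K : ℕ) (db : List Clause) (sc : List (ℕ × ℚ)) : Local → Local → Prop
  | refl (s : Local) : Steps δ K db sc s s
  | tail (s s' s'' : Local) (h : Steps δ K db sc s s')
      (hv : (searchStep δ (mkSearch db sc s')).val = .search (mkSearch db sc s''))
      (hc : (searchStep δ (mkSearch db sc s')).cost ≤ K)
      (hm : 2 * s'.2.1.length + s''.2.2.length + 1 ≤ 2 * s''.2.1.length + s'.2.2.length) :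
      Steps δ K db sc s s''

theorem Solver.Run.trans {S : Solver} {a b c : S.State} {t u : ℕ} (h : S.Run a t b)
    (h' : S.Run b u c) : S.Run a (t + u) c := by
  induction h with
  | refl s => simpa using h'
  | head s s' s'' k t hs hr ih => rw [Nat.add_assoc]; exact Solver.Run.head _ _ _ _ _ hs (ih h')

theorem Solver.Run.single {S : Solver} {a b : S.State} {t : ℕ} (h : S.step a t b) :
    S.Run a t b := by
  simpa using Solver.Run.head a b b t 0 h (Solver.Run.refl b)

theorem cdcl_step_search {δ : ℚ} {s : Search} {s' : CDCLState} (h : (searchStep δ s).val = s') :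
    (cdcl δ).step (.search s) (searchStep δ s).cost s' := by
  change some (searchStep δ s) = some _
  rw [← h]

/-- Potential argument: twice the trail length minus the queue length increases with every step. A
decision adds one entry to both, and a propagation removes a literal from the queue and adds the
same number of new literals to both. The bound is stated without subtraction. -/
theorem Steps.run {δ : ℚ} {K : ℕ} {db : List Clause} {sc : List (ℕ × ℚ)} {s s' : Local}
    (h : Steps δ K db sc s s') : ∃ t,
    t + K * (2 * s.2.1.length + s'.2.2.length) ≤ K * (2 * s'.2.1.length + s.2.2.length) ∧
    (cdcl δ).Run (.search (mkSearch db sc s)) t (.search (mkSearch db sc s')) := by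
  induction h with
  | refl => exact ⟨0, by simp, Solver.Run.refl _⟩
  | tail s₁ s₂ h hv hc hm ih =>
    obtain ⟨t, ht, hr⟩ := ih
    refine ⟨t + (searchStep δ (mkSearch db sc s₁)).cost, ?_,
      hr.trans (Solver.Run.single (S := cdcl δ) (cdcl_step_search hv))⟩
    have := Nat.mul_le_mul_left K hm
    nlinarith

/-! ### Bit lengths of scores -/

/-- The denominator divides `d ^ c`, which has at most `c * d.size` bits up to rounding, and the
numerator is at most twice the denominator. So score lengths grow only linearly with the number of
conflicts. -/
theorem bits_le {q : ℚ} {d c : ℕ} (hd : 0 < d) (h0 : 0 ≤ q) (h2 : q ≤ 2) (hq : q.den ∣ d ^ c) :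
    bits q ≤ 2 * (c * d.size) + 3 := by
  have hden : q.den ≤ d ^ c := Nat.le_of_dvd (pow_pos hd c) hq
  have hpow : d ^ c ≤ 2 ^ (c * d.size) := by
    rw [Nat.mul_comm, pow_mul]
    exact Nat.pow_le_pow_left (Nat.lt_size_self d).le c
  have hnum : q.num.natAbs ≤ 2 * q.den := by
    have h := Rat.num_div_den q
    have hdp : (0 : ℚ) < q.den := by exact_mod_cast q.den_pos
    have h1 : (q.num : ℚ) ≤ 2 * q.den := by
      rw [← h, div_le_iff₀ hdp] at h2
      simpa using h2
    have h3 : q.num ≤ 2 * q.den := by exact_mod_cast h1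
    have h4 : 0 ≤ q.num := Rat.num_nonneg.2 h0
    omega
  have hpos : 0 < 2 ^ (c * d.size) := by positivity
  have s1 : q.num.natAbs.size ≤ c * d.size + 2 := by
    rw [Nat.size_le, pow_add]
    omega
  have s2 : q.den.size ≤ c * d.size + 1 := by
    rw [Nat.size_le, pow_add]
    omega
  unfold bits
  omega

/-! ### Assignments to the variables of the ordering principle -/

/-- An assignment: `A i j b` says that `P_{i,j}` has the value `b`. -/
abbrev Asg := ℕ → ℕ → Bool → Prop

/-- `P_{i,j}` is a variable of `OP n`. -/
def Valid (n i j : ℕ) : Prop := i < n ∧ j < n ∧ i ≠ j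

theorem opVar_inj {n i j i' j' : ℕ} (hi : i < n) (hi' : i' < n) :
    opVar n i j = opVar n i' j' ↔ i = i' ∧ j = j' := by
  constructor
  · intro h
    have h1 := congrArg (· % n) h
    have h2 := congrArg (· / n) h
    simp only [opVar_mod hi, opVar_mod hi', opVar_div hi, opVar_div hi'] at h1 h2
    exact ⟨h1, h2⟩
  · rintro ⟨rfl, rfl⟩; rfl

/-- The literals over the variables of `OP n` that `A` makes true. -/
def AsgLit (n : ℕ) (A : Asg) (l : Lit) : Prop :=
  ∃ i j b, Valid n i j ∧ l = (opVar n i j, b) ∧ A i j b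

theorem asgLit_iff {n : ℕ} {A : Asg} {i j : ℕ} {b : Bool} (h : Valid n i j) :
    AsgLit n A (opVar n i j, b) ↔ A i j b := by
  constructor
  · rintro ⟨i', j', b', hv, he, hA⟩
    rw [Prod.mk.injEq, opVar_inj h.1 hv.1] at he
    obtain ⟨⟨rfl, rfl⟩, rfl⟩ := he
    exact hA
  · exact fun hA => ⟨i, j, b, h, rfl, hA⟩

/-- The trail `tr` carries the assignment `A`. -/
structure Rep (n : ℕ) (tr : List Entry) (A : Asg) : Prop where
  nodup : NodupVars tr
  mem : ∀ l, l ∈ lits tr ↔ AsgLit n A l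

theorem Rep.mem_iff {n : ℕ} {tr : List Entry} {A : Asg} (h : Rep n tr A) {i j : ℕ} {b : Bool}
    (hv : Valid n i j) : (opVar n i j, b) ∈ lits tr ↔ A i j b := by
  rw [h.mem, asgLit_iff hv]

theorem Rep.congr {n : ℕ} {tr : List Entry} {A A' : Asg} (h : Rep n tr A)
    (hA : ∀ i j b, Valid n i j → (A i j b ↔ A' i j b)) : Rep n tr A' := by
  refine ⟨h.nodup, fun l => (h.mem l).trans ?_⟩
  constructor <;> rintro ⟨i, j, b, hv, rfl, h'⟩
  · exact ⟨i, j, b, hv, rfl, (hA i j b hv).1 h'⟩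
  · exact ⟨i, j, b, hv, rfl, (hA i j b hv).2 h'⟩

theorem Rep.length_le {n : ℕ} {tr : List Entry} {A : Asg} (h : Rep n tr A) :
    tr.length ≤ n * n := by
  have h1 : (tr.map fun e => e.lit.1) ⊆ List.range (n * n) := by
    intro x hx
    obtain ⟨e, he, rfl⟩ := List.mem_map.1 hx
    obtain ⟨i, j, b, hv, hl, -⟩ := (h.mem e.lit).1 (List.mem_map.2 ⟨e, he, rfl⟩)
    rw [hl, List.mem_range]
    have hj := hv.2.1
    have : (j + 1) * n ≤ n * n := Nat.mul_le_mul_right n hj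
    rw [Nat.succ_mul] at this
    have hi := hv.1
    simp only [opVar]
    omega
  have := (List.Nodup.subperm h.nodup h1).length_le
  simpa using this

/-! ### The clauses of the database -/

/-- `C` consists of the literals `P_{x,j}` with `x ≤ m` and `x ≠ j`. -/
structure IsCol (n j m : ℕ) (C : Clause) : Prop where
  nodup : C.Nodup
  mem : ∀ l, l ∈ C ↔ ∃ x, x ≤ m ∧ x ≠ j ∧ l = (opVar n x j, true)

theorem IsCol.length_le {n j m : ℕ} {C : Clause} (h : IsCol n j m C) (hm : m < n) :
    C.length ≤ n := by
  have h1 : C ⊆ (List.range n).map fun x => (opVar n x j, true) := by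
    intro l hl
    obtain ⟨x, hx, -, rfl⟩ := (h.mem l).1 hl
    exact List.mem_map.2 ⟨x, List.mem_range.2 (by omega), rfl⟩
  have := (List.Nodup.subperm h.nodup h1).length_le
  simpa using this

/-- The database consists of the transitivity and antisymmetry clauses followed by the column
clauses that belong to `LS`. -/
structure DB (n : ℕ) (LS : ℕ → ℕ → Prop) (db : List Clause) : Prop where
  split : ∃ Cs, db = (opTrans n ++ opAnti n) ++ Cs ∧
    (∀ C ∈ Cs, ∃ j m, LS j m ∧ IsCol n j m C) ∧ (∀ j m, LS j m → ∃ C ∈ Cs, IsCol n j m C)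
  range : ∀ j m, LS j m → j ≤ m ∧ m < n ∧ 1 ≤ m
  full : ∀ j < n, LS j (n - 1)

theorem DB.cases {n : ℕ} {LS : ℕ → ℕ → Prop} {db : List Clause} (h : DB n LS db) {C : Clause}
    (hC : C ∈ db) : (∃ i j k, i < n ∧ j < n ∧ k < n ∧ i ≠ j ∧ k ≠ i ∧ j ≠ k ∧
      C = [(opVar n i j, false), (opVar n j k, false), (opVar n i k, true)]) ∨
    (∃ i j, i < n ∧ j < n ∧ i ≠ j ∧ C = [(opVar n i j, false), (opVar n j i, false)]) ∨
    ∃ j m, LS j m ∧ IsCol n j m C := by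
  obtain ⟨Cs, rfl, h1, -⟩ := h.split
  rcases List.mem_append.1 hC with hC | hC
  · rcases List.mem_append.1 hC with hC | hC
    · exact Or.inl (mem_opTrans.1 hC)
    · exact Or.inr (Or.inl (mem_opAnti.1 hC))
  · exact Or.inr (Or.inr (h1 C hC))

/-- No clause is falsified by `A`. -/
structure NoConf (n : ℕ) (LS : ℕ → ℕ → Prop) (A : Asg) : Prop where
  trans : ∀ i j k, A i j true → A j k true → A i k false → False
  anti : ∀ i j, A i j true → A j i true → False
  col : ∀ j m, LS j m → ∃ x, x ≤ m ∧ x ≠ j ∧ ¬ A x j false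

theorem NoConf.not_falsifies {n : ℕ} {LS : ℕ → ℕ → Prop} {db : List Clause} {tr : List Entry}
    {A : Asg} (h : NoConf n LS A) (hdb : DB n LS db) (hA : Rep n tr A) :
    ∀ C ∈ db, ¬ Falsifies (lits tr) C := by
  intro C hC hf
  rcases hdb.cases hC with ⟨i, j, k, hi, hj, hk, h1, h2, h3, rfl⟩ | ⟨i, j, hi, hj, h1, rfl⟩ |
    ⟨j, m, hLS, hcol⟩
  · refine h.trans i j k ((hA.mem_iff ⟨hi, hj, h1⟩).1 (hf (opVar n i j, false) (by simp)))
      ((hA.mem_iff ⟨hj, hk, h3⟩).1 (hf (opVar n j k, false) (by simp)))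
      ((hA.mem_iff ⟨hi, hk, h2.symm⟩).1 (hf (opVar n i k, true) (by simp)))
  · exact h.anti i j ((hA.mem_iff ⟨hi, hj, h1⟩).1 (hf (opVar n i j, false) (by simp)))
      ((hA.mem_iff ⟨hj, hi, h1.symm⟩).1 (hf (opVar n j i, false) (by simp)))
  · obtain ⟨x, hx, hxj, hn⟩ := h.col j m hLS
    have := hdb.range j m hLS
    exact hn ((hA.mem_iff ⟨by omega, by omega, hxj⟩).1
      (hf (opVar n x j, true) ((hcol.mem _).2 ⟨x, hx, hxj, rfl⟩)))

theorem NoConf.mono {n : ℕ} {LS : ℕ → ℕ → Prop} {A A' : Asg} (h : NoConf n LS A')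
    (hA : ∀ i j b, A i j b → A' i j b) : NoConf n LS A :=
  ⟨fun i j k h1 h2 h3 => h.trans i j k (hA _ _ _ h1) (hA _ _ _ h2) (hA _ _ _ h3),
    fun i j h1 h2 => h.anti i j (hA _ _ _ h1) (hA _ _ _ h2),
    fun j m hm => (h.col j m hm).imp fun _ hx => ⟨hx.1, hx.2.1, fun h => hx.2.2 (hA _ _ _ h)⟩⟩

/-! ### Propagation of a literal -/

/-- The union of two assignments. -/
def Asg.union (A W : Asg) : Asg := fun i j b => A i j b ∨ W i j b

/-- A value is assigned. -/
def Asg.Def (A : Asg) (i j : ℕ) : Prop := A i j true ∨ A i j false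

/-- Between `A` and `A ∪ W`, the transitivity clause for `i, j, k` implies only literals
from `W`. -/
structure TransOK (A W : Asg) (i j k : ℕ) : Prop where
  third : A.union W i j true → A.union W j k true → A.Def i k ∨ W i k true
  second : A.union W i j true → A.union W i k false → A.Def j k ∨ W j k false
  first : A.union W j k true → A.union W i k false → A.Def i j ∨ W i j false

/-- Between `A` and `A ∪ W`, the column clause for `j, m` implies only literals from `W`. -/
def ColOK (A W : Asg) (j m : ℕ) : Prop :=
  ∀ w ≤ m, w ≠ j → (∀ x ≤ m, x ≠ j → x ≠ w → A.union W x j false) → A.Def w j ∨ W w j true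

/-- What is known about the entries `new` that the propagation of `l` puts on the trail `tr`. -/
structure Fresh (n : ℕ) (db : List Clause) (tr : List Entry) (lvl : ℕ) (l : Lit) (W : Asg)
    (new : List Entry) : Prop where
  mem : ∀ l', l' ∈ lits new ↔ AsgLit n W l'
  info : ∀ e ∈ new, e.level = lvl ∧ ∃ C ∈ db, e.reason = some C ∧ neg l ∈ C ∧ e.lit ∈ C ∧
    ∀ l' ∈ C, l' ≠ e.lit → neg l' ∈ lits (new ++ tr)

theorem Rep.union_of {n : ℕ} {tr new : List Entry} {A W : Asg}
    (hA : Rep n tr A) (hnd : NodupVars (new ++ tr))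
    (hmem : ∀ l, l ∈ lits (new ++ tr) ↔ l ∈ lits tr ∨ AsgLit n W l) :
    Rep n (new ++ tr) (A.union W) := by
  refine ⟨hnd, fun l => ?_⟩
  rw [hmem, hA.mem]
  constructor
  · rintro (⟨i, j, b, hv, rfl, h⟩ | ⟨i, j, b, hv, rfl, h⟩)
    · exact ⟨i, j, b, hv, rfl, Or.inl h⟩
    · exact ⟨i, j, b, hv, rfl, Or.inr h⟩
  · rintro ⟨i, j, b, hv, rfl, h | h⟩
    · exact Or.inl ⟨i, j, b, hv, rfl, h⟩
    · exact Or.inr ⟨i, j, b, hv, rfl, h⟩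

/-- `saturate_spec` in terms of assignments. -/
theorem saturate_asg {n : ℕ} {p : Option Lit} {lvl : ℕ} {Γ : List Clause} {tr : List Entry}
    {A W : Asg} (hA : Rep n tr A)
    (hW : ∀ i j b, Valid n i j → W i j b → ¬ A.Def i j ∧ ¬ W i j (!b))
    (hsound : ∀ C ∈ Γ, Visits p C → ∀ w ∈ C,
      (∀ l ∈ C, l ≠ w → AsgLit n (A.union W) (neg l)) → ∃ i j b, Valid n i j ∧
        w = (opVar n i j, b) ∧ (A.Def i j ∨ W i j b))
    (hcomp : ∀ i j b, Valid n i j → W i j b → ∃ C ∈ Γ, Visits p C ∧ (opVar n i j, b) ∈ C ∧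
      ∀ l ∈ C, l ≠ (opVar n i j, b) → AsgLit n A (neg l)) :
    ∃ new, (saturate p lvl Γ tr).val = (new ++ tr, (lits new).reverse) ∧
      Rep n (new ++ tr) (A.union W) ∧ (∀ l, l ∈ lits new ↔ AsgLit n W l) ∧
      (∀ e ∈ new, e.level = lvl ∧ ∃ C ∈ Γ, e.reason = some C ∧ Visits p C ∧ e.lit ∈ C ∧
        ∀ l ∈ C, l ≠ e.lit → neg l ∈ lits (new ++ tr)) := by
  have hdisj : ∀ w, AsgLit n W w → w ∉ lits tr ∧ neg w ∉ lits tr ∧ ¬ AsgLit n W (neg w) := by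
    rintro _ ⟨i, j, b, hv, rfl, h⟩
    obtain ⟨h1, h2⟩ := hW i j b hv h
    simp only [neg]
    rw [hA.mem_iff hv, hA.mem_iff hv, asgLit_iff hv]
    refine ⟨fun h => h1 ?_, fun h => h1 ?_, h2⟩ <;> cases b <;> simp_all [Asg.Def]
  have hun : ∀ l, AsgLit n (A.union W) l ↔ l ∈ lits tr ∨ AsgLit n W l := by
    intro l
    rw [hA.mem]
    constructor
    · rintro ⟨i, j, b, hv, rfl, h | h⟩
      · exact Or.inl ⟨i, j, b, hv, rfl, h⟩
      · exact Or.inr ⟨i, j, b, hv, rfl, h⟩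
    · rintro (⟨i, j, b, hv, rfl, h⟩ | ⟨i, j, b, hv, rfl, h⟩)
      · exact ⟨i, j, b, hv, rfl, Or.inl h⟩
      · exact ⟨i, j, b, hv, rfl, Or.inr h⟩
  obtain ⟨new, h1, h2, h3, h4, h5⟩ := saturate_spec (p := p) (lvl := lvl) (Γ := Γ) (tr := tr)
    (AsgLit n W) hA.nodup (fun w hw => (hdisj w hw).2)
    (by
      intro C hC hv w hw hf
      obtain ⟨i, j, b, hv, rfl, h | h⟩ := hsound C hC hv w hw fun l hl hne =>
        (hun _).2 (hf l hl hne)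
      · simp only [neg]
        rw [hA.mem_iff hv, hA.mem_iff hv]
        rcases h with h | h <;> cases b <;> simp [h]
      · exact Or.inr (Or.inr ⟨i, j, b, hv, rfl, h⟩))
    (by
      rintro _ ⟨i, j, b, hv, rfl, h⟩
      obtain ⟨C, hC, hvis, hm, hf⟩ := hcomp i j b hv h
      exact ⟨C, hC, hvis, hm, fun l hl hne => (hA.mem _).2 (hf l hl hne)⟩)
  refine ⟨new, h1, hA.union_of h2 h3, fun l => ⟨h4 l, fun hl => ?_⟩, fun e he => ?_⟩
  · have := (h3 l).2 (Or.inr hl)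
    rw [lits_append, List.mem_append] at this
    exact this.resolve_right (hdisj l hl).1
  · obtain ⟨ha, C, hC, hb, hc, hd, hf⟩ := h5 e he
    exact ⟨ha, C, hC, hb, hc, hd, fun l hl hne => (h3 _).2 (hf l hl hne)⟩

/-- Allows a pass to be split where the order clauses end and the column clauses begin. -/
theorem saturate_append (p : Option Lit) (lvl : ℕ) (Γ Γ' : List Clause) : ∀ tr : List Entry,
    (saturate p lvl (Γ ++ Γ') tr).val =
      ((saturate p lvl Γ' (saturate p lvl Γ tr).val.1).val.1,
        (saturate p lvl Γ tr).val.2 ++ (saturate p lvl Γ' (saturate p lvl Γ tr).val.1).val.2) := by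
  induction Γ with
  | nil => intro tr; simp [saturate]
  | cons C Γ ih =>
    intro tr
    rw [List.cons_append]
    simp only [saturate, val_bind]
    split_ifs
    · simp only [val_bind]
      split <;> simp [ih]
    · simp [ih]

theorem asgLit_neg {n : ℕ} {A : Asg} {i j : ℕ} {b : Bool} (hv : Valid n i j) :
    AsgLit n A (neg (opVar n i j, b)) ↔ A i j (!b) := asgLit_iff hv

/-- The transitivity and antisymmetry clauses imply only literals from `W`. -/
theorem sound_order {n : ℕ} {p : Option Lit} {A W : Asg}
    (htrans : ∀ i j k, i < n → j < n → k < n → i ≠ j → k ≠ i → j ≠ k →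
      Visits p [(opVar n i j, false), (opVar n j k, false), (opVar n i k, true)] →
      TransOK A W i j k)
    (hanti : ∀ i j, i < n → j < n → i ≠ j → Visits p [(opVar n i j, false), (opVar n j i, false)] →
      (A.union W i j true → A.Def j i ∨ W j i false) ∧
      (A.union W j i true → A.Def i j ∨ W i j false)) :
    ∀ C ∈ opTrans n ++ opAnti n, Visits p C → ∀ w ∈ C,
      (∀ l ∈ C, l ≠ w → AsgLit n (A.union W) (neg l)) → ∃ i j b, Valid n i j ∧
        w = (opVar n i j, b) ∧ (A.Def i j ∨ W i j b) := by
  intro C hC hvis w hw hf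
  rcases List.mem_append.1 hC with hC | hC
  · obtain ⟨i, j, k, hi, hj, hk, h1, h2, h3, rfl⟩ := mem_opTrans.1 hC
    have hok := htrans i j k hi hj hk h1 h2 h3 hvis
    have v1 : Valid n i j := ⟨hi, hj, h1⟩
    have v2 : Valid n j k := ⟨hj, hk, h3⟩
    have v3 : Valid n i k := ⟨hi, hk, h2.symm⟩
    have f1 : (opVar n i j, false) ≠ w → A.union W i j true := fun h =>
      (asgLit_neg v1).1 (hf (opVar n i j, false) (by simp) h)
    have f2 : (opVar n j k, false) ≠ w → A.union W j k true := fun h =>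
      (asgLit_neg v2).1 (hf (opVar n j k, false) (by simp) h)
    have f3 : (opVar n i k, true) ≠ w → A.union W i k false := fun h =>
      (asgLit_neg v3).1 (hf (opVar n i k, true) (by simp) h)
    simp only [List.mem_cons, List.not_mem_nil, or_false] at hw
    rcases hw with rfl | rfl | rfl
    · refine ⟨i, j, false, v1, rfl, hok.first (f2 ?_) (f3 (by simp))⟩
      rw [Ne, Prod.mk.injEq, opVar_inj hj hi]
      omega
    · refine ⟨j, k, false, v2, rfl, hok.second (f1 ?_) (f3 (by simp))⟩
      rw [Ne, Prod.mk.injEq, opVar_inj hi hj]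
      omega
    · exact ⟨i, k, true, v3, rfl, hok.third (f1 (by simp)) (f2 (by simp))⟩
  · obtain ⟨i, j, hi, hj, h1, rfl⟩ := mem_opAnti.1 hC
    have hok := hanti i j hi hj h1 hvis
    have v1 : Valid n i j := ⟨hi, hj, h1⟩
    have v2 : Valid n j i := ⟨hj, hi, h1.symm⟩
    have hne : (opVar n i j, false) ≠ (opVar n j i, false) := by
      rw [Ne, Prod.mk.injEq, opVar_inj hi hj]; omega
    simp only [List.mem_cons, List.not_mem_nil, or_false] at hw
    rcases hw with rfl | rfl
    · exact ⟨i, j, false, v1, rfl,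
        hok.2 ((asgLit_neg v2).1 (hf (opVar n j i, false) (by simp) hne.symm))⟩
    · exact ⟨j, i, false, v2, rfl,
        hok.1 ((asgLit_neg v1).1 (hf (opVar n i j, false) (by simp) hne))⟩

/-- The literals that follow from `P_{a,b}` and `A` by one transitivity or antisymmetry clause. -/
def ImplPos (A : Asg) (a b i j : ℕ) (c : Bool) : Prop :=
  (c = false ∧ j = a ∧ i ≠ b ∧ A i b false) ∨ (c = false ∧ i = b ∧ j = a) ∨
  (c = true ∧ i = a ∧ j ≠ b ∧ A b j true)

/-- Only clauses with `¬ P_{a,b}` are visited. Column clauses are positive, so what remains are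
transitivity clauses with `a, b` as first or as second pair, and the antisymmetry clause: one
hypothesis for each of the three. -/
theorem saturate_pos {n : ℕ} {LS : ℕ → ℕ → Prop} {db : List Clause} {tr : List Entry} {lvl : ℕ}
    {A W : Asg} (hdb : DB n LS db) (hA : Rep n tr A) {a b : ℕ} (hv : Valid n a b)
    (hab : A a b true)
    (hW : ∀ i j c, Valid n i j → W i j c → ¬ A.Def i j ∧ ¬ W i j (!c))
    (h₁ : ∀ c < n, c ≠ a → c ≠ b → TransOK A W a b c)
    (h₂ : ∀ c < n, c ≠ a → c ≠ b → TransOK A W c a b)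
    (h₃ : A.Def b a ∨ W b a false)
    (hcomp : ∀ i j c, Valid n i j → W i j c → ImplPos A a b i j c) :
    ∃ new, (saturate (some (opVar n a b, true)) lvl db tr).val = (new ++ tr, (lits new).reverse) ∧
      Rep n (new ++ tr) (A.union W) ∧ Fresh n db tr lvl (opVar n a b, true) W new := by
  obtain ⟨Cs, hsplit, hC1, hC2⟩ := hdb.split
  have hsound : ∀ C ∈ db, Visits (some (opVar n a b, true)) C → ∀ w ∈ C,
      (∀ l ∈ C, l ≠ w → AsgLit n (A.union W) (neg l)) → ∃ i j b, Valid n i j ∧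
        w = (opVar n i j, b) ∧ (A.Def i j ∨ W i j b) := by
    intro C hC hvis
    rw [hsplit] at hC
    rcases List.mem_append.1 hC with hC | hC
    · refine sound_order ?_ ?_ C hC hvis
      · intro i j k hi hj hk h1 h2 h3 hvis
        have := hvis _ rfl
        simp only [neg, Bool.not_true, List.mem_cons, Prod.mk.injEq, Bool.false_eq_true, and_false,
          List.not_mem_nil, or_false, and_true, opVar_inj hv.1 hi, opVar_inj hv.1 hj] at this
        rcases this with ⟨rfl, rfl⟩ | ⟨rfl, rfl⟩
        · exact h₁ k hk h2 h3.symm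
        · exact h₂ i hi h1 h2.symm
      · intro i j hi hj h1 hvis
        have := hvis _ rfl
        simp only [neg, Bool.not_true, List.mem_cons, Prod.mk.injEq, and_true,
          List.not_mem_nil, or_false, opVar_inj hv.1 hi, opVar_inj hv.1 hj] at this
        rcases this with ⟨rfl, rfl⟩ | ⟨rfl, rfl⟩
        · exact ⟨fun _ => h₃, fun _ => Or.inl (Or.inl hab)⟩
        · exact ⟨fun _ => Or.inl (Or.inl hab), fun _ => h₃⟩
    · obtain ⟨j, m, -, hcol⟩ := hC1 C hC
      obtain ⟨x, -, -, hx⟩ := (hcol.mem _).1 (hvis _ rfl)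
      simp [neg] at hx
  have htm : ∀ i j k, i < n → j < n → k < n → i ≠ j → k ≠ i → j ≠ k →
      [(opVar n i j, false), (opVar n j k, false), (opVar n i k, true)] ∈ db := by
    intro i j k hi hj hk h1 h2 h3
    rw [hsplit]
    exact List.mem_append_left _ (List.mem_append_left _
      (mem_opTrans.2 ⟨i, j, k, hi, hj, hk, h1, h2, h3, rfl⟩))
  obtain ⟨new, e1, e2, e3, e4⟩ := saturate_asg (lvl := lvl) hA hW hsound (by
    intro i j c hij hw
    obtain ⟨hi, hj, hne⟩ := hij
    obtain ⟨ha, hb, hab'⟩ := hv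
    rcases hcomp i j c ⟨hi, hj, hne⟩ hw with ⟨rfl, rfl, hib, hf⟩ | ⟨rfl, rfl, rfl⟩ |
      ⟨rfl, rfl, hjb, hf⟩
    · refine ⟨_, htm i j b hi hj hb hne hib.symm hab', by simp [Visits, neg], by simp, ?_⟩
      intro l hl hln
      simp only [List.mem_cons, List.not_mem_nil, or_false] at hl
      rcases hl with rfl | rfl | rfl
      · exact absurd rfl hln
      · exact (asgLit_neg ⟨ha, hb, hab'⟩).2 hab
      · exact (asgLit_neg ⟨hi, hb, hib⟩).2 hf
    · refine ⟨[(opVar n i j, false), (opVar n j i, false)], ?_, by simp [Visits, neg], by simp, ?_⟩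
      · rw [hsplit]
        exact List.mem_append_left _ (List.mem_append_right _
          (mem_opAnti.2 ⟨i, j, hi, hj, hne, rfl⟩))
      · intro l hl hln
        simp only [List.mem_cons, List.not_mem_nil, or_false] at hl
        rcases hl with rfl | rfl
        · exact absurd rfl hln
        · exact (asgLit_neg ⟨ha, hb, hab'⟩).2 hab
    · refine ⟨_, htm i b j hi hb hj hab' hne.symm hjb.symm, by simp [Visits, neg], by simp, ?_⟩
      intro l hl hln
      simp only [List.mem_cons, List.not_mem_nil, or_false] at hl
      rcases hl with rfl | rfl | rfl
      · exact (asgLit_neg ⟨ha, hb, hab'⟩).2 hab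
      · exact (asgLit_neg ⟨hb, hj, hjb.symm⟩).2 hf
      · exact absurd rfl hln)
  refine ⟨new, e1, e2, e3, fun e he => ?_⟩
  obtain ⟨h1, C, hC, h2, h3, h4, h5⟩ := e4 e he
  exact ⟨h1, C, hC, h2, h3 _ rfl, h4, h5⟩

/-- Propagation of `¬ P_{a,b}`: first the transitivity clauses imply `W₁`, then the column
clauses imply `W₂`. -/
theorem saturate_neg {n : ℕ} {LS : ℕ → ℕ → Prop} {db : List Clause} {tr : List Entry} {lvl : ℕ}
    {A W₁ W₂ : Asg} (hdb : DB n LS db) (hA : Rep n tr A) {a b : ℕ} (hv : Valid n a b)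
    (hab : A a b false)
    (hW₁ : ∀ i j c, Valid n i j → W₁ i j c → ¬ A.Def i j ∧ ¬ W₁ i j (!c))
    (hW₂ : ∀ i j c, Valid n i j → W₂ i j c → ¬ (A.union W₁).Def i j ∧ ¬ W₂ i j (!c))
    (h₁ : ∀ c < n, c ≠ a → c ≠ b → TransOK A W₁ a c b)
    (h₂ : ∀ m, LS b m → a ≤ m → ColOK (A.union W₁) W₂ b m)
    (hcomp₁ : ∀ i j c, Valid n i j → W₁ i j c → c = false ∧ i = a ∧ j ≠ b ∧ A j b true)
    (hcomp₂ : ∀ i j c, Valid n i j → W₂ i j c → c = true ∧ j = b ∧ ∃ m, LS b m ∧ a ≤ m ∧ i ≤ m ∧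
      ∀ x ≤ m, x ≠ b → x ≠ i → A x b false) :
    ∃ new, (saturate (some (opVar n a b, false)) lvl db tr).val = (new ++ tr, (lits new).reverse) ∧
      Rep n (new ++ tr) ((A.union W₁).union W₂) ∧
      Fresh n db tr lvl (opVar n a b, false) (W₁.union W₂) new := by
  obtain ⟨Cs, hsplit, hC1, hC2⟩ := hdb.split
  obtain ⟨ha, hb, hne⟩ := hv
  obtain ⟨new₁, e1, e2, e3, e4⟩ := saturate_asg (p := some (opVar n a b, false)) (lvl := lvl)
    (Γ := opTrans n ++ opAnti n) hA hW₁ (sound_order (by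
      intro i j k hi hj hk h1 h2 h3 hvis
      have := hvis _ rfl
      simp only [neg, Bool.not_false, List.mem_cons, Prod.mk.injEq, Bool.true_eq_false, and_false,
        List.not_mem_nil, or_false, and_true, opVar_inj ha hi, false_or] at this
      obtain ⟨rfl, rfl⟩ := this
      exact h₁ j hj h1.symm h3) (by
      intro i j hi hj h1 hvis
      have := hvis _ rfl
      simp [neg] at this)) (by
      intro i j c hij hw
      obtain ⟨hi, hj, hne'⟩ := hij
      obtain ⟨rfl, rfl, hjb, hf⟩ := hcomp₁ i j c ⟨hi, hj, hne'⟩ hw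
      refine ⟨_, List.mem_append_left _ (mem_opTrans.2 ⟨i, j, b, hi, hj, hb, hne', hne.symm, hjb,
        rfl⟩), by simp [Visits, neg], by simp, ?_⟩
      intro l hl hln
      simp only [List.mem_cons, List.not_mem_nil, or_false] at hl
      rcases hl with rfl | rfl | rfl
      · exact absurd rfl hln
      · exact (asgLit_neg ⟨hj, hb, hjb⟩).2 hf
      · exact (asgLit_neg ⟨hi, hb, hne⟩).2 hab)
  -- All column clauses stand behind the order clauses in the database, so the second half of the
  -- pass starts from `A.union W₁`.
  obtain ⟨new₂, e1', e2', e3', e4'⟩ := saturate_asg (p := some (opVar n a b, false)) (lvl := lvl)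
    (Γ := Cs) e2 hW₂ (by
      intro C hC hvis w hw hf
      obtain ⟨j, m, hLS, hcol⟩ := hC1 C hC
      have hr := hdb.range j m hLS
      obtain ⟨x, hx, hxj, hxe⟩ := (hcol.mem _).1 (hvis _ rfl)
      simp only [neg, Bool.not_false, Prod.mk.injEq, and_true, opVar_inj ha
        (show x < n by omega)] at hxe
      obtain ⟨rfl, rfl⟩ := hxe
      obtain ⟨y, hy, hyj, rfl⟩ := (hcol.mem _).1 hw
      have hvy : Valid n y b := ⟨by omega, hb, hyj⟩
      refine ⟨y, b, true, hvy, rfl, h₂ m hLS hx y hy hyj fun z hz hzb hzy => ?_⟩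
      refine (asgLit_neg ⟨by omega, hb, hzb⟩).1
        (hf (opVar n z b, true) ((hcol.mem _).2 ⟨z, hz, hzb, rfl⟩) ?_)
      rw [Ne, Prod.mk.injEq, opVar_inj (by omega) hvy.1]
      omega) (by
      intro i j c hij hw
      obtain ⟨rfl, rfl, m, hLS, ham, him, hf⟩ := hcomp₂ i j c hij hw
      have hr := hdb.range j m hLS
      obtain ⟨C, hC, hcol⟩ := hC2 j m hLS
      refine ⟨C, hC, ?_, (hcol.mem _).2 ⟨i, him, hij.2.2, rfl⟩, ?_⟩
      · intro l hl
        obtain rfl := Option.some.inj hl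
        exact (hcol.mem _).2 ⟨a, ham, hne, rfl⟩
      · intro l hl hln
        obtain ⟨x, hx, hxj, rfl⟩ := (hcol.mem _).1 hl
        refine (asgLit_neg ⟨by omega, hb, hxj⟩).2 (Or.inl (hf x hx hxj fun h => hln ?_))
        rw [h])
  refine ⟨new₂ ++ new₁, ?_, ?_, ?_, ?_⟩
  · rw [hsplit, saturate_append, e1]
    simp only [e1', List.append_assoc, lits_append, List.reverse_append]
  · rw [List.append_assoc]; exact e2'
  · intro l
    rw [lits_append, List.mem_append, e3, e3']
    constructor
    · rintro (⟨i, j, b, hv, rfl, h⟩ | ⟨i, j, b, hv, rfl, h⟩)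
      · exact ⟨i, j, b, hv, rfl, Or.inr h⟩
      · exact ⟨i, j, b, hv, rfl, Or.inl h⟩
    · rintro ⟨i, j, b, hv, rfl, h | h⟩
      · exact Or.inr ⟨i, j, b, hv, rfl, h⟩
      · exact Or.inl ⟨i, j, b, hv, rfl, h⟩
  · intro e he
    rcases List.mem_append.1 he with he | he
    · obtain ⟨h1, C, hC, h2, h3, h4, h5⟩ := e4' e he
      refine ⟨h1, C, by rw [hsplit]; exact List.mem_append_right _ hC, h2, h3 _ rfl, h4, ?_⟩
      rw [List.append_assoc]
      exact h5
    · obtain ⟨h1, C, hC, h2, h3, h4, h5⟩ := e4 e he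
      refine ⟨h1, C, by rw [hsplit]; exact List.mem_append_left _ hC, h2, h3 _ rfl, h4, ?_⟩
      intro l hl hln
      rw [List.append_assoc, lits_append]
      exact List.mem_append_right _ (h5 l hl hln)

/-! ### Steps of the search on the ordering principle -/

/-- The empty assignment. -/
def noAsg : Asg := fun _ _ _ => False

theorem union_noAsg (A : Asg) : A.union noAsg = A := by
  funext i j b; simp [Asg.union, noAsg]

theorem noAsg_union (A : Asg) : noAsg.union A = A := by
  funext i j b; simp [Asg.union, noAsg]

/-- The data of the solver that are fixed between two conflicts, with all sizes below `D`. -/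
structure Env (n : ℕ) (δ : ℚ) (D : ℕ) (LS : ℕ → ℕ → Prop) (db : List Clause) (vars : List ℕ)
    (sc : ℕ → ℚ) : Prop where
  n6 : 6 ≤ n
  dbs : DB n LS db
  vars_mem : ∀ x, x ∈ vars ↔ ∃ i j, Valid n i j ∧ x = opVar n i j
  clause_len : ∀ C ∈ db, C.length + 2 ≤ D
  len : n * n + db.length + 4 ≤ D
  vars_len : vars.length + 1 ≤ D
  bits_δ : bits δ ≤ D
  bits_sc : ∀ x, bits (sc x) ≤ D ∧ bits (δ * sc x) ≤ D

/-- The search state carries the assignment `A`. -/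
structure St (n : ℕ) (db : List Clause) (A : Asg) (s : Local) : Prop where
  rep : Rep n s.2.1 A
  reason : ∀ e ∈ s.2.1, ∀ C ∈ e.reason, C ∈ db
  queue : s.2.2.length ≤ s.2.1.length
  level : ∀ e ∈ s.2.1, e.level ≤ s.1

section steps

variable {n : ℕ} {δ : ℚ} {D : ℕ} {LS : ℕ → ℕ → Prop} {db : List Clause} {vars : List ℕ}
  {sc : ℕ → ℚ} {A : Asg} {s₀ : Local} {lvl : ℕ} {tr : List Entry} {q : List Lit}

/-- The score list of the solver. -/
abbrev scList (vars : List ℕ) (sc : ℕ → ℚ) : List (ℕ × ℚ) := vars.map fun y => (y, sc y)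

theorem Env.bounded (hE : Env n δ D LS db vars sc) {s : Local} (hS : St n db A s) :
    Bounded δ D (mkSearch db (scList vars sc) s) where
  db := hE.clause_len
  len := by
    have h1 := hS.rep.length_le
    have h2 := hE.len
    simp only [mkSearch]
    omega
  queue := by
    have h1 := hS.rep.length_le
    have h2 := hE.len
    have h3 := hS.queue
    simp only [mkSearch]
    omega
  reason := fun e he C hC => by
    have := hE.clause_len C (hS.reason e he C hC)
    omega
  scores := by simpa [mkSearch] using hE.vars_len
  bits_δ := hE.bits_δ
  bits_scores := by
    intro p hp
    obtain ⟨x, -, rfl⟩ := List.mem_map.1 hp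
    exact hE.bits_sc x

theorem Env.findConflict (hE : Env n δ D LS db vars sc) (hA : Rep n tr A) (hn : NoConf n LS A) :
    (findConflict tr db).val = none :=
  findConflict_none hA.nodup (hn.not_falsifies hE.dbs hA)

theorem Env.cost (hE : Env n δ D LS db vars sc) {s : Local} (hS : St n db A s)
    (hn : NoConf n LS A) :
    (searchStep δ (mkSearch db (scList vars sc) s)).cost ≤ stepCost D :=
  searchStep_cost (hE.bounded hS) fun _ C hC => by
    have := hE.findConflict hS.rep hn
    simp only [mkSearch] at hC
    rw [this] at hC
    cases hC

theorem step_propagate (hE : Env n δ D LS db vars sc) {l : Lit} {new : List Entry} {W A' : Asg}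
    (h : Steps δ (stepCost D) db (scList vars sc) s₀ (lvl, tr, l :: q))
    (hS : St n db A (lvl, tr, l :: q)) (hn : NoConf n LS A)
    (hsat : (saturate (some l) lvl db tr).val = (new ++ tr, (lits new).reverse))
    (hA' : Rep n (new ++ tr) A') (hf : Fresh n db tr lvl l W new) :
    Steps δ (stepCost D) db (scList vars sc) s₀ (lvl, new ++ tr, q ++ (lits new).reverse) ∧
      St n db A' (lvl, new ++ tr, q ++ (lits new).reverse) := by
  refine ⟨Steps.tail _ _ _ h ?_ (hE.cost hS hn) ?_, ⟨hA', ?_, ?_, ?_⟩⟩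
  · simp [searchStep, mkSearch, hE.findConflict hS.rep hn, hsat]
  · simp; omega
  · intro e he C hC
    rcases List.mem_append.1 he with he | he
    · obtain ⟨-, E, hE', hr, -⟩ := hf.info e he
      rw [hr] at hC
      obtain rfl := Option.some.inj hC
      exact hE'
    · exact hS.reason e he C hC
  · have := hS.queue
    simp at this ⊢
    omega
  · intro e he
    rcases List.mem_append.1 he with he | he
    · exact (hf.info e he).1.le
    · exact hS.level e he

theorem step_pos (hE : Env n δ D LS db vars sc) {a b : ℕ} (W A' : Asg)
    (h : Steps δ (stepCost D) db (scList vars sc) s₀ (lvl, tr, (opVar n a b, true) :: q))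
    (hS : St n db A (lvl, tr, (opVar n a b, true) :: q)) (hn : NoConf n LS A)
    (hv : Valid n a b) (hab : A a b true)
    (hA' : ∀ i j c, Valid n i j → (A i j c ∨ W i j c ↔ A' i j c))
    (hW : ∀ i j c, Valid n i j → W i j c → ¬ A.Def i j ∧ ¬ W i j (!c))
    (h₁ : ∀ c < n, c ≠ a → c ≠ b → TransOK A W a b c)
    (h₂ : ∀ c < n, c ≠ a → c ≠ b → TransOK A W c a b)
    (h₃ : A.Def b a ∨ W b a false)
    (hcomp : ∀ i j c, Valid n i j → W i j c → ImplPos A a b i j c) :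
    ∃ new, Steps δ (stepCost D) db (scList vars sc) s₀ (lvl, new ++ tr, q ++ (lits new).reverse) ∧
      St n db A' (lvl, new ++ tr, q ++ (lits new).reverse) ∧
      Fresh n db tr lvl (opVar n a b, true) W new := by
  obtain ⟨new, h1, h2, h3⟩ := saturate_pos (lvl := lvl) hE.dbs hS.rep hv hab hW h₁ h₂ h₃ hcomp
  obtain ⟨h4, h5⟩ := step_propagate hE h hS hn h1 (h2.congr hA') h3
  exact ⟨new, h4, h5, h3⟩

theorem step_neg (hE : Env n δ D LS db vars sc) {a b : ℕ} (W₁ W₂ A' : Asg)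
    (h : Steps δ (stepCost D) db (scList vars sc) s₀ (lvl, tr, (opVar n a b, false) :: q))
    (hS : St n db A (lvl, tr, (opVar n a b, false) :: q)) (hn : NoConf n LS A)
    (hv : Valid n a b) (hab : A a b false)
    (hA' : ∀ i j c, Valid n i j → ((A i j c ∨ W₁ i j c) ∨ W₂ i j c ↔ A' i j c))
    (hW₁ : ∀ i j c, Valid n i j → W₁ i j c → ¬ A.Def i j ∧ ¬ W₁ i j (!c))
    (hW₂ : ∀ i j c, Valid n i j → W₂ i j c → ¬ (A.union W₁).Def i j ∧ ¬ W₂ i j (!c))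
    (h₁ : ∀ c < n, c ≠ a → c ≠ b → TransOK A W₁ a c b)
    (h₂ : ∀ m, LS b m → a ≤ m → ColOK (A.union W₁) W₂ b m)
    (hcomp₁ : ∀ i j c, Valid n i j → W₁ i j c → c = false ∧ i = a ∧ j ≠ b ∧ A j b true)
    (hcomp₂ : ∀ i j c, Valid n i j → W₂ i j c → c = true ∧ j = b ∧ ∃ m, LS b m ∧ a ≤ m ∧ i ≤ m ∧
      ∀ x ≤ m, x ≠ b → x ≠ i → A x b false) :
    ∃ new, Steps δ (stepCost D) db (scList vars sc) s₀ (lvl, new ++ tr, q ++ (lits new).reverse) ∧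
      St n db A' (lvl, new ++ tr, q ++ (lits new).reverse) ∧
      Fresh n db tr lvl (opVar n a b, false) (W₁.union W₂) new := by
  obtain ⟨new, h1, h2, h3⟩ := saturate_neg (lvl := lvl) hE.dbs hS.rep hv hab hW₁ hW₂ h₁ h₂
    hcomp₁ hcomp₂
  obtain ⟨h4, h5⟩ := step_propagate hE h hS hn h1 (h2.congr hA') h3
  exact ⟨new, h4, h5, h3⟩

theorem Fresh.eq_nil {l : Lit} {new : List Entry} {W : Asg} (h : Fresh n db tr lvl l W new)
    (hW : ∀ i j b, Valid n i j → ¬ W i j b) : new = [] := by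
  cases new with
  | nil => rfl
  | cons e new =>
    obtain ⟨i, j, b, hv, -, hw⟩ := (h.mem e.lit).1 (by simp)
    exact absurd hw (hW i j b hv)

/-- If a pass implies exactly one literal, then the new part of the trail and the shape of its
reason are known; two entries with the same literal would repeat a variable. -/
theorem Fresh.eq_singleton {l : Lit} {new : List Entry} {W : Asg} {a b : ℕ} {c : Bool}
    (h : Fresh n db tr lvl l W new) (hnd : NodupVars (new ++ tr)) (hv : Valid n a b)
    (hW : ∀ i j b', Valid n i j → (W i j b' ↔ i = a ∧ j = b ∧ b' = c)) :
    ∃ C ∈ db, new = [⟨(opVar n a b, c), lvl, some C⟩] ∧ neg l ∈ C ∧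
      (opVar n a b, c) ∈ C ∧ ∀ l' ∈ C, l' ≠ (opVar n a b, c) →
        neg l' = (opVar n a b, c) ∨ neg l' ∈ lits tr := by
  have hall : ∀ e ∈ new, e.lit = (opVar n a b, c) := by
    intro e he
    obtain ⟨i, j, b', hv', hl, hw⟩ := (h.mem e.lit).1 (List.mem_map.2 ⟨e, he, rfl⟩)
    obtain ⟨rfl, rfl, rfl⟩ := (hW i j b' hv').1 hw
    exact hl
  have hin : (opVar n a b, c) ∈ lits new :=
    (h.mem _).2 ⟨a, b, c, hv, rfl, (hW a b c hv).2 ⟨rfl, rfl, rfl⟩⟩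
  match new, h, hnd, hall, hin with
  | [e], h, _, hall, _ =>
    obtain ⟨h1, C, hC, h2, h3, h4, h5⟩ := h.info e (by simp)
    have he := hall e (by simp)
    obtain ⟨l₁, v₁, r₁⟩ := e
    simp only at h1 h2 h4 h5 he
    subst h1 h2 he
    refine ⟨C, hC, rfl, h3, h4, fun l' hl' hne => ?_⟩
    simpa using h5 l' hl' hne
  | e :: e' :: new, h, hnd, hall, _ =>
    have h1 := hall e (by simp)
    have h2 := hall e' (by simp)
    have := hnd.notMem (l := e.lit) rfl
    exact absurd (by simp [h1, h2]) this.1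

/-- The propagation of negative literals that imply nothing. -/
theorem steps_idle (hE : Env n δ D LS db vars sc) (hn : NoConf n LS A) :
    ∀ Q : List Lit, Steps δ (stepCost D) db (scList vars sc) s₀ (lvl, tr, Q) →
    St n db A (lvl, tr, Q) →
    (∀ l ∈ Q, ∃ a b, Valid n a b ∧ l = (opVar n a b, false) ∧ A a b false ∧
      (∀ c < n, c ≠ a → c ≠ b → TransOK A noAsg a c b) ∧
      (∀ m, LS b m → a ≤ m → ColOK A noAsg b m)) →
    Steps δ (stepCost D) db (scList vars sc) s₀ (lvl, tr, []) ∧ St n db A (lvl, tr, []) := by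
  intro Q
  induction Q with
  | nil => exact fun h hS _ => ⟨h, hS⟩
  | cons l Q ih =>
    intro h hS hQ
    obtain ⟨a, b, hv, rfl, hab, ht, hc⟩ := hQ l (by simp)
    obtain ⟨new, h1, h2, h3⟩ := step_neg hE noAsg noAsg A h hS hn hv hab
      (by simp [noAsg]) (by simp [noAsg]) (by simp [noAsg]) ht
      (by rw [union_noAsg]; exact hc) (by simp [noAsg]) (by simp [noAsg])
    obtain rfl := h3.eq_nil (by simp [noAsg, Asg.union])
    simp only [List.nil_append, List.map_nil, List.reverse_nil, List.append_nil] at h1 h2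
    exact ih h1 h2 fun l hl => hQ l (List.mem_cons_of_mem _ hl)

/-- The assignment must leave `P_{a,b}` open and make it preferable to every other open variable;
the negative literal then opens a new level. -/
theorem step_decide (hE : Env n δ D LS db vars sc) {a b : ℕ} (A' : Asg)
    (h : Steps δ (stepCost D) db (scList vars sc) s₀ (lvl, tr, []))
    (hS : St n db A (lvl, tr, [])) (hn : NoConf n LS A) (hv : Valid n a b) (hab : ¬ A.Def a b)
    (hpick : ∀ i j, Valid n i j → ¬ A.Def i j → ¬ (i = a ∧ j = b) →
      Better sc (opVar n a b) (opVar n i j))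
    (hA' : ∀ i j c, Valid n i j → (A i j c ∨ (i = a ∧ j = b ∧ c = false) ↔ A' i j c)) :
    Steps δ (stepCost D) db (scList vars sc) s₀
      (lvl + 1, ⟨(opVar n a b, false), lvl + 1, none⟩ :: tr, [(opVar n a b, false)]) ∧
    St n db A' (lvl + 1, ⟨(opVar n a b, false), lvl + 1, none⟩ :: tr, [(opVar n a b, false)]) := by
  have hdef : ∀ i j, Valid n i j → ¬ A.Def i j →
      (opVar n i j, true) ∉ lits tr ∧ (opVar n i j, false) ∉ lits tr := by
    intro i j hv hd
    constructor
    · exact fun h => hd (Or.inl ((hS.rep.mem_iff hv).1 h))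
    · exact fun h => hd (Or.inr ((hS.rep.mem_iff hv).1 h))
  have hpb : (pickBranch tr (scList vars sc) none).val = some (opVar n a b) := by
    refine pickBranch_val hS.rep.nodup sc (hdef a b hv hab) vars none ?_
      (Or.inl ⟨rfl, (hE.vars_mem _).2 ⟨a, b, hv, rfl⟩⟩)
    intro y hy hne h1 h2
    obtain ⟨i, j, hv', rfl⟩ := (hE.vars_mem y).1 hy
    refine hpick i j hv' ?_ fun h => hne (by rw [h.1, h.2])
    rintro (hd | hd)
    · exact h1 ((hS.rep.mem_iff hv').2 hd)
    · exact h2 ((hS.rep.mem_iff hv').2 hd)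
  refine ⟨Steps.tail _ _ _ h ?_ (hE.cost hS hn) (by simp; omega), ⟨⟨?_, ?_⟩, ?_, ?_, ?_⟩⟩
  · simp [searchStep, mkSearch, hE.findConflict hS.rep hn, hpb]
  · refine List.nodup_cons.2 ⟨fun hm => ?_, hS.rep.nodup⟩
    obtain ⟨e, he, heq⟩ := List.mem_map.1 hm
    rcases eq_or_eq_neg (l := e.lit) (m := (opVar n a b, false)) heq with h' | h'
    · exact (hdef a b hv hab).2 (List.mem_map.2 ⟨e, he, h'⟩)
    · exact (hdef a b hv hab).1 (List.mem_map.2 ⟨e, he, h'⟩)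
  · intro l
    simp only [List.map_cons, List.mem_cons]
    rw [hS.rep.mem]
    constructor
    · rintro (rfl | ⟨i, j, c, hv', rfl, h'⟩)
      · exact ⟨a, b, false, hv, rfl, (hA' _ _ _ hv).1 (Or.inr ⟨rfl, rfl, rfl⟩)⟩
      · exact ⟨i, j, c, hv', rfl, (hA' _ _ _ hv').1 (Or.inl h')⟩
    · rintro ⟨i, j, c, hv', rfl, h'⟩
      rcases (hA' _ _ _ hv').2 h' with h' | ⟨rfl, rfl, rfl⟩
      · exact Or.inr ⟨i, j, c, hv', rfl, h'⟩
      · exact Or.inl rfl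
  · intro e he C hC
    rcases List.mem_cons.1 he with rfl | he
    · cases hC
    · exact hS.reason e he C hC
  · simp
  · intro e he
    rcases List.mem_cons.1 he with rfl | he
    · exact le_rfl
    · exact (hS.level e he).trans (Nat.le_succ _)

/-! ### Restarts -/

theorem restart_val (db : List Clause) (sc : List (ℕ × ℚ)) : (restart db sc).val =
    .search (mkSearch db sc (0, (saturate none 0 db []).val.1, (saturate none 0 db []).val.2)) :=
  rfl

theorem rep_nil (n : ℕ) : Rep n [] noAsg :=
  ⟨List.nodup_nil, fun l => by simp [AsgLit, noAsg]⟩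

/-- The trail after a restart: the column clauses with only one literal are propagated. -/
theorem saturate_none (hdb : DB n LS db) (W : Asg)
    (hW : ∀ i j c, Valid n i j → W i j c → ¬ W i j (!c))
    (h₂ : ∀ j m, LS j m → ColOK noAsg W j m)
    (hcomp : ∀ i j c, Valid n i j → W i j c → c = true ∧ ∃ m, LS j m ∧ i ≤ m ∧
      ∀ x ≤ m, x ≠ j → x = i) :
    ∃ new, (saturate none 0 db []).val = (new, (lits new).reverse) ∧
      St n db W (0, new, (lits new).reverse) := by
  obtain ⟨Cs, hsplit, hC1, hC2⟩ := hdb.split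
  -- Order clauses have at least two literals, so none of them is unit on the empty trail.
  have hT : (saturate none 0 (opTrans n ++ opAnti n) []).val = ([], []) := by
    obtain ⟨new, e1, e2, e3, e4⟩ := saturate_asg (p := none) (lvl := 0)
      (Γ := opTrans n ++ opAnti n) (W := noAsg) (rep_nil n) (by simp [noAsg]) (sound_order (by
        intro i j k _ _ _ _ _ _ _
        constructor <;> simp [Asg.union, noAsg]) (by
        intro i j _ _ _ _
        simp [Asg.union, noAsg])) (by simp [noAsg])
    have : new = [] := by
      cases new with
      | nil => rfl
      | cons e new =>
        obtain ⟨i, j, b, hv, -, hw⟩ := (e3 e.lit).1 (by simp)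
        exact hw.elim
    rw [e1, this]
    rfl
  obtain ⟨new, e1, e2, e3, e4⟩ := saturate_asg (p := none) (lvl := 0) (Γ := Cs) (W := W)
    (rep_nil n) (fun i j b hv h => ⟨by simp [Asg.Def, noAsg], hW i j b hv h⟩) (by
      intro C hC _ w hw hf
      obtain ⟨j, m, hLS, hcol⟩ := hC1 C hC
      have hr := hdb.range j m hLS
      obtain ⟨y, hy, hyj, rfl⟩ := (hcol.mem _).1 hw
      have hvy : Valid n y j := ⟨by omega, by omega, hyj⟩
      refine ⟨y, j, true, hvy, rfl, h₂ j m hLS y hy hyj fun z hz hzb hzy => ?_⟩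
      refine (asgLit_neg ⟨by omega, by omega, hzb⟩).1
        (hf (opVar n z j, true) ((hcol.mem _).2 ⟨z, hz, hzb, rfl⟩) ?_)
      rw [Ne, Prod.mk.injEq, opVar_inj (by omega) hvy.1]
      omega) (by
      intro i j c hij hw
      obtain ⟨rfl, m, hLS, him, hf⟩ := hcomp i j c hij hw
      obtain ⟨C, hC, hcol⟩ := hC2 j m hLS
      refine ⟨C, hC, by simp [Visits], (hcol.mem _).2 ⟨i, him, hij.2.2, rfl⟩, ?_⟩
      intro l hl hln
      obtain ⟨x, hx, hxj, rfl⟩ := (hcol.mem _).1 hl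
      exact absurd (by rw [hf x hx hxj]) hln)
  rw [List.append_nil] at e1 e2
  refine ⟨new, ?_, ⟨by rw [noAsg_union] at e2; exact e2, ?_, by simp, ?_⟩⟩
  · rw [hsplit, saturate_append, hT]
    simp [e1]
  · intro e he C hC
    obtain ⟨-, E, hE', hr, -⟩ := e4 e he
    rw [hr] at hC
    obtain rfl := Option.some.inj hC
    rw [hsplit]
    exact List.mem_append_right _ hE'
  · exact fun e he => (e4 e he).1.le

/-! ### Conflicts -/

/-- Which falsified clause is found first depends on the database, so the property `P` of the
learned clause is required for every falsified clause. The clause `E` is that clause without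
repetitions. -/
theorem step_conflict (hE : Env n δ D LS db vars sc) (hS : St n db A (lvl, tr, q))
    (hlvl : lvl ≠ 0) (hex : ∃ C ∈ db, Falsifies (lits tr) C) {P : Clause → Prop}
    (hP : ∀ C ∈ db, Falsifies (lits tr) C → ∀ E : Clause, E.Nodup → (∀ l, l ∈ E ↔ l ∈ C) →
      P (analyze tr lvl tr E).val) (hPD : ∀ L, P L → L.length + 2 ≤ D) :
    ∃ L, P L ∧ (searchStep δ (mkSearch db (scList vars sc) (lvl, tr, q))).val =
        (restart (db ++ [L]) (scList vars (bump δ L sc))).val ∧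
      (searchStep δ (mkSearch db (scList vars sc) (lvl, tr, q))).cost ≤ stepCost D := by
  obtain ⟨C, hC, hf, hs⟩ := findConflict_some hS.rep.nodup hex
  obtain ⟨h1, h2⟩ := unionLits_val C [] List.nodup_nil
  have hL := hP C hC hf _ h1 (by simpa using h2)
  refine ⟨_, hL, ?_, searchStep_cost (hE.bounded hS) fun _ C' hC' => ?_⟩
  · simp [searchStep, mkSearch, hs, hlvl, updateScores_val]
  · simp only [mkSearch] at hC' ⊢
    rw [hs] at hC'
    obtain rfl := Option.some.inj hC'
    exact hPD _ hL

end steps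

/-! ### Conflict analysis on the ordering principle -/

section analysis

variable {n : ℕ} {LS : ℕ → ℕ → Prop} {db : List Clause}

/-- A reason for `¬ P_{x,p}` that contains `¬ P_{p,k}` or `P_{x,k}` is a transitivity or
antisymmetry clause. -/
theorem reason_form (hdb : DB n LS db) {C : Clause} (hC : C ∈ db) {x p k : ℕ} (hx : x < n)
    (hp : p < n) (hk : k < n) (hxp : x ≠ p) (hpk : p ≠ k) (h : (opVar n x p, false) ∈ C)
    (h' : (opVar n p k, false) ∈ C ∨ (x ≠ k ∧ (opVar n x k, true) ∈ C)) (l : Lit) :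
    (l ∈ C ∧ l ≠ (opVar n x p, false)) ↔
      l = (opVar n p k, false) ∨ (x ≠ k ∧ l = (opVar n x k, true)) := by
  have hne : (opVar n p k, false) ≠ (opVar n x p, false) := by
    rw [Ne, Prod.mk.injEq, opVar_inj hp hx]; omega
  rcases hdb.cases hC with ⟨i, j, m, hi, hj, hm, h1, h2, h3, rfl⟩ | ⟨i, j, hi, hj, h1, rfl⟩ |
    ⟨j, m, hLS, hcol⟩
  · have key : i = x ∧ j = p ∧ m = k ∧ x ≠ k := by
      simp only [List.mem_cons, Prod.mk.injEq, and_true, Bool.false_eq_true, and_false, or_false,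
        List.not_mem_nil, Bool.true_eq_false, false_or, opVar_inj hx hi, opVar_inj hx hj,
        opVar_inj hp hi, opVar_inj hp hj] at h h'
      omega
    obtain ⟨rfl, rfl, rfl, hik⟩ := key
    simp only [List.mem_cons, List.not_mem_nil, or_false]
    constructor
    · rintro ⟨rfl | rfl | rfl, hn⟩
      · exact absurd rfl hn
      · exact Or.inl rfl
      · exact Or.inr ⟨hik, rfl⟩
    · rintro (rfl | ⟨-, rfl⟩)
      · exact ⟨Or.inr (Or.inl rfl), hne⟩
      · exact ⟨Or.inr (Or.inr rfl), by simp⟩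
  · have key : x = k ∧ ((i = x ∧ j = p) ∨ (i = p ∧ j = x)) := by
      simp only [List.mem_cons, Prod.mk.injEq, and_true, Bool.true_eq_false, and_false, or_false,
        List.not_mem_nil, opVar_inj hx hi, opVar_inj hx hj,
        opVar_inj hp hi, opVar_inj hp hj] at h h'
      omega
    obtain ⟨rfl, ⟨rfl, rfl⟩ | ⟨rfl, rfl⟩⟩ := key
    · simp only [List.mem_cons, List.not_mem_nil, or_false, ne_eq, not_true_eq_false, false_and]
      constructor
      · rintro ⟨rfl | rfl, hn⟩
        · exact absurd rfl hn
        · rfl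
      · rintro rfl
        exact ⟨Or.inr rfl, hne⟩
    · simp only [List.mem_cons, List.not_mem_nil, or_false, ne_eq, not_true_eq_false, false_and]
      constructor
      · rintro ⟨rfl | rfl, hn⟩
        · rfl
        · exact absurd rfl hn
      · rintro rfl
        exact ⟨Or.inl rfl, hne⟩
  · obtain ⟨y, -, -, hy⟩ := (hcol.mem _).1 h
    simp at hy

/-- Analysis of the implied literals `¬ P_{x,p}`, which follow from `P_{p,k}` and `¬ P_{x,k}`,
and of `P_{p,k}`. -/
theorem analyze_column (hdb : DB n LS db) {full tr₁ tr₀ : List Entry} {lvl p k : ℕ} {X : Clause}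
    (hfull : NodupVars full) (hpk : Valid n p k) {full' : List Entry}
    (hsub : full = full' ++ (tr₁ ++ ⟨(opVar n p k, true), lvl, some X⟩ :: tr₀)) {B : ℕ → Prop}
    (hB : ∀ x, B x → x < n ∧ x ≠ p ∧ (opVar n x p, false) ∈ lits tr₁ ∧
      (x ≠ k → (opVar n x k, false) ∈ lits tr₀))
    (htr₁ : ∀ e ∈ tr₁, e.level = lvl ∧ ∀ x, B x → e.lit = (opVar n x p, false) → ∃ C ∈ db,
      e.reason = some C ∧ ((opVar n p k, false) ∈ C ∨ (x ≠ k ∧ (opVar n x k, true) ∈ C)) ∧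
        e.lit ∈ C)
    {x₁ x₂ y : ℕ} (hx₁ : B x₁) (hx₂ : B x₂) (hx : x₁ ≠ x₂) (hy : B y) (hyk : y ≠ k)
    (hyl : AtLevel full lvl (opVar n y k, true))
    (hX : ∀ l ∈ X, l ≠ (opVar n p k, true) → ∃ x, B x ∧ x ≠ k ∧ l = (opVar n x k, true))
    {E : Clause} (hE : E.Nodup) (hEm : ∀ l, l ∈ E ↔ ∃ x, B x ∧ l = (opVar n x p, true)) :
    ∃ E' : Clause, E'.Nodup ∧ (∀ l, l ∈ E' ↔ ∃ x, B x ∧ x ≠ k ∧ l = (opVar n x k, true)) ∧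
      (analyze full lvl (tr₁ ++ ⟨(opVar n p k, true), lvl, some X⟩ :: tr₀) E).val =
        (analyze full lvl tr₀ E').val := by
  obtain ⟨hp, hk, hpk⟩ := hpk
  have hin : ∀ e ∈ tr₁, e ∈ full := by
    intro e he; rw [hsub]; simp [he]
  have hep : (⟨(opVar n p k, true), lvl, some X⟩ : Entry) ∈ full := by
    rw [hsub]; simp
  obtain ⟨E', h1, h2, h3⟩ := analyze_layer (ep := ⟨(opVar n p k, true), lvl, some X⟩) (lvl := lvl)
    (tr₀ := tr₀) hfull rfl ⟨_, hep, rfl, rfl⟩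
    -- The layer consists of the literals `P_{x,p}`. Resolution replaces such a literal by
    -- `P_{x,k}`, except for `x = k`, where the reason is the antisymmetry clause and nothing but `¬
    -- P_{p,k}` remains.
    (fun b => ∃ x, B x ∧ b = (opVar n x p, true))
    (fun b l => ∃ x, B x ∧ b = (opVar n x p, true) ∧ x ≠ k ∧ l = (opVar n x k, true))
    (by
      rintro _ ⟨x, hx, rfl⟩
      obtain ⟨e, he, heq⟩ := List.mem_map.1 (hB x hx).2.2.1
      exact ⟨e, hin e he, by rw [heq], (htr₁ e he).1⟩)
    (b₁ := (opVar n x₁ p, true)) (b₂ := (opVar n x₂ p, true)) ⟨x₁, hx₁, rfl⟩ ⟨x₂, hx₂, rfl⟩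
    (by rw [Ne, Prod.mk.injEq, opVar_inj (hB x₁ hx₁).1 (hB x₂ hx₂).1]; omega)
    (by
      rintro _ _ - ⟨x, hx, rfl, hxk, rfl⟩
      exact (hB x hx).2.2.2 hxk)
    (b₀ := (opVar n y p, true)) (y := (opVar n y k, true)) ⟨y, hy, rfl⟩ ⟨y, hy, rfl, hyk, rfl⟩ hyl
    tr₁ E (by rw [hsub] at hfull; exact hfull.append_right)
    (by
      rintro e he ⟨x, hx, hbe⟩
      have he' : e.lit = (opVar n x p, false) := by
        rw [← neg_neg_lit e.lit, hbe]; rfl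
      obtain ⟨C, hC, hr, hcase, hm⟩ := (htr₁ e he).2 x hx he'
      refine ⟨C, hr, fun l => ?_⟩
      rw [he'] at hm ⊢
      rw [reason_form hdb hC (hB x hx).1 hp hk (hB x hx).2.1 hpk hm hcase l]
      simp only [neg, Bool.not_true, Bool.not_false, Prod.mk.injEq, and_true]
      refine or_congr Iff.rfl ⟨fun h => ⟨x, hx, rfl, h⟩, ?_⟩
      rintro ⟨x', hx', heq, h⟩
      obtain ⟨rfl, -⟩ := (opVar_inj (hB x hx).1 (hB x' hx').1).1 heq
      exact h)
    hE
    (by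
      intro l
      rw [hEm]
      constructor
      · rintro ⟨x, hx, rfl⟩
        exact Or.inl ⟨⟨x, hx, rfl⟩, (hB x hx).2.2.1⟩
      · rintro (⟨h, -⟩ | ⟨_, ⟨x, hx, rfl⟩, h, -⟩)
        · exact h
        · exact absurd (hB x hx).2.2.1 h)
  refine ⟨E', h1, fun l => ?_, h3⟩
  rw [h2]
  constructor
  · rintro (⟨hl, hne⟩ | ⟨_, ⟨x, hx, rfl⟩, x', hx', -, hxk, rfl⟩)
    · exact hX l hl hne
    · exact ⟨x', hx', hxk, rfl⟩
  · rintro ⟨x, hx, hxk, rfl⟩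
    exact Or.inr ⟨_, ⟨x, hx, rfl⟩, x, hx, rfl, hxk, rfl⟩

/-- The analysis stops when all literals but one were falsified at lower levels. -/
theorem analyze_uip {full new old tr : List Entry} {lvl : ℕ} (hfull : NodupVars full)
    (hsub : full = new ++ old) (hold : ∀ e ∈ old, e.level < lvl) {E : Clause} (hE : E.Nodup)
    {a : Lit} (hEa : ∀ l ∈ E, l = a ∨ neg l ∈ lits old) : (analyze full lvl tr E).val = E := by
  refine analyze_stop (countLevel_le_one hfull hE (a := a) fun b hb hl => ?_)
  refine (hEa b hb).resolve_right fun hold' => ?_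
  obtain ⟨e, he, heq, hlv⟩ := hl
  obtain ⟨e', he', heq'⟩ := List.mem_map.1 hold'
  have hee : e = e' := by
    refine List.inj_on_of_nodup_map hfull he (by rw [hsub]; simp [he']) ?_
    rw [heq, heq']
    rfl
  have := hold e' he'
  rw [← hee] at this
  omega

end analysis

/-! ### Runs from a restart to the next conflict -/

/-- The elements of `X` are not below `k`. -/
def decidedAsg (k : ℕ) (X : ℕ → Prop) : Asg := fun i j b => b = false ∧ j = k ∧ X i

/-- Moreover, `p` is below `k`. -/
def unitAsg (k : ℕ) (X : ℕ → Prop) (p : ℕ) : Asg := fun i j b =>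
  (b = false ∧ j = k ∧ X i) ∨ (b = true ∧ i = p ∧ j = k)

/-- Moreover, the elements of `X` and `k` are not below `p`. -/
def columnAsg (k : ℕ) (X : ℕ → Prop) (p : ℕ) : Asg := fun i j b =>
  (b = false ∧ j = k ∧ X i) ∨ (b = true ∧ i = p ∧ j = k) ∨ (b = false ∧ j = p ∧ (X i ∨ i = k))

/-- The solver prefers the variables `P_{x,k}` with `x ≤ M`, in their order. -/
def Prefers (n : ℕ) (sc : ℕ → ℚ) (k M : ℕ) : Prop :=
  ∀ x ≤ M, x ≠ k → ∀ i j, Valid n i j → (j ≠ k ∨ x < i) →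
    Better sc (opVar n x k) (opVar n i j)

/-- The run from `s₀` ends with a conflict, after which the column clause `j, m` is learned. -/
def Learns (n : ℕ) (δ : ℚ) (D : ℕ) (db : List Clause) (vars : List ℕ) (sc : ℕ → ℚ) (s₀ : Local)
    (j m : ℕ) : Prop :=
  ∃ s L, IsCol n j m L ∧ Steps δ (stepCost D) db (scList vars sc) s₀ s ∧
    (searchStep δ (mkSearch db (scList vars sc) s)).val =
      (restart (db ++ [L]) (scList vars (bump δ L sc))).val ∧
    (searchStep δ (mkSearch db (scList vars sc) s)).cost ≤ stepCost D ∧ s.2.1.length ≤ n * n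

section runs

variable {n : ℕ} {δ : ℚ} {D : ℕ} {LS : ℕ → ℕ → Prop} {db : List Clause} {vars : List ℕ}
  {sc : ℕ → ℚ}

theorem DB.ne (hdb : DB n LS db) {j m : ℕ} (h : LS j m) : ∃ x, x ≤ m ∧ x ≠ j := by
  have := hdb.range j m h
  by_cases hj : j = 0
  · exact ⟨1, by omega, by omega⟩
  · exact ⟨0, by omega, by omega⟩

theorem noConf_decidedAsg (hdb : DB n LS db) {k : ℕ} {X : ℕ → Prop}
    (h : ∀ m, LS k m → ∃ x, x ≤ m ∧ x ≠ k ∧ ¬ X x) : NoConf n LS (decidedAsg k X) := by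
  refine ⟨by simp [decidedAsg], by simp [decidedAsg], fun j m hm => ?_⟩
  by_cases hjk : j = k
  · subst hjk
    obtain ⟨x, h1, h2, h3⟩ := h m hm
    exact ⟨x, h1, h2, by simp [decidedAsg, h3]⟩
  · obtain ⟨x, h1, h2⟩ := hdb.ne hm
    exact ⟨x, h1, h2, by simp [decidedAsg, hjk]⟩

/-- Column `k` is safe by the true `P_{p,k}`, column `p` by a predecessor that has not been
excluded, and all other columns are untouched. -/
theorem noConf_columnAsg (hdb : DB n LS db) {k p : ℕ} {X : ℕ → Prop} (hpk : p ≠ k) (hXp : ¬ X p)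
    (h : ∀ m, LS k m → p ≤ m) (h' : ∀ m, LS p m → ∃ x, x ≤ m ∧ x ≠ p ∧ x ≠ k ∧ ¬ X x) :
    NoConf n LS (columnAsg k X p) := by
  refine ⟨?_, ?_, fun j m hm => ?_⟩
  · simp only [columnAsg]; grind
  · simp only [columnAsg]; grind
  · by_cases hjk : j = k
    · subst hjk
      exact ⟨p, h m hm, hpk, by simp only [columnAsg]; grind⟩
    · by_cases hjp : j = p
      · subst hjp
        obtain ⟨x, h1, h2, h3, h4⟩ := h' m hm
        exact ⟨x, h1, h2, by simp only [columnAsg]; grind⟩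
      · obtain ⟨x, h1, h2⟩ := hdb.ne hm
        exact ⟨x, h1, h2, by simp only [columnAsg]; grind⟩

/-- A clause with two positive literals is a column clause. -/
theorem col_reason (hdb : DB n LS db) {C : Clause} (hC : C ∈ db) {a p b : ℕ} (ha : Valid n a b)
    (hp : Valid n p b) (haC : (opVar n a b, true) ∈ C) (hpC : (opVar n p b, true) ∈ C) {l : Lit}
    (hl : l ∈ C) (hap : a ≠ p := by omega) :
    ∃ x, x < n ∧ x ≠ b ∧ l = (opVar n x b, true) := by
  rcases hdb.cases hC with ⟨i, j, r, hi, hj, hr, e1, e2, e3, rfl⟩ | ⟨i, j, hi, hj, e1, rfl⟩ |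
    ⟨j, r, hLS, hcol⟩
  · exfalso
    simp only [List.mem_cons, Prod.mk.injEq, Bool.true_eq_false, and_false,
      false_or, and_true, List.not_mem_nil, or_false, opVar_inj ha.1 hi,
      opVar_inj hp.1 hi] at haC hpC
    omega
  · simp at haC
  · have hr := hdb.range j r hLS
    obtain ⟨x, hx, hxj, rfl⟩ := (hcol.mem _).1 hl
    obtain ⟨z, hz, -, he⟩ := (hcol.mem _).1 haC
    simp only [Prod.mk.injEq, and_true] at he
    obtain ⟨-, rfl⟩ := (opVar_inj ha.1 (show z < n by omega)).1 he
    exact ⟨x, by omega, hxj, rfl⟩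

/-- The decisions that imply nothing. -/
theorem run_decisions (hE : Env n δ D LS db vars sc) {k d p M : ℕ} (hk : k < n) (hdp : d < p)
    (hpn : p < n) (hdk : d ≠ k) (hpk : p ≠ k) (hLS : ∀ m, LS k m → p ≤ m) (hdM : d ≤ M)
    (hpick : Prefers n sc k M) : ∀ t ≤ d, ∃ lvl tr,
      Steps δ (stepCost D) db (scList vars sc) (0, [], []) (lvl, tr, []) ∧
      St n db (decidedAsg k fun x => x < t ∧ x ≠ k) (lvl, tr, []) := by
  intro t
  induction t with
  | zero =>
    intro _
    refine ⟨0, [], Steps.refl _, (rep_nil n).congr ?_, by simp, by simp, by simp⟩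
    simp [decidedAsg, noAsg]
  | succ t ih =>
    intro ht
    obtain ⟨lvl, tr, h, hS⟩ := ih (by omega)
    by_cases htk : t = k
    · refine ⟨lvl, tr, h, hS.rep.congr ?_, hS.reason, hS.queue, hS.level⟩
      intro i j b _
      simp only [decidedAsg]
      constructor <;> rintro ⟨h1, h2, h3, h4⟩ <;> exact ⟨h1, h2, by omega, h4⟩
    have hn := noConf_decidedAsg (X := fun x => x < t ∧ x ≠ k) hE.dbs
      (fun m hm => ⟨p, hLS m hm, hpk, by omega⟩)
    have hn' := noConf_decidedAsg (X := fun x => x < t + 1 ∧ x ≠ k) hE.dbs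
      (fun m hm => ⟨p, hLS m hm, hpk, by omega⟩)
    have hv : Valid n t k := ⟨by omega, hk, htk⟩
    obtain ⟨h1, hS1⟩ := step_decide hE (a := t) (b := k)
      (decidedAsg k fun x => x < t + 1 ∧ x ≠ k) h hS hn hv
      (by simp [Asg.Def, decidedAsg])
      (by
        intro i j hv' hd hne
        refine hpick t (by omega) htk i j hv' ?_
        by_contra hcon
        push Not at hcon
        refine hd (Or.inr ⟨rfl, hcon.1, ?_, ?_⟩)
        · have := hcon.2
          have : i ≠ t := fun h => hne ⟨h, hcon.1⟩
          omega
        · have := hv'.2.2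
          rw [hcon.1] at this
          exact this)
      (by intro i j c _; simp only [decidedAsg]; grind)
    obtain ⟨h2, hS2⟩ := steps_idle hE hn' _ h1 hS1 (by
      intro l hl
      rw [List.mem_singleton] at hl
      refine ⟨t, k, hv, hl, ⟨rfl, rfl, by omega, htk⟩, ?_, ?_⟩
      · intro c _ _ _
        constructor <;> simp [Asg.union, decidedAsg, noAsg]
      · intro m hm _ w hw hwk hall
        exfalso
        have hp := hLS m hm
        rw [union_noAsg] at hall
        by_cases hwp : w = p
        · have := (hall d (by omega) hdk (by omega)).2.2
          omega
        · have := (hall p hp hpk (Ne.symm hwp)).2.2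
          omega)
    exact ⟨_, _, h2, hS2⟩

/-- The trail after the decisions on column `k`, the implied literal `P_{p,k}` and its
propagation. -/
structure AfterUnit (n : ℕ) (db : List Clause) (k d p lvl : ℕ) (old batch : List Entry)
    (X : Clause) : Prop where
  old_level : ∀ e ∈ old, e.level ≤ lvl
  rep_old : Rep n old (decidedAsg k fun x => x < d ∧ x ≠ k)
  reason : ∀ l ∈ X, l ≠ (opVar n p k, true) → ∃ x, x ≤ d ∧ x ≠ k ∧ l = (opVar n x k, true)
  fresh : Fresh n db
    (⟨(opVar n p k, true), lvl + 1, some X⟩ :: ⟨(opVar n d k, false), lvl + 1, none⟩ :: old)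
    (lvl + 1) (opVar n p k, true) (fun i j b => b = false ∧ j = p ∧ ((i ≤ d ∧ i ≠ k) ∨ i = k))
    batch

/-- The trail of `AfterUnit`. -/
def unitTrail (n k d p lvl : ℕ) (old batch : List Entry) (X : Clause) : List Entry :=
  batch ++ ⟨(opVar n p k, true), lvl + 1, some X⟩ :: ⟨(opVar n d k, false), lvl + 1, none⟩ :: old

/-- Here `p` is the largest and `d` the second largest element up to `m` other than `k`. Since `k,
m` is the shortest clause of its column, nothing is implied before `¬ P_{d,k}`, which leaves only
`P_{p,k}`. From `P_{p,k}` and `¬ P_{x,k}` follows `¬ P_{x,p}` by transitivity, and `¬ P_{k,p}` by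
antisymmetry. -/
theorem run_unit (hE : Env n δ D LS db vars sc) {k d p m M : ℕ} (hk : k < n) (hdp : d < p)
    (hpm : p ≤ m) (hdk : d ≠ k) (hpk : p ≠ k) (hm : LS k m)
    (hLS : ∀ m', LS k m' → m ≤ m') (hall : ∀ x ≤ m, x ≠ k → x ≤ d ∨ x = p) (hdM : d ≤ M)
    (hpick : Prefers n sc k M) : ∃ lvl old batch X,
      Steps δ (stepCost D) db (scList vars sc) (0, [], [])
        (lvl + 1, unitTrail n k d p lvl old batch X, (lits batch).reverse) ∧
      St n db (columnAsg k (fun x => x ≤ d ∧ x ≠ k) p)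
        (lvl + 1, unitTrail n k d p lvl old batch X, (lits batch).reverse) ∧
      AfterUnit n db k d p lvl old batch X := by
  have hmn := (hE.dbs.range k m hm).2.1
  have hLS' : ∀ m', LS k m' → p ≤ m' := fun m' h => hpm.trans (hLS m' h)
  obtain ⟨lvl, old, h, hS⟩ := run_decisions hE hk hdp (by omega) hdk hpk hLS' hdM hpick d le_rfl
  have hv : Valid n d k := ⟨by omega, hk, hdk⟩
  have hvp : Valid n p k := ⟨by omega, hk, hpk⟩
  have hn := noConf_decidedAsg (X := fun x => x < d ∧ x ≠ k) hE.dbs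
    (fun m hm => ⟨p, hLS' m hm, hpk, by omega⟩)
  have hn' := noConf_decidedAsg (X := fun x => x ≤ d ∧ x ≠ k) hE.dbs
    (fun m hm => ⟨p, hLS' m hm, hpk, by omega⟩)
  obtain ⟨h1, hS1⟩ := step_decide hE (a := d) (b := k)
    (decidedAsg k fun x => x ≤ d ∧ x ≠ k) h hS hn hv
    (by simp [Asg.Def, decidedAsg])
    (by
      intro i j hv' hd hne
      refine hpick d hdM hdk i j hv' ?_
      by_contra hcon
      push Not at hcon
      refine hd (Or.inr ⟨rfl, hcon.1, ?_, ?_⟩)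
      · have := hcon.2
        have : i ≠ d := fun h => hne ⟨h, hcon.1⟩
        omega
      · have := hv'.2.2
        rw [hcon.1] at this
        exact this)
    (by intro i j c _; simp only [decidedAsg]; grind)
  obtain ⟨new, h2, hS2, hf2⟩ := step_neg hE (a := d) (b := k) noAsg
    (fun i j b => b = true ∧ i = p ∧ j = k) (unitAsg k (fun x => x ≤ d ∧ x ≠ k) p) h1 hS1 hn' hv
    ⟨rfl, rfl, le_rfl, hdk⟩
    (by intro i j c _; simp only [decidedAsg, unitAsg, noAsg]; grind)
    (by simp [noAsg])
    (by
      intro i j c _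
      simp only [union_noAsg, Asg.Def, decidedAsg]
      rintro ⟨rfl, rfl, rfl⟩
      simp
      omega)
    (by
      intro c _ _ _
      constructor <;> simp [Asg.union, decidedAsg, noAsg])
    (by
      intro m' hm' _ w hw hwk hall'
      rw [union_noAsg] at hall' ⊢
      by_cases hwp : w = p
      · exact Or.inr ⟨rfl, hwp, rfl⟩
      · rcases hall' p (hLS' m' hm') hpk (Ne.symm hwp) with h | h
        · have := h.2.2; omega
        · exact absurd h.1 (by simp))
    (by simp [noAsg])
    (by
      rintro i j c _ ⟨rfl, rfl, rfl⟩
      refine ⟨rfl, rfl, m, hm, by omega, hpm, fun x hx hxk hxp => ⟨rfl, rfl, ?_, hxk⟩⟩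
      exact (hall x hx hxk).resolve_right hxp)
  obtain ⟨X, hX, rfl, hdX, hpX, hXf⟩ := hf2.eq_singleton (a := p) (b := k) (c := true)
    hS2.rep.nodup hvp (by intro i j b' _; simp only [Asg.union, noAsg]; grind)
  have hn2 : NoConf n LS (unitAsg k (fun x => x ≤ d ∧ x ≠ k) p) := by
    refine ⟨by simp only [unitAsg]; grind, by simp only [unitAsg]; grind, fun j r hr => ?_⟩
    by_cases hjk : j = k
    · subst hjk
      exact ⟨p, hLS' r hr, hpk, by simp only [unitAsg]; grind⟩
    · obtain ⟨x, h1, h2⟩ := hE.dbs.ne hr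
      exact ⟨x, h1, h2, by simp only [unitAsg]; grind⟩
  simp only [List.nil_append, List.singleton_append, List.map_cons, List.map_nil,
    List.reverse_singleton] at h2 hS2
  obtain ⟨batch, h3, hS3, hf3⟩ := step_pos hE (a := p) (b := k)
    (fun i j b => b = false ∧ j = p ∧ ((i ≤ d ∧ i ≠ k) ∨ i = k))
    (columnAsg k (fun x => x ≤ d ∧ x ≠ k) p) h2 hS2 hn2 hvp (Or.inr ⟨rfl, rfl, rfl⟩)
    (by intro i j c _; simp only [unitAsg, columnAsg]; grind)
    (by intro i j c _; simp only [unitAsg, Asg.Def]; grind)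
    (by
      intro c _ _ _
      constructor <;> simp only [unitAsg, Asg.Def, Asg.union] <;> grind)
    (by
      intro c _ _ _
      constructor <;> simp only [unitAsg, Asg.Def, Asg.union] <;> grind)
    (by simp only [unitAsg, Asg.Def]; grind)
    (by intro i j c hv; simp only [unitAsg, ImplPos]; have := hv.2.2; grind)
  simp only [List.nil_append] at h3 hS3
  refine ⟨lvl, old, batch, X, h3, hS3, hS.level, hS.rep, ?_, hf3⟩
  intro l hl hne
  obtain ⟨x, hx, hxk, rfl⟩ := col_reason hE.dbs hX hv hvp hdX hpX hl
  rcases hXf _ hl hne with h | h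
  · simp [neg] at h
  · obtain ⟨-, -, h⟩ := (hS1.rep.mem_iff ⟨hx, hk, hxk⟩).1 h
    exact ⟨x, h.1, h.2, rfl⟩

end runs

section runs

variable {n : ℕ} {δ : ℚ} {D : ℕ} {LS : ℕ → ℕ → Prop} {db : List Clause} {vars : List ℕ}
  {sc : ℕ → ℚ}

/-! ### Conflicts in a learned column clause -/

theorem mem_unitTrail {k d p lvl : ℕ} {old batch : List Entry} {X : Clause}
    (h : AfterUnit n db k d p lvl old batch X) (hk : k < n) (hd : d < n) (hdk : d ≠ k) {x : ℕ}
    (hx : x ≤ d) (hxk : x ≠ k) :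
    (opVar n x k, false) ∈
      lits ((⟨(opVar n d k, false), lvl + 1, none⟩ : Entry) :: old) := by
  by_cases hxd : x = d
  · subst hxd; simp
  · exact List.mem_cons_of_mem _ ((h.rep_old.mem_iff ⟨by omega, hk, hxk⟩).2
      ⟨rfl, rfl, by omega, hxk⟩)

/-- Analysis of the literals implied by `P_{p,k}`. -/
theorem analyze_unit (hdb : DB n LS db) {k d p lvl : ℕ} {old batch full full' : List Entry}
    {X : Clause} (h : AfterUnit n db k d p lvl old batch X) (hfull : NodupVars full)
    (hsub : full = full' ++ unitTrail n k d p lvl old batch X) (hk : k < n) (hdk : d ≠ k)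
    (hdp : d < p) (hp : p < n) (hpk : p ≠ k) {E : Clause} (hE : E.Nodup)
    (hEm : ∀ l, l ∈ E ↔ ∃ x, ((x ≤ d ∧ x ≠ k) ∨ x = k) ∧ l = (opVar n x p, true)) :
    ((analyze full (lvl + 1) (unitTrail n k d p lvl old batch X) E).val).Nodup ∧
      ∀ l, l ∈ (analyze full (lvl + 1) (unitTrail n k d p lvl old batch X) E).val ↔
        ∃ x, x ≤ d ∧ x ≠ k ∧ l = (opVar n x k, true) := by
  have hmem := fun x => mem_unitTrail (x := x) h hk (by omega) hdk
  obtain ⟨E', h1, h2, h3⟩ := analyze_column hdb hfull (p := p) (k := k) ⟨hp, hk, hpk⟩ hsub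
    (B := fun x => (x ≤ d ∧ x ≠ k) ∨ x = k)
    (by
      intro x hx
      refine ⟨by omega, by omega, (h.fresh.mem _).2 ⟨x, p, false, ⟨by omega, hp, by omega⟩, rfl,
        rfl, rfl, hx⟩, fun hxk => hmem x (by omega) hxk⟩)
    (by
      intro e he
      obtain ⟨hl, C, hC, hr, hn, hm, -⟩ := h.fresh.info e he
      exact ⟨hl, fun x _ _ => ⟨C, hC, hr, Or.inl hn, hm⟩⟩)
    -- The decision `¬ P_{d,k}` supplies the second literal of the conflict level that keeps the
    -- analysis going until `P_{p,k}` has been resolved away. After that it is the only literal of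
    -- this level.
    (x₁ := d) (x₂ := k) (y := d) (Or.inl ⟨le_rfl, hdk⟩) (Or.inr rfl) hdk (Or.inl ⟨le_rfl, hdk⟩) hdk
    ⟨⟨(opVar n d k, false), lvl + 1, none⟩, by rw [hsub]; simp [unitTrail], rfl, rfl⟩
    (by
      intro l hl hne
      obtain ⟨x, hx, hxk, rfl⟩ := h.reason l hl hne
      exact ⟨x, Or.inl ⟨hx, hxk⟩, hxk, rfl⟩)
    hE hEm
  have huip : (analyze full (lvl + 1)
      (⟨(opVar n d k, false), lvl + 1, none⟩ :: old) E').val = E' := by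
    refine analyze_uip (old := old) (new := full' ++ batch ++
      [⟨(opVar n p k, true), lvl + 1, some X⟩, ⟨(opVar n d k, false), lvl + 1, none⟩]) hfull
      (by rw [hsub]; simp [unitTrail])
      (fun e he => Nat.lt_succ_of_le (h.old_level e he)) h1 (a := (opVar n d k, true)) ?_
    intro l hl
    obtain ⟨x, hx, hxk, rfl⟩ := (h2 l).1 hl
    by_cases hxd : x = d
    · exact Or.inl (by rw [hxd])
    · exact Or.inr ((h.rep_old.mem_iff ⟨by omega, hk, hxk⟩).2 ⟨rfl, rfl, by omega, hxk⟩)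
  have heq := h3.trans huip
  rw [unitTrail, heq]
  refine ⟨h1, fun l => ?_⟩
  rw [h2]
  constructor
  · rintro ⟨x, hx, hxk, rfl⟩
    exact ⟨x, by omega, hxk, rfl⟩
  · rintro ⟨x, hx, hxk, rfl⟩
    exact ⟨x, Or.inl ⟨hx, hxk⟩, hxk, rfl⟩

/-- By `huniq` the clause `j, r` is the only column clause that is falsified, and the order clauses
are not, so it is the one from which analysis starts. -/
theorem learns_of_conflict (hE : Env n δ D LS db vars sc) {s₀ : Local} {lvl : ℕ}
    {tr : List Entry} {q : List Lit} {A : Asg} {j r j' r' : ℕ}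
    (h : Steps δ (stepCost D) db (scList vars sc) s₀ (lvl, tr, q)) (hS : St n db A (lvl, tr, q))
    (hlvl : lvl ≠ 0) (hLS : LS j r) (hcol : ∀ x ≤ r, x ≠ j → A x j false)
    (htrans : ∀ i j k, A i j true → A j k true → A i k false → False)
    (hanti : ∀ i j, A i j true → A j i true → False)
    (huniq : ∀ j' r', LS j' r' → (∀ x ≤ r', x ≠ j' → A x j' false) → j' = j ∧ r' = r)
    (hr' : r' < n)
    (han : ∀ E : Clause, E.Nodup → (∀ l, l ∈ E ↔ ∃ x, x ≤ r ∧ x ≠ j ∧ l = (opVar n x j, true)) →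
      IsCol n j' r' (analyze tr lvl tr E).val) :
    Learns n δ D db vars sc s₀ j' r' := by
  have hval : ∀ j r x, LS j r → x ≤ r → x ≠ j → Valid n x j := fun j r x h hx hxj => by
    have := hE.dbs.range j r h
    exact ⟨by omega, by omega, hxj⟩
  obtain ⟨L, hL, h1, h2⟩ := step_conflict hE hS hlvl (P := IsCol n j' r')
    (by
      obtain ⟨Cs, hsplit, -, hC2⟩ := hE.dbs.split
      obtain ⟨C, hC, hCcol⟩ := hC2 j r hLS
      refine ⟨C, by rw [hsplit]; exact List.mem_append_right _ hC, fun l hl => ?_⟩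
      obtain ⟨x, hx, hxj, rfl⟩ := (hCcol.mem l).1 hl
      exact (hS.rep.mem_iff (hval j r x hLS hx hxj)).2 (hcol x hx hxj))
    (by
      intro C hC hf E hnd hEm
      rcases hE.dbs.cases hC with ⟨a, b, c, ha, hb, hc, e1, e2, e3, rfl⟩ |
        ⟨a, b, ha, hb, e1, rfl⟩ | ⟨a, b, hab, hCcol⟩
      · exact (htrans a b c
          ((hS.rep.mem_iff ⟨ha, hb, e1⟩).1 (hf (opVar n a b, false) (by simp)))
          ((hS.rep.mem_iff ⟨hb, hc, e3⟩).1 (hf (opVar n b c, false) (by simp)))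
          ((hS.rep.mem_iff ⟨ha, hc, e2.symm⟩).1 (hf (opVar n a c, true) (by simp)))).elim
      · exact (hanti a b
          ((hS.rep.mem_iff ⟨ha, hb, e1⟩).1 (hf (opVar n a b, false) (by simp)))
          ((hS.rep.mem_iff ⟨hb, ha, e1.symm⟩).1 (hf (opVar n b a, false) (by simp)))).elim
      · obtain ⟨rfl, rfl⟩ := huniq a b hab fun x hx hxa =>
          (hS.rep.mem_iff (hval a b x hab hx hxa)).1
            (hf (opVar n x a, true) ((hCcol.mem _).2 ⟨x, hx, hxa, rfl⟩))
        exact han E hnd fun l => by rw [hEm, hCcol.mem])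
    (by
      intro L hL
      have := hL.length_le hr'
      have := hE.len
      have := hE.n6
      nlinarith)
  exact ⟨_, L, hL, h, h1, h2, hS.rep.length_le⟩

/-- From the column clause `k, p`, where the column clause `p, p` is in the database, the solver
learns the column clause `k, p - 1`. -/
theorem learns_learned (hE : Env n δ D LS db vars sc) {k d p M : ℕ} (hkp : k < p) (hdp : d < p)
    (hdk : d ≠ k) (hm : LS k p) (hLS : ∀ m, LS k m → p ≤ m) (hall : ∀ x < p, x ≠ k → x ≤ d)
    (hp : LS p p) (hdM : d ≤ M) (hpick : Prefers n sc k M) :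
    Learns n δ D db vars sc (0, [], []) k (p - 1) := by
  have hpn := (hE.dbs.range k p hm).2.1
  obtain ⟨lvl, old, batch, X, h, hS, hau⟩ := run_unit hE (by omega) hdp le_rfl hdk (by omega) hm hLS
    (fun x hx hxk => (Nat.lt_or_eq_of_le hx).imp (fun h => hall x h hxk) id) hdM hpick
  refine learns_of_conflict hE h hS (by omega) hp ?_ ?_ ?_ ?_ (by omega) ?_
  · intro x hx hxp
    by_cases hxk : x = k
    · exact Or.inr (Or.inr ⟨rfl, rfl, Or.inr hxk⟩)
    · exact Or.inr (Or.inr ⟨rfl, rfl, Or.inl ⟨hall x (by omega) hxk, hxk⟩⟩)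
  · simp only [columnAsg]; grind
  · simp only [columnAsg]; grind
  · intro j' r' hjr hall'
    have hr := hE.dbs.range j' r' hjr
    by_cases hjk : j' = k
    · subst hjk
      have h1 := hall' p (hLS r' hjr) (by omega)
      simp only [columnAsg] at h1
      grind
    · by_cases hjp : j' = p
      · subst hjp
        refine ⟨rfl, ?_⟩
        -- A longer clause of column `p` contains `P_{p+1,p}`, which is unassigned.
        by_contra hne
        have h1 := hall' (j' + 1) (by omega) (by omega)
        simp only [columnAsg] at h1
        omega
      · obtain ⟨x, hx, hxj⟩ := hE.dbs.ne hjr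
        have h1 := hall' x hx hxj
        simp only [columnAsg] at h1
        omega
  · intro E hnd hEm
    obtain ⟨h1, h2⟩ := analyze_unit (full' := []) hE.dbs hau hS.rep.nodup rfl (by omega) hdk hdp hpn
      (by omega) hnd (by
        intro l
        rw [hEm]
        constructor
        · rintro ⟨x, hx, hxp, rfl⟩
          refine ⟨x, ?_, rfl⟩
          by_cases hxk : x = k
          · exact Or.inr hxk
          · exact Or.inl ⟨hall x (by omega) hxk, hxk⟩
        · rintro ⟨x, hx, rfl⟩
          exact ⟨x, by omega, by omega, rfl⟩)
    refine ⟨h1, fun l => ?_⟩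
    rw [h2]
    constructor
    · rintro ⟨x, hx, hxk, rfl⟩
      exact ⟨x, by omega, hxk, rfl⟩
    · rintro ⟨x, hx, hxk, rfl⟩
      exact ⟨x, hall x (by omega) hxk, hxk, rfl⟩

/-! ### Conflicts in the last column -/

/-- After `columnAsg`, the element `q` is below `p`, and the elements of `Y` are not below `q`. -/
def topAsg (k : ℕ) (X : ℕ → Prop) (p q : ℕ) (Y : ℕ → Prop) : Asg := fun i j b =>
  (b = false ∧ j = k ∧ X i) ∨ (b = true ∧ i = p ∧ j = k) ∨ (b = false ∧ j = p ∧ (X i ∨ i = k)) ∨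
  (b = true ∧ i = q ∧ j = p) ∨ (b = false ∧ j = q ∧ Y i)

/-- After `topAsg`, the literal `P_{q,p}` is propagated. -/
def topFullAsg (k : ℕ) (X : ℕ → Prop) (p q : ℕ) : Asg := fun i j b =>
  (b = false ∧ j = k ∧ X i) ∨ (b = true ∧ i = p ∧ j = k) ∨ (b = false ∧ j = p ∧ (X i ∨ i = k)) ∨
  (b = true ∧ i = q ∧ j = p) ∨ (b = false ∧ j = q ∧ (X i ∨ i = k)) ∨ (b = true ∧ i = q ∧ j = k) ∨
  (b = false ∧ i = p ∧ j = q)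

/-- Column `q` is not falsified even if all `¬ P_{x,q}` with `x ≠ p` are present: `¬ P_{p,q}` arises
only when `P_{q,p}` itself is propagated. Column `p` is safe by `P_{q,p}`. -/
theorem noConf_topAsg (hdb : DB n LS db) {k p q : ℕ} {X Y : ℕ → Prop} (hpk : p ≠ k) (hqp : q ≠ p)
    (hqk : q ≠ k) (hXp : ¬ X p) (hXk : ¬ X k) (hXq : ¬ X q) (hY : ∀ x, Y x → X x ∨ x = k)
    (h : ∀ m, LS k m → p ≤ m) (h' : ∀ m, LS p m → q ≤ m) (h'' : ∀ m, LS q m → p ≤ m) :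
    NoConf n LS (topAsg k X p q Y) := by
  have hYp : ¬ Y p := fun h => (hY p h).elim hXp hpk
  refine ⟨?_, ?_, fun j m hm => ?_⟩
  · simp only [topAsg]; grind
  · simp only [topAsg]; grind
  · by_cases hjk : j = k
    · subst hjk
      exact ⟨p, h m hm, hpk, by simp only [topAsg]; grind⟩
    · by_cases hjp : j = p
      · subst hjp
        exact ⟨q, h' m hm, hqp, by simp only [topAsg]; grind⟩
      · by_cases hjq : j = q
        · subst hjq
          exact ⟨p, h'' m hm, hqp.symm, by simp only [topAsg]; grind⟩
        · obtain ⟨x, h1, h2⟩ := hdb.ne hm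
          exact ⟨x, h1, h2, by simp only [topAsg]; grind⟩

/-- The entries of `new` have reasons that make `P_{q,p}` and `¬ P_{x,p}` responsible. -/
def ColumnReasons (n : ℕ) (db : List Clause) (lvl p q : ℕ) (new : List Entry) : Prop :=
  ∀ e ∈ new, e.level = lvl ∧ ∀ x, x < n → x ≠ q → e.lit = (opVar n x q, false) → ∃ C ∈ db,
    e.reason = some C ∧ ((opVar n q p, false) ∈ C ∨ (x ≠ p ∧ (opVar n x p, true) ∈ C)) ∧ e.lit ∈ C

/-- Once `P_{q,p}` is propagated, every element is excluded as a predecessor of the last element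
`q`, and its input clause is false. Analysis turns that clause into `P_{x,p}` for `x < q`, `x ≠ p`;
whether it stops there or continues into column `k` depends on the levels and is left to `han`. The
set `Y` records the `¬ P_{x,q}` that were implied earlier. -/
theorem learns_top (hE : Env n δ D LS db vars sc) {k p q lvl y j' r' : ℕ} {X Y : ℕ → Prop}
    {s₀ : Local} {mid tr₀ : List Entry} {R : List Lit} {Xq : Clause}
    (h : Steps δ (stepCost D) db (scList vars sc) s₀
      (lvl, mid ++ ⟨(opVar n q p, true), lvl, some Xq⟩ :: tr₀, (opVar n q p, true) :: R))
    (hS : St n db (topAsg k X p q Y)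
      (lvl, mid ++ ⟨(opVar n q p, true), lvl, some Xq⟩ :: tr₀, (opVar n q p, true) :: R))
    (hlvl : lvl ≠ 0) (hq : q = n - 1) (hpq : p < q) (hkq : k < q) (hpk : p ≠ k)
    (hXp : ¬ X p) (hXk : ¬ X k) (hXq : ¬ X q) (hY : ∀ x, Y x → X x ∨ x = k)
    (hX : ∀ x < q, x ≠ p → x ≠ k → X x)
    (hLSk : ∀ m, LS k m → p ≤ m) (hLSp : ∀ m, LS p m → m = q)
    (hrep : Rep n tr₀ (columnAsg k X p)) (hmid : ColumnReasons n db lvl p q mid)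
    (hXqr : ∀ l ∈ Xq, l ≠ (opVar n q p, true) → ∃ x, x < q ∧ x ≠ p ∧ l = (opVar n x p, true))
    (hy : y < q) (hyp : y ≠ p) (hyl : AtLevel tr₀ lvl (opVar n y p, true)) (hr' : r' < n)
    (han : ∀ new : List Entry,
      NodupVars (new ++ (⟨(opVar n q p, true), lvl, some Xq⟩ : Entry) :: tr₀) →
      ∀ E : Clause, E.Nodup → (∀ l, l ∈ E ↔ ∃ x, x < q ∧ x ≠ p ∧ l = (opVar n x p, true)) →
      IsCol n j' r' (analyze (new ++ ⟨(opVar n q p, true), lvl, some Xq⟩ :: tr₀) lvl tr₀ E).val) :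
    Learns n δ D db vars sc s₀ j' r' := by
  have hn6 := hE.n6
  have hqn : q < n := by omega
  have hv : Valid n q p := ⟨hqn, by omega, by omega⟩
  have hn := noConf_topAsg (Y := Y) hE.dbs hpk hv.2.2 (show q ≠ k by omega) hXp hXk hXq hY hLSk
    (fun m hm => (hLSp m hm).ge) (fun m hm => by have := (hE.dbs.range q m hm).1; omega)
  -- The implied literals are the missing `¬ P_{x,q}`, then `P_{q,k}` by transitivity through
  -- `P_{p,k}`, and `¬ P_{p,q}` by antisymmetry.
  obtain ⟨new, h1, hS1, hf⟩ := step_pos hE (a := q) (b := p)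
    (fun i j b => (b = false ∧ j = q ∧ (X i ∨ i = k) ∧ ¬ Y i) ∨ (b = true ∧ i = q ∧ j = k) ∨
      (b = false ∧ i = p ∧ j = q)) (topFullAsg k X p q) h hS hn hv
    (Or.inr (Or.inr (Or.inr (Or.inl ⟨rfl, rfl, rfl⟩))))
    (by intro i j c _; simp only [topAsg, topFullAsg]; grind)
    (by intro i j c _; simp only [topAsg, Asg.Def]; grind)
    (by
      intro c _ _ _
      constructor <;> simp only [topAsg, Asg.Def, Asg.union] <;> grind)
    (by
      intro c _ _ _
      constructor <;> simp only [topAsg, Asg.Def, Asg.union] <;> grind)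
    (by simp only [topAsg, Asg.Def]; grind)
    (by intro i j c hv; simp only [topAsg, ImplPos]; have := hv.2.2; grind)
  refine learns_of_conflict hE h1 hS1 hlvl (hE.dbs.full q hqn) ?_ ?_ ?_ ?_ hr' ?_
  · intro x hx hxq
    have := hX x (by omega)
    simp only [topFullAsg]
    grind
  · simp only [topFullAsg]; grind
  · simp only [topFullAsg]; grind
  · intro j r hjr hall
    have hr := hE.dbs.range j r hjr
    by_cases hjk : j = k
    · subst hjk
      have h1 := hall p (hLSk r hjr) (by omega)
      simp only [topFullAsg] at h1
      grind
    · by_cases hjp : j = p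
      · subst hjp
        have h1 := hall q (hLSp r hjr).ge (by omega)
        simp only [topFullAsg] at h1
        grind
      · by_cases hjq : j = q
        · exact ⟨hjq, by omega⟩
        · obtain ⟨x, hx, hxj⟩ := hE.dbs.ne hjr
          have h1 := hall x hx hxj
          simp only [topFullAsg] at h1
          grind
  · intro E hnd hEm
    have hfull := hS1.rep.nodup
    simp only [] at hfull
    rw [← List.append_assoc] at hfull
    have hin : ∀ x, x < n → x ≠ q → (opVar n x q, false) ∈ lits (new ++ mid) := by
      intro x hx hxq
      have h1 : (opVar n x q, false) ∈
          lits (new ++ (mid ++ ⟨(opVar n q p, true), lvl, some Xq⟩ :: tr₀)) := by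
        refine (hS1.rep.mem_iff ⟨hx, hqn, hxq⟩).2 ?_
        have := hX x (by omega)
        simp only [topFullAsg]
        grind
      rw [← List.append_assoc, lits_append, List.mem_append] at h1
      refine h1.resolve_right fun h2 => ?_
      rcases List.mem_cons.1 h2 with h2 | h2
      · simp at h2
      · have := (hrep.mem_iff ⟨hx, hqn, hxq⟩).1 h2
        simp only [columnAsg] at this
        omega
    obtain ⟨E', e1, e2, e3⟩ := analyze_column (full' := []) (tr₁ := new ++ mid) (tr₀ := tr₀)
      (lvl := lvl) hE.dbs hfull hv rfl
      (B := fun x => x < q)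
      (by
        intro x hx
        refine ⟨by omega, by omega, hin x (by omega) (by omega), fun hxp => ?_⟩
        refine (hrep.mem_iff ⟨by omega, by omega, hxp⟩).2 ?_
        have := hX x hx hxp
        simp only [columnAsg]
        grind)
      (by
        intro e he
        rcases List.mem_append.1 he with he | he
        · obtain ⟨hl, C, hC, hr, hn, hm, -⟩ := hf.info e he
          exact ⟨hl, fun x _ _ => ⟨C, hC, hr, Or.inl hn, hm⟩⟩
        · obtain ⟨hl, hm⟩ := hmid e he
          exact ⟨hl, fun x hx => hm x (by omega) (by omega)⟩)
      (x₁ := 0) (x₂ := 1) (y := y) (by omega) (by omega) (by omega) hy hyp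
      (by
        obtain ⟨e, he, h⟩ := hyl
        exact ⟨e, by simp [he], h⟩)
      hXqr hnd
      (by
        intro l
        rw [hEm]
        constructor
        · rintro ⟨x, hx, hxq, rfl⟩
          exact ⟨x, by omega, rfl⟩
        · rintro ⟨x, hx, rfl⟩
          exact ⟨x, by omega, by omega, rfl⟩)
    have := han (new ++ mid) hfull E' e1 e2
    rw [← e3] at this
    simp only [List.append_assoc] at this ⊢
    exact this

end runs

section runs

variable {n : ℕ} {δ : ℚ} {D : ℕ} {LS : ℕ → ℕ → Prop} {db : List Clause} {vars : List ℕ}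
  {sc : ℕ → ℚ}

/-- The last literal `¬ P_{x,p}` with `x ≠ q` makes the column clause `p, q` a unit clause. -/
theorem step_last (hE : Env n δ D LS db vars sc) {k p q lvl x₀ : ℕ} {X : ℕ → Prop} {s₀ : Local}
    {tr : List Entry} {Q : List Lit}
    (h : Steps δ (stepCost D) db (scList vars sc) s₀ (lvl, tr, (opVar n x₀ p, false) :: Q))
    (hS : St n db (columnAsg k X p) (lvl, tr, (opVar n x₀ p, false) :: Q))
    (hx₀ : x₀ < q) (hx₀p : x₀ ≠ p) (hq : q = n - 1) (hpq : p < q) (hkq : k < q) (hpk : p ≠ k)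
    (hXp : ¬ X p) (hXq : ¬ X q) (hX : ∀ x < q, x ≠ p → x ≠ k → X x)
    (hLSk : ∀ m, LS k m → p ≤ m) (hLSp : ∀ m, LS p m → m = q) :
    ∃ Xq, Steps δ (stepCost D) db (scList vars sc) s₀
        (lvl, ⟨(opVar n q p, true), lvl, some Xq⟩ :: tr, Q ++ [(opVar n q p, true)]) ∧
      St n db (topAsg k X p q fun _ => False)
        (lvl, ⟨(opVar n q p, true), lvl, some Xq⟩ :: tr, Q ++ [(opVar n q p, true)]) ∧
      ∀ l ∈ Xq, l ≠ (opVar n q p, true) → ∃ x, x < q ∧ x ≠ p ∧ l = (opVar n x p, true) := by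
  have hn6 := hE.n6
  have hv : Valid n x₀ p := ⟨by omega, by omega, hx₀p⟩
  have hvq : Valid n q p := ⟨by omega, by omega, by omega⟩
  have hLSpq : LS p q := hq ▸ hE.dbs.full p (by omega)
  have hn : NoConf n LS (columnAsg k X p) := noConf_columnAsg hE.dbs hpk hXp hLSk fun m hm =>
    ⟨q, (hLSp m hm).ge, by omega, by omega, hXq⟩
  have hfal : ∀ x < q, x ≠ p → columnAsg k X p x p false := by
    intro x hx hxp
    by_cases hxk : x = k
    · exact Or.inr (Or.inr ⟨rfl, rfl, Or.inr hxk⟩)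
    · exact Or.inr (Or.inr ⟨rfl, rfl, Or.inl (hX x hx hxp hxk)⟩)
  obtain ⟨new, h1, hS1, hf⟩ := step_neg hE (a := x₀) (b := p) noAsg
    (fun i j c => c = true ∧ i = q ∧ j = p) (topAsg k X p q fun _ => False) h hS hn hv
    (hfal x₀ hx₀ hx₀p)
    (by intro i j c _; simp only [columnAsg, topAsg, noAsg]; grind)
    (by simp [noAsg])
    (by intro i j c _; simp only [union_noAsg, columnAsg, Asg.Def]; grind)
    (by
      intro c _ _ _
      constructor <;> simp only [columnAsg, noAsg, Asg.Def, Asg.union] <;> grind)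
    (by
      intro m hm _ w hw hwp _
      obtain rfl := hLSp m hm
      rw [union_noAsg]
      by_cases hwm : w = m
      · exact Or.inr ⟨rfl, hwm, rfl⟩
      · exact Or.inl (Or.inr (hfal w (by omega) hwp)))
    (by simp [noAsg])
    (by
      rintro i j c _ ⟨rfl, rfl, rfl⟩
      exact ⟨rfl, rfl, i, hLSpq, by omega, le_rfl, fun x hx hxp hxi => hfal x (by omega) hxp⟩)
  obtain ⟨Xq, hXq', rfl, hm1, hm2, -⟩ := hf.eq_singleton (a := q) (b := p) (c := true)
    hS1.rep.nodup hvq (by intro i j b' _; simp only [Asg.union, noAsg]; grind)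
  refine ⟨Xq, by simpa using h1, by simpa using hS1, fun l hl hne => ?_⟩
  obtain ⟨x, hx, hxp, rfl⟩ := col_reason hE.dbs hXq' hv hvq hm1 hm2 hl
  refine ⟨x, ?_, hxp, rfl⟩
  have : x ≠ q := fun h => hne (by rw [h])
  omega

/-- The remaining literals `¬ P_{x,p}` are propagated before `P_{q,p}` and the conflict. -/
theorem learns_top_queue (hE : Env n δ D LS db vars sc) {k p q lvl y j' r' : ℕ} {X : ℕ → Prop}
    {s₀ : Local} {tr₀ : List Entry} {Xq : Clause} (hlvl : lvl ≠ 0) (hq : q = n - 1) (hpq : p < q)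
    (hkq : k < q) (hpk : p ≠ k) (hXp : ¬ X p) (hXk : ¬ X k) (hXq : ¬ X q)
    (hX : ∀ x < q, x ≠ p → x ≠ k → X x)
    (hLSk : ∀ m, LS k m → p ≤ m) (hLSp : ∀ m, LS p m → m = q)
    (hrep : Rep n tr₀ (columnAsg k X p))
    (hXqr : ∀ l ∈ Xq, l ≠ (opVar n q p, true) → ∃ x, x < q ∧ x ≠ p ∧ l = (opVar n x p, true))
    (hy : y < q) (hyp : y ≠ p) (hyl : AtLevel tr₀ lvl (opVar n y p, true)) (hr' : r' < n)
    (han : ∀ new : List Entry,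
      NodupVars (new ++ (⟨(opVar n q p, true), lvl, some Xq⟩ : Entry) :: tr₀) →
      ∀ E : Clause, E.Nodup → (∀ l, l ∈ E ↔ ∃ x, x < q ∧ x ≠ p ∧ l = (opVar n x p, true)) →
      IsCol n j' r' (analyze (new ++ ⟨(opVar n q p, true), lvl, some Xq⟩ :: tr₀) lvl tr₀ E).val) :
    ∀ (Q R : List Lit) (mid : List Entry) (Y : ℕ → Prop),
    (∀ l ∈ Q, ∃ x, x < q ∧ x ≠ p ∧ l = (opVar n x p, false)) →
    (∀ x, Y x → X x ∨ x = k) → ColumnReasons n db lvl p q mid →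
    Steps δ (stepCost D) db (scList vars sc) s₀
      (lvl, mid ++ ⟨(opVar n q p, true), lvl, some Xq⟩ :: tr₀, Q ++ (opVar n q p, true) :: R) →
    St n db (topAsg k X p q Y)
      (lvl, mid ++ ⟨(opVar n q p, true), lvl, some Xq⟩ :: tr₀, Q ++ (opVar n q p, true) :: R) →
    Learns n δ D db vars sc s₀ j' r' := by
  intro Q
  induction Q with
  | nil =>
    intro R mid Y _ hY hmid h hS
    exact learns_top hE h hS hlvl hq hpq hkq hpk hXp hXk hXq hY hX hLSk hLSp hrep hmid hXqr hy hyp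
      hyl hr' han
  | cons l Q ih =>
    intro R mid Y hQ hY hmid h hS
    obtain ⟨x, hxq, hxp, rfl⟩ := hQ l (by simp)
    have hn6 := hE.n6
    have hxn : x < n := by omega
    have hqn : q < n := by omega
    have hn := noConf_topAsg (Y := Y) hE.dbs hpk (show q ≠ p by omega) (show q ≠ k by omega) hXp hXk
      hXq hY hLSk (fun m hm => (hLSp m hm).ge)
      (fun m hm => by have := (hE.dbs.range q m hm).1; omega)
    have hXx := hX x hxq hxp
    -- Although `P_{q,p}` is still queued, it is on the trail, so `¬ P_{x,p}` already implies `¬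
    -- P_{x,q}`. The reason is the same transitivity clause that `P_{q,p}` would have used.
    obtain ⟨new, h1, hS1, hf⟩ := step_neg hE (a := x) (b := p)
      (fun i j c => c = false ∧ i = x ∧ j = q ∧ ¬ Y x) noAsg
      (topAsg k X p q fun z => Y z ∨ z = x) h hS hn ⟨hxn, by omega, hxp⟩
      (by simp only [topAsg]; grind)
      (by intro i j c _; simp only [topAsg, noAsg]; grind)
      (by intro i j c _; simp only [topAsg, Asg.Def]; grind)
      (by simp [noAsg])
      (by
        intro c _ _ _
        constructor <;> simp only [topAsg, Asg.Def, Asg.union] <;> grind)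
      (by
        intro m hm _ w hw hwp _
        obtain rfl := hLSp m hm
        have := hX w
        by_cases hwm : w = m
        · exact Or.inl (Or.inl (Or.inl (by simp only [topAsg]; grind)))
        · exact Or.inl (Or.inr (Or.inl (by simp only [topAsg]; grind))))
      (by
        rintro i j c _ ⟨rfl, rfl, rfl, -⟩
        exact ⟨rfl, rfl, by omega, by simp only [topAsg]; grind⟩)
      (by simp [noAsg])
    rw [union_noAsg] at hf
    refine ih (R ++ (lits new).reverse) (new ++ mid) (fun z => Y z ∨ z = x)
      (fun l hl => hQ l (List.mem_cons_of_mem _ hl)) ?_ ?_ ?_ ?_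
    · rintro z (hz | rfl)
      · exact hY z hz
      · grind
    · intro e he
      rcases List.mem_append.1 he with he | he
      · obtain ⟨hl, C, hC, hr, hnl, hm, -⟩ := hf.info e he
        refine ⟨hl, fun z hz hzq hez => ⟨C, hC, hr, ?_, hm⟩⟩
        obtain ⟨i, j, c, hv, heq, rfl, rfl, rfl, -⟩ :=
          (hf.mem e.lit).1 (List.mem_map.2 ⟨e, he, rfl⟩)
        rw [hez, Prod.mk.injEq, opVar_inj hz hv.1] at heq
        obtain ⟨⟨rfl, -⟩, -⟩ := heq
        exact Or.inr ⟨hxp, hnl⟩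
      · exact hmid e he
    · simpa using h1
    · simpa using hS1

/-- From the column clause `k, n - 2`, the solver learns the column clause `k, n - 3`. -/
theorem learns_second (hE : Env n δ D LS db vars sc) {k d p M : ℕ} (hp : p + 2 = n) (hkp : k < p)
    (hdp : d < p) (hdk : d ≠ k) (hm : LS k p) (hLS : ∀ m, LS k m → p ≤ m)
    (hall : ∀ x < p, x ≠ k → x ≤ d) (hLSp : ∀ m, LS p m → m = p + 1) (hdM : d ≤ M)
    (hpick : Prefers n sc k M) :
    Learns n δ D db vars sc (0, [], []) k (p - 1) := by
  have hn6 := hE.n6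
  obtain ⟨lvl, old, batch, X, h, hS, hau⟩ := run_unit hE (by omega) hdp le_rfl hdk (by omega) hm hLS
    (fun x hx hxk => (Nat.lt_or_eq_of_le hx).imp (fun h => hall x h hxk) id) hdM hpick
  have hb : ∀ l ∈ (lits batch).reverse, ∃ x, x < p + 1 ∧ x ≠ p ∧ l = (opVar n x p, false) := by
    intro l hl
    obtain ⟨i, j, c, hv, rfl, rfl, rfl, hc⟩ := (hau.fresh.mem l).1 (List.mem_reverse.1 hl)
    exact ⟨i, by omega, hv.2.2, rfl⟩
  have hne : (opVar n k p, false) ∈ (lits batch).reverse :=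
    List.mem_reverse.2 ((hau.fresh.mem _).2
      ⟨k, p, false, ⟨by omega, by omega, by omega⟩, rfl, rfl, rfl, Or.inr rfl⟩)
  -- All `¬ P_{x,p}` are on the trail before any of them is propagated, so the first one in the
  -- queue already makes the input clause of column `p` unit, whichever it is.
  obtain ⟨l₀, Q, hQ⟩ := List.exists_cons_of_ne_nil (List.ne_nil_of_mem hne)
  have hrep := hS.rep
  rw [hQ] at h hS hb
  obtain ⟨x₀, hx₀, hx₀p, rfl⟩ := hb l₀ (by simp)
  have hX : ∀ x < p + 1, x ≠ p → x ≠ k → x ≤ d ∧ x ≠ k := fun x hx hxp hxk =>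
    ⟨hall x (by omega) hxk, hxk⟩
  obtain ⟨Xq, h1, hS1, hXq⟩ := step_last hE h hS hx₀ hx₀p (by omega) (by omega) (by omega)
    (by omega) (by omega) (by omega) hX hLS hLSp
  obtain ⟨e, he, heq⟩ := List.mem_map.1 ((hau.fresh.mem (opVar n d p, false)).2
      ⟨d, p, false, ⟨by omega, by omega, by omega⟩, rfl, rfl, rfl, Or.inl ⟨le_rfl, hdk⟩⟩)
  refine learns_top_queue hE (tr₀ := unitTrail n k d p lvl old batch X) (by omega) (by omega)
    (by omega) (by omega) (by omega) (by omega) (by omega) (by omega) hX hLS hLSp hrep hXq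
    (y := d) (by omega) (by omega) ⟨e, by simp [unitTrail, he], by rw [heq],
    (hau.fresh.info e he).1⟩ (by omega) ?_ Q [] [] (fun _ => False)
    (fun l hl => hb l (List.mem_cons_of_mem _ hl)) (by simp) (by simp [ColumnReasons]) h1 hS1
  -- The literals of column `p` were all falsified at the conflict level, by the propagation of
  -- `P_{p,k}`. So the analysis passes through a second layer, from column `p` to column `k`.
  intro new hnd E hE' hEm
  obtain ⟨e1, e2⟩ := analyze_unit (full' := new ++ [⟨(opVar n (p + 1) p, true), lvl + 1, some Xq⟩])
    hE.dbs hau hnd (by simp) (by omega) hdk hdp (by omega) (by omega) hE' (by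
      intro l
      rw [hEm]
      constructor
      · rintro ⟨x, hx, hxp, rfl⟩
        refine ⟨x, ?_, rfl⟩
        by_cases hxk : x = k
        · exact Or.inr hxk
        · exact Or.inl (hX x hx hxp hxk)
      · rintro ⟨x, hx, rfl⟩
        exact ⟨x, by omega, by omega, rfl⟩)
  refine ⟨e1, fun l => ?_⟩
  rw [e2]
  constructor
  · rintro ⟨x, hx, hxk, rfl⟩
    exact ⟨x, by omega, hxk, rfl⟩
  · rintro ⟨x, hx, hxk, rfl⟩
    exact ⟨x, hall x (by omega) hxk, hxk, rfl⟩

end runs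

/-! ### Leaving a column -/

section runs

variable {n : ℕ} {δ : ℚ} {D : ℕ} {LS : ℕ → ℕ → Prop} {db : List Clause} {vars : List ℕ}
  {sc : ℕ → ℚ}

/-- The literals `¬ P_{x,p}` imply nothing as long as `n - 2` and `n - 1` are possible
predecessors of `p`. -/
theorem steps_idle_column (hE : Env n δ D LS db vars sc) {k p lvl : ℕ} {X : ℕ → Prop}
    {s₀ : Local} {tr : List Entry} {Q : List Lit} (hpk : p ≠ k) (hp : p + 2 < n) (hk : k + 2 < n)
    (hXp : ¬ X p) (hX : ∀ x, X x → x + 2 < n) (hLSk : ∀ m, LS k m → p ≤ m)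
    (hLSp : ∀ m, LS p m → m + 1 = n) (hQ : ∀ l ∈ Q, ∃ x, (X x ∨ x = k) ∧ l = (opVar n x p, false))
    (h : Steps δ (stepCost D) db (scList vars sc) s₀ (lvl, tr, Q))
    (hS : St n db (columnAsg k X p) (lvl, tr, Q)) :
    Steps δ (stepCost D) db (scList vars sc) s₀ (lvl, tr, []) ∧
      St n db (columnAsg k X p) (lvl, tr, []) := by
  have hn : NoConf n LS (columnAsg k X p) := noConf_columnAsg hE.dbs hpk hXp hLSk fun m hm =>
    ⟨n - 1, by have := hLSp m hm; omega, by omega, by omega, fun h => by have := hX _ h; omega⟩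
  refine steps_idle hE hn Q h hS fun l hl => ?_
  obtain ⟨x, hx, rfl⟩ := hQ l hl
  have hxn : x + 2 < n := hx.elim (hX x) (by omega)
  have hxp : x ≠ p := by grind
  refine ⟨x, p, ⟨by omega, by omega, hxp⟩, rfl, Or.inr (Or.inr ⟨rfl, rfl, hx⟩), ?_, ?_⟩
  · intro c _ _ _
    constructor <;> simp only [columnAsg, noAsg, Asg.Def, Asg.union] <;> grind
  · intro m hm _ w hw hwp hall
    exfalso
    have := hLSp m hm
    have hfree : ∀ z, z < n → z + 2 ≥ n → w ≠ z → False := by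
      intro z hz hz2 hwz
      rw [union_noAsg] at hall
      have h1 := hall z (by omega) (by omega) (Ne.symm hwz)
      simp only [columnAsg] at h1
      have := hX z
      grind
    by_cases hw1 : w = n - 1
    · exact hfree (n - 2) (by omega) (by omega) (by omega)
    · exact hfree (n - 1) (by omega) (by omega) hw1

/-- A decision `¬ P_{t,k}` after `P_{p,k}` implies `¬ P_{t,p}`. -/
theorem step_transfer (hE : Env n δ D LS db vars sc) {k p t lvl M : ℕ} {X : ℕ → Prop}
    {s₀ : Local} {tr : List Entry} (hpk : p ≠ k) (ht : t + 1 < n) (htk : t ≠ k) (htp : t ≠ p)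
    (hk : k < n) (hp : p < n) (hXp : ¬ X p) (hX : ∀ x, X x → x < t)
    (hLSk : ∀ m, LS k m → p ≤ m)
    (hLSp : ∀ m, LS p m → m + 1 = n) (hX' : ∀ x < t, x ≠ p → x ≠ k → X x) (htM : t ≤ M)
    (hpick : Prefers n sc k M) (hpt : p < t) (hkt : k < t)
    (h : Steps δ (stepCost D) db (scList vars sc) s₀ (lvl, tr, []))
    (hS : St n db (columnAsg k X p) (lvl, tr, [])) :
    ∃ C, Steps δ (stepCost D) db (scList vars sc) s₀
        (lvl + 1, ⟨(opVar n t p, false), lvl + 1, some C⟩ ::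
          ⟨(opVar n t k, false), lvl + 1, none⟩ :: tr, [(opVar n t p, false)]) ∧
      St n db (columnAsg k (fun x => X x ∨ x = t) p)
        (lvl + 1, ⟨(opVar n t p, false), lvl + 1, some C⟩ ::
          ⟨(opVar n t k, false), lvl + 1, none⟩ :: tr, [(opVar n t p, false)]) := by
  have hXt : ¬ X t := fun h => lt_irrefl _ (hX t h)
  have hXl : ¬ X (n - 1) := fun h => by have := hX _ h; omega
  have hn : NoConf n LS (columnAsg k X p) := noConf_columnAsg hE.dbs hpk hXp hLSk fun m hm =>
    ⟨n - 1, by have := hLSp m hm; omega, by omega, by omega, hXl⟩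
  have hn' : NoConf n LS (columnAsg k (fun x => X x ∨ x = t) p) :=
    noConf_columnAsg hE.dbs hpk (by grind) hLSk fun m hm =>
    ⟨n - 1, by have := hLSp m hm; omega, by omega, by omega,
      by rintro (h | h); exacts [hXl h, by omega]⟩
  have hv : Valid n t k := ⟨by omega, hk, htk⟩
  obtain ⟨h1, hS1⟩ := step_decide hE (a := t) (b := k)
    (fun i j c => columnAsg k X p i j c ∨ (i = t ∧ j = k ∧ c = false)) h hS hn hv
    (by simp only [Asg.Def, columnAsg]; grind)
    (by
      intro i j hv' hd hne
      refine hpick t htM htk i j hv' ?_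
      by_contra hcon
      push Not at hcon
      obtain ⟨rfl, hit⟩ := hcon
      have hit' : i ≠ t := fun h => hne ⟨h, rfl⟩
      by_cases hip : i = p
      · exact hd (Or.inl (Or.inr (Or.inl ⟨rfl, hip, rfl⟩)))
      · exact hd (Or.inr (Or.inl ⟨rfl, rfl, hX' i (by omega) hip hv'.2.2⟩)))
    (by intro i j c _; rfl)
  obtain ⟨new, h2, hS2, hf⟩ := step_neg hE (a := t) (b := k)
    (fun i j c => c = false ∧ i = t ∧ j = p) noAsg
    (columnAsg k (fun x => X x ∨ x = t) p) h1 hS1 (hn'.mono (by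
      intro i j c; simp only [columnAsg]; grind)) hv (Or.inr ⟨rfl, rfl, rfl⟩)
    (by intro i j c _; simp only [columnAsg, noAsg]; grind)
    (by intro i j c _; simp only [columnAsg, Asg.Def]; grind)
    (by simp [noAsg])
    (by
      intro c _ _ _
      constructor <;> simp only [columnAsg, Asg.Def, Asg.union] <;> grind)
    (by
      intro m hm _ w hw hwk hall
      by_cases hwp : w = p
      · exact Or.inl (Or.inl (Or.inl (Or.inl (Or.inr (Or.inl ⟨rfl, hwp, rfl⟩)))))
      · have := hall p (hLSk m hm) hpk (Ne.symm hwp)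
        simp only [columnAsg, noAsg, Asg.union] at this
        grind)
    (by
      rintro i j c _ ⟨rfl, rfl, rfl⟩
      exact ⟨rfl, rfl, hpk, Or.inl (Or.inr (Or.inl ⟨rfl, rfl, rfl⟩))⟩)
    (by simp [noAsg])
  rw [union_noAsg] at hf
  obtain ⟨C, -, rfl, -⟩ := hf.eq_singleton (a := t) (b := p) (c := false)
    hS2.rep.nodup ⟨by omega, hp, htp⟩ (by grind)
  exact ⟨C, by simpa using h2, by simpa using hS2⟩

/-- The solver leaves column `k`, and learns the column clause `p, n - 2`. -/
theorem learns_jump (hE : Env n δ D LS db vars sc) {k d p m : ℕ} (hm2 : m + 2 < n) (hkm : k ≤ m)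
    (hdp : d < p) (hpm : p ≤ m) (hdk : d ≠ k) (hpk : p ≠ k) (hm : LS k m)
    (hLS : ∀ m', LS k m' → m ≤ m') (hall : ∀ x ≤ m, x ≠ k → x ≤ d ∨ x = p)
    (hLSp : ∀ m', LS p m' → m' + 1 = n) (hpick : Prefers n sc k (n - 2)) :
    Learns n δ D db vars sc (0, [], []) p (n - 2) := by
  have hn6 := hE.n6
  have hLSk : ∀ m', LS k m' → p ≤ m' := fun m' h => hpm.trans (hLS m' h)
  obtain ⟨lvl₀, old, batch, X, h, hS, hau⟩ := run_unit hE (by omega) hdp hpm hdk hpk hm hLS hall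
    (show d ≤ n - 2 by omega) hpick
  obtain ⟨h, hS⟩ := steps_idle_column hE hpk (by omega) (by omega) (by omega) (by omega) hLSk hLSp
    (by
      intro l hl
      obtain ⟨i, j, c, hv, rfl, rfl, rfl, hc⟩ := (hau.fresh.mem l).1 (List.mem_reverse.1 hl)
      exact ⟨i, hc, rfl⟩) h hS
  -- The decisions continue in column `k` beyond `m`, where no clause of that column forces
  -- anything, and each one is copied to column `p`. The last one, for `n - 2`, is treated
  -- separately because it makes column `p` unit.
  have hloop : ∀ t, m < t → t + 2 ≤ n → ∃ lvl tr,
      Steps δ (stepCost D) db (scList vars sc) (0, [], []) (lvl, tr, []) ∧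
      St n db (columnAsg k (fun x => (x ≤ d ∧ x ≠ k) ∨ (m < x ∧ x < t)) p) (lvl, tr, []) := by
    intro t hmt
    induction t, hmt using Nat.le_induction with
    | base =>
      intro _
      refine ⟨_, _, h, hS.rep.congr ?_, hS.reason, hS.queue, hS.level⟩
      intro i j b _; simp only [columnAsg]; grind
    | succ t hmt ih =>
      intro ht
      obtain ⟨lvl, tr, h, hS⟩ := ih (by omega)
      obtain ⟨C, h1, hS1⟩ := step_transfer hE hpk (t := t) (by omega) (by omega) (by omega)
        (by omega) (by omega) (by omega) (by omega) hLSk hLSp (by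
          intro x hx hxp hxk
          have := hall x
          omega) (show t ≤ n - 2 by omega) hpick (by omega) (by omega) h hS
      obtain ⟨h2, hS2⟩ := steps_idle_column hE hpk (by omega) (by omega) (by omega) (by omega)
        hLSk hLSp (Q := [(opVar n t p, false)]) (by
          intro l hl
          exact ⟨t, Or.inl (Or.inr rfl), by simpa using hl⟩) h1 hS1
      refine ⟨_, _, h2, hS2.rep.congr ?_, hS2.reason, hS2.queue, hS2.level⟩
      intro i j b _; simp only [columnAsg]; grind
  obtain ⟨lvl, tr, h, hS⟩ := hloop (n - 2) (by omega) (by omega)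
  obtain ⟨C, h1, hS1⟩ := step_transfer hE hpk (t := n - 2) (by omega) (by omega) (by omega)
    (by omega) (by omega) (by omega) (by omega) hLSk hLSp (by
      intro x hx hxp hxk
      have := hall x
      omega) le_rfl hpick (by omega) (by omega) h hS
  have hX : ∀ x < n - 1, x ≠ p → x ≠ k →
      ((x ≤ d ∧ x ≠ k) ∨ (m < x ∧ x < n - 2)) ∨ x = n - 2 := by
    intro x hx hxp hxk
    have := hall x
    omega
  have hLSp' : ∀ m', LS p m' → m' = n - 1 := fun m' hm' => by have := hLSp m' hm'; omega
  obtain ⟨Xq, h2, hS2, hXq⟩ := step_last hE h1 hS1 (q := n - 1) (by omega) (by omega) rfl (by omega)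
    (by omega) hpk (by omega) (by omega) hX hLSk hLSp'
  refine learns_top_queue hE (Nat.succ_ne_zero lvl) rfl (by omega) (by omega) hpk (by omega)
    (by omega) (by omega) hX hLSk hLSp' hS1.rep hXq (y := n - 2) (by omega) (by omega)
    ⟨⟨(opVar n (n - 2) p, false), lvl + 1, some C⟩, by simp, rfl, rfl⟩ (by omega) ?_ [] [] []
    (fun _ => False) (by simp) (by simp) (by simp [ColumnReasons]) h2 hS2
  intro new hnd E hE' hEm
  -- Unlike in `learns_second`, the literals of column `p` were falsified at different levels, and
  -- only `P_{n-2,p}` belongs to the newest. Analysis stops in column `p`, and this is what makes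
  -- the solver change columns.
  rw [analyze_uip (old := tr) (new := new ++ [⟨(opVar n (n - 1) p, true), lvl + 1, some Xq⟩,
      ⟨(opVar n (n - 2) p, false), lvl + 1, some C⟩, ⟨(opVar n (n - 2) k, false), lvl + 1, none⟩])
    hnd (by simp) (fun e he => Nat.lt_succ_of_le (hS.level e he)) hE'
    (a := (opVar n (n - 2) p, true))]
  · refine ⟨hE', fun l => ?_⟩
    rw [hEm]
    constructor
    · rintro ⟨x, hx, hxp, rfl⟩
      exact ⟨x, by omega, hxp, rfl⟩
    · rintro ⟨x, hx, hxp, rfl⟩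
      exact ⟨x, by omega, hxp, rfl⟩
  · intro l hl
    obtain ⟨x, hx, hxp, rfl⟩ := (hEm l).1 hl
    by_cases hx2 : x = n - 2
    · exact Or.inl (by rw [hx2])
    · refine Or.inr ((hS.rep.mem_iff ⟨by omega, by omega, hxp⟩).2 (Or.inr (Or.inr ⟨rfl, rfl, ?_⟩)))
      by_cases hxk : x = k
      · exact Or.inr hxk
      · have := hX x hx hxp hxk
        exact Or.inl (by omega)

end runs

section runs

variable {n : ℕ} {δ : ℚ} {D : ℕ} {LS : ℕ → ℕ → Prop} {db : List Clause} {vars : List ℕ}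
  {sc : ℕ → ℚ}

/-! ### Runs that start with `P_{0,1}` -/

/-- The element `0` is below `1`, the elements `1, …, t - 1` are not below `0`, and the elements
of `Y` are not below `1`. -/
def zeroAsg (t : ℕ) (Y : ℕ → Prop) : Asg := fun i j b =>
  (b = true ∧ i = 0 ∧ j = 1) ∨ (b = false ∧ j = 0 ∧ 1 ≤ i ∧ i < t) ∨ (b = false ∧ j = 1 ∧ Y i)

/-- Moreover, `p` is below `0`. -/
def zeroUnitAsg (p : ℕ) (Y : ℕ → Prop) : Asg := fun i j b =>
  zeroAsg p Y i j b ∨ (b = true ∧ i = p ∧ j = 0)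

/-- After `zeroUnitAsg`, the literal `P_{p,0}` is propagated. -/
def zeroFullAsg (p : ℕ) (Y : ℕ → Prop) : Asg := fun i j b =>
  zeroUnitAsg p Y i j b ∨ (b = true ∧ i = p ∧ j = 1) ∨ (b = false ∧ j = p ∧ i < p)

theorem noConf_zeroAsg (hdb : DB n LS db) {t p : ℕ} {Y : ℕ → Prop} (htp : t ≤ p) (hp : 1 ≤ p)
    (hY : ∀ x, Y x → 2 ≤ x) (h : ∀ m, LS 0 m → p ≤ m) : NoConf n LS (zeroAsg t Y) := by
  refine ⟨?_, ?_, fun j m hm => ?_⟩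
  · simp only [zeroAsg]; grind
  · simp only [zeroAsg]; grind
  · by_cases hj0 : j = 0
    · subst hj0
      exact ⟨p, h m hm, by omega, by simp only [zeroAsg]; grind⟩
    · by_cases hj1 : j = 1
      · subst hj1
        have := hY 0
        exact ⟨0, by omega, by omega, by simp only [zeroAsg]; grind⟩
      · obtain ⟨x, h1, h2⟩ := hdb.ne hm
        exact ⟨x, h1, h2, by simp only [zeroAsg]; grind⟩

/-- The state before the propagation of `¬ P_{t-1,0}`, where this literal belongs to the newest
level. -/
structure ZeroChain (n : ℕ) (δ : ℚ) (D : ℕ) (db : List Clause) (vars : List ℕ) (sc : ℕ → ℚ)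
    (s₀ : Local) (t : ℕ) (Y : ℕ → Prop) (lvl : ℕ) (tr : List Entry) : Prop where
  steps : Steps δ (stepCost D) db (scList vars sc) s₀ (lvl, tr, [(opVar n (t - 1) 0, false)])
  st : St n db (zeroAsg t Y) (lvl, tr, [(opVar n (t - 1) 0, false)])
  split : ∃ top old, tr = top ++ old ∧ (∀ e ∈ old, e.level < lvl) ∧
    ∀ x, 1 ≤ x → x + 1 < t → (opVar n x 0, false) ∈ lits old
  last : AtLevel tr lvl (opVar n (t - 1) 0, true)

/-- Everything here happens at level 0: the unit clause `P_{0,1}` gives `¬ P_{1,0}` by antisymmetry.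
The requirement on lower levels is still empty for `t = 2`. -/
theorem zeroChain_start (hE : Env n δ D LS db vars sc) {p : ℕ} (hp : 2 ≤ p)
    (hLS : ∀ m, LS 0 m → p ≤ m) {tr : List Entry}
    (hS : St n db (zeroAsg 1 fun _ => False) (0, tr, [(opVar n 0 1, true)])) :
    ∃ tr', ZeroChain n δ D db vars sc (0, tr, [(opVar n 0 1, true)]) 2 (fun _ => False) 0 tr' := by
  have hn6 := hE.n6
  obtain ⟨new, h1, hS1, hf⟩ := step_pos hE (a := 0) (b := 1)
    (fun i j c => c = false ∧ i = 1 ∧ j = 0) (zeroAsg 2 fun _ => False) (Steps.refl _) hS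
    (noConf_zeroAsg hE.dbs (p := p) (by omega) (by omega) (by simp) hLS)
    ⟨by omega, by omega, by omega⟩ (Or.inl ⟨rfl, rfl, rfl⟩)
    (by intro i j c _; simp only [zeroAsg]; grind)
    (by intro i j c _; simp only [zeroAsg, Asg.Def]; grind)
    (by
      intro c _ _ _
      constructor <;> simp only [zeroAsg, Asg.Def, Asg.union] <;> grind)
    (by
      intro c _ _ _
      constructor <;> simp only [zeroAsg, Asg.Def, Asg.union] <;> grind)
    (Or.inr ⟨rfl, rfl, rfl⟩)
    (by intro i j c hv; simp only [zeroAsg, ImplPos]; grind)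
  obtain ⟨C, -, rfl, -⟩ := hf.eq_singleton (a := 1) (b := 0) (c := false) hS1.rep.nodup
    ⟨by omega, by omega, by omega⟩ (by grind)
  refine ⟨_, by simpa using h1, by simpa using hS1,
    ⟨_, [], (List.append_nil _).symm, by simp, by omega⟩,
    ⟨_, by simp; exact Or.inl rfl, rfl, rfl⟩⟩

/-- The literals `¬ P_{t-1,0}` imply nothing as long as two predecessors of `0` are possible. -/
theorem ZeroChain.idle (hE : Env n δ D LS db vars sc) {s₀ : Local} {t p lvl : ℕ} {Y : ℕ → Prop}
    {tr : List Entry} (h : ZeroChain n δ D db vars sc s₀ t Y lvl tr) (ht : 2 ≤ t) (htp : t < p)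
    (hY : ∀ x, Y x → 2 ≤ x) (hLS : ∀ m, LS 0 m → p ≤ m) (hpn : p < n) :
    Steps δ (stepCost D) db (scList vars sc) s₀ (lvl, tr, []) ∧
      St n db (zeroAsg t Y) (lvl, tr, []) := by
  refine steps_idle hE (noConf_zeroAsg hE.dbs (p := p) (by omega) (by omega) hY hLS) _ h.steps h.st
    fun l hl => ⟨t - 1, 0, ⟨by omega, by omega, by omega⟩, by simpa using hl,
      Or.inr (Or.inl ⟨rfl, rfl, by omega, by omega⟩), ?_, ?_⟩
  · intro c _ _ _
    constructor <;> simp only [zeroAsg, noAsg, Asg.Def, Asg.union] <;> grind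
  · intro m hm _ w hw hw0 hall
    exfalso
    have hpm := hLS m hm
    rw [union_noAsg] at hall
    by_cases hwp : w = p
    · have h1 := hall t (by omega) (by omega) (by omega)
      simp only [zeroAsg] at h1
      omega
    · have h1 := hall p (by omega) (by omega) (Ne.symm hwp)
      simp only [zeroAsg] at h1
      omega

/-- A decision in column `0`. -/
theorem ZeroChain.decide (hE : Env n δ D LS db vars sc) {s₀ : Local} {t p lvl M : ℕ}
    {tr : List Entry} (h : ZeroChain n δ D db vars sc s₀ t (fun _ => False) lvl tr) (ht : 2 ≤ t)
    (htp : t < p) (hLS : ∀ m, LS 0 m → p ≤ m) (hpn : p < n) (htM : t ≤ M)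
    (hpick : Prefers n sc 0 M) :
    ∃ tr', ZeroChain n δ D db vars sc s₀ (t + 1) (fun _ => False) (lvl + 1) tr' := by
  obtain ⟨h1, hS1⟩ := h.idle hE ht htp (by simp) hLS hpn
  have hn := noConf_zeroAsg (Y := fun _ => False) hE.dbs htp.le (by omega) (by simp) hLS
  obtain ⟨h2, hS2⟩ := step_decide hE (a := t) (b := 0) (zeroAsg (t + 1) fun _ => False) h1 hS1 hn
    ⟨by omega, by omega, by omega⟩ (by simp only [zeroAsg, Asg.Def]; grind)
    (by
      intro i j hv hd hne
      refine hpick t htM (by omega) i j hv ?_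
      by_contra hcon
      push Not at hcon
      obtain ⟨rfl, hit⟩ := hcon
      have hit' : i ≠ t := fun h => hne ⟨h, rfl⟩
      have := hv.2.2
      exact hd (Or.inr (Or.inr (Or.inl ⟨rfl, rfl, by omega, by omega⟩))))
    (by intro i j c _; simp only [zeroAsg]; grind)
  refine ⟨_, h2, hS2, ⟨[_], tr, rfl, fun e he => Nat.lt_succ_of_le (hS1.level e he), ?_⟩,
    ⟨_, List.mem_cons_self, rfl, rfl⟩⟩
  intro x hx hxt
  exact (hS1.rep.mem_iff ⟨by omega, by omega, by omega⟩).2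
    (Or.inr (Or.inl ⟨rfl, rfl, hx, by omega⟩))

/-- A decision `¬ P_{t,1}`, which implies `¬ P_{t,0}`. -/
theorem ZeroChain.decide_one (hE : Env n δ D LS db vars sc) {s₀ : Local} {t p lvl M : ℕ}
    {tr : List Entry} (h : ZeroChain n δ D db vars sc s₀ t (fun x => 2 ≤ x ∧ x < t) lvl tr)
    (ht : 2 ≤ t) (htp : t < p) (hLS : ∀ m, LS 0 m → p ≤ m) (hpn : p < n) (htM : t ≤ M)
    (hpick : Prefers n sc 1 M) :
    ∃ tr', ZeroChain n δ D db vars sc s₀ (t + 1) (fun x => 2 ≤ x ∧ x < t + 1) (lvl + 1) tr' := by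
  obtain ⟨h1, hS1⟩ := h.idle hE ht htp (fun _ h => h.1) hLS hpn
  have hn := noConf_zeroAsg (Y := fun x => 2 ≤ x ∧ x < t) hE.dbs htp.le (by omega)
    (fun _ h => h.1) hLS
  have hn' := noConf_zeroAsg (t := t + 1) (Y := fun x => 2 ≤ x ∧ x < t + 1) hE.dbs (by omega)
    (by omega) (fun _ h => h.1) hLS
  have hv : Valid n t 1 := ⟨by omega, by omega, by omega⟩
  obtain ⟨h2, hS2⟩ := step_decide hE (a := t) (b := 1)
    (zeroAsg t fun x => 2 ≤ x ∧ x < t + 1) h1 hS1 hn hv (by simp only [zeroAsg, Asg.Def]; grind)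
    (by
      intro i j hv hd hne
      refine hpick t htM (by omega) i j hv ?_
      by_contra hcon
      push Not at hcon
      obtain ⟨rfl, hit⟩ := hcon
      have hit' : i ≠ t := fun h => hne ⟨h, rfl⟩
      have := hv.2.2
      by_cases hi : i = 0
      · exact hd (Or.inl (Or.inl ⟨rfl, hi, rfl⟩))
      · exact hd (Or.inr (Or.inr (Or.inr ⟨rfl, rfl, by omega, by omega⟩))))
    (by intro i j c _; simp only [zeroAsg]; grind)
  obtain ⟨new, h3, hS3, hf⟩ := step_neg hE (a := t) (b := 1)
    (fun i j c => c = false ∧ i = t ∧ j = 0) noAsg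
    (zeroAsg (t + 1) fun x => 2 ≤ x ∧ x < t + 1) h2 hS2
    (hn'.mono (by intro i j c; simp only [zeroAsg]; grind)) hv
    (Or.inr (Or.inr ⟨rfl, rfl, by omega, by omega⟩))
    (by intro i j c _; simp only [zeroAsg, noAsg]; grind)
    (by intro i j c _; simp only [zeroAsg, Asg.Def]; grind)
    (by simp [noAsg])
    (by
      intro c _ _ _
      constructor <;> simp only [zeroAsg, Asg.Def, Asg.union] <;> grind)
    (by
      intro m hm _ w hw hw1 hall
      by_cases hw0 : w = 0
      · exact Or.inl (Or.inl (Or.inl (Or.inl ⟨rfl, hw0, rfl⟩)))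
      · have := hall 0 (by omega) (by omega) (Ne.symm hw0)
        simp only [zeroAsg, noAsg, Asg.union] at this
        grind)
    (by
      rintro i j c _ ⟨rfl, rfl, rfl⟩
      exact ⟨rfl, rfl, by omega, Or.inl ⟨rfl, rfl, rfl⟩⟩)
    (by simp [noAsg])
  rw [union_noAsg] at hf
  obtain ⟨C, -, rfl, -⟩ := hf.eq_singleton (a := t) (b := 0) (c := false) hS3.rep.nodup
    ⟨by omega, by omega, by omega⟩ (by grind)
  refine ⟨_, by simpa using h3, by simpa using hS3, ⟨[_, _], tr, rfl,
    fun e he => Nat.lt_succ_of_le (hS1.level e he), ?_⟩, ⟨_, List.mem_cons_self, rfl, rfl⟩⟩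
  intro x hx hxt
  exact (hS1.rep.mem_iff ⟨by omega, by omega, by omega⟩).2
    (Or.inr (Or.inl ⟨rfl, rfl, hx, by omega⟩))

/-- The last literal `¬ P_{p-1,0}` implies `P_{p,0}`, whose propagation falsifies the column
clause `p, p`. -/
theorem ZeroChain.unit (hE : Env n δ D LS db vars sc) {s₀ : Local} {p lvl : ℕ} {Y : ℕ → Prop}
    {tr : List Entry} (h : ZeroChain n δ D db vars sc s₀ p Y lvl tr) (hp : 2 ≤ p)
    (hLS : ∀ m, LS 0 m → p ≤ m) (hm : LS 0 p) (hY : ∀ x, Y x → 2 ≤ x ∧ x < p) :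
    ∃ X batch, Steps δ (stepCost D) db (scList vars sc) s₀
        (lvl, batch ++ ⟨(opVar n p 0, true), lvl, some X⟩ :: tr, (lits batch).reverse) ∧
      St n db (zeroFullAsg p Y)
        (lvl, batch ++ ⟨(opVar n p 0, true), lvl, some X⟩ :: tr, (lits batch).reverse) ∧
      (∀ l ∈ X, l ≠ (opVar n p 0, true) → ∃ x, x < p ∧ x ≠ 0 ∧ l = (opVar n x 0, true)) ∧
      Fresh n db (⟨(opVar n p 0, true), lvl, some X⟩ :: tr) lvl (opVar n p 0, true)
        (fun i j b => (b = true ∧ i = p ∧ j = 1) ∨ (b = false ∧ j = p ∧ i < p)) batch := by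
  have hn6 := hE.n6
  have hpn := (hE.dbs.range 0 p hm).2.1
  have hv : Valid n (p - 1) 0 := ⟨by omega, by omega, by omega⟩
  have hvp : Valid n p 0 := ⟨by omega, by omega, by omega⟩
  have hn := noConf_zeroAsg hE.dbs le_rfl (by omega) (fun x hx => (hY x hx).1) hLS
  obtain ⟨new, h1, hS1, hf⟩ := step_neg hE (a := p - 1) (b := 0) noAsg
    (fun i j c => c = true ∧ i = p ∧ j = 0) (zeroUnitAsg p Y) h.steps h.st hn hv
    (Or.inr (Or.inl ⟨rfl, rfl, by omega, by omega⟩))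
    (by intro i j c _; simp only [zeroAsg, zeroUnitAsg, noAsg]; grind)
    (by simp [noAsg])
    (by intro i j c _; simp only [union_noAsg, zeroAsg, Asg.Def]; grind)
    (by
      intro c _ _ _
      constructor <;> simp only [zeroAsg, noAsg, Asg.Def, Asg.union] <;> grind)
    (by
      intro m hm' _ w hw hw0 hall
      rw [union_noAsg] at hall ⊢
      by_cases hwp : w = p
      · exact Or.inr ⟨rfl, hwp, rfl⟩
      · have h1 := hall p (hLS m hm') (by omega) (Ne.symm hwp)
        simp only [Asg.union, zeroAsg] at h1
        grind)
    (by simp [noAsg])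
    (by
      rintro i j c _ ⟨rfl, rfl, rfl⟩
      exact ⟨rfl, rfl, i, hm, by omega, le_rfl, fun x hx hx0 hxi =>
        Or.inr (Or.inl ⟨rfl, rfl, by omega, by omega⟩)⟩)
  obtain ⟨X, hX, rfl, hm1, hm2, hXf⟩ := hf.eq_singleton (a := p) (b := 0) (c := true)
    hS1.rep.nodup hvp (by intro i j b' _; simp only [Asg.union, noAsg]; grind)
  have hn7 : NoConf n LS (zeroUnitAsg p Y) := by
    refine ⟨by simp only [zeroUnitAsg, zeroAsg]; grind,
      by simp only [zeroUnitAsg, zeroAsg]; grind, fun j m hm => ?_⟩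
    by_cases hj0 : j = 0
    · subst hj0
      exact ⟨p, hLS m hm, by omega, by simp only [zeroUnitAsg, zeroAsg]; grind⟩
    · by_cases hj1 : j = 1
      · subst hj1
        have := hY 0
        exact ⟨0, by omega, by omega, by simp only [zeroUnitAsg, zeroAsg]; grind⟩
      · obtain ⟨x, h1, h2⟩ := hE.dbs.ne hm
        exact ⟨x, h1, h2, by simp only [zeroUnitAsg, zeroAsg]; grind⟩
  simp only [List.nil_append, List.singleton_append, List.map_cons, List.map_nil,
    List.reverse_singleton] at h1 hS1
  have hYp := hY p
  obtain ⟨batch, h2, hS2, hf2⟩ := step_pos hE (a := p) (b := 0)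
    (fun i j b => (b = true ∧ i = p ∧ j = 1) ∨ (b = false ∧ j = p ∧ i < p))
    (zeroFullAsg p Y) h1 hS1 hn7 hvp (Or.inr ⟨rfl, rfl, rfl⟩)
    (by intro i j c _; simp only [zeroFullAsg])
    (by intro i j c _; simp only [zeroUnitAsg, zeroAsg, Asg.Def]; grind)
    (by
      intro c _ _ _
      constructor <;> simp only [zeroUnitAsg, zeroAsg, Asg.Def, Asg.union] <;> grind)
    (by
      intro c _ _ _
      constructor <;> simp only [zeroUnitAsg, zeroAsg, Asg.Def, Asg.union] <;> grind)
    (by simp only [zeroUnitAsg, zeroAsg, Asg.Def]; grind)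
    (by intro i j c hv; simp only [zeroUnitAsg, zeroAsg, ImplPos]; have := hv.2.2; grind)
  refine ⟨X, batch, by simpa using h2, by simpa using hS2, fun l hl hne => ?_, hf2⟩
  obtain ⟨x, hx, hx0, rfl⟩ := col_reason hE.dbs hX hv hvp hm1 hm2 hl
  rcases hXf _ hl hne with h' | h'
  · simp [neg] at h'
  · have := (h.st.rep.mem_iff ⟨hx, by omega, hx0⟩).1 h'
    simp only [zeroAsg] at this
    exact ⟨x, by omega, hx0, rfl⟩

/-- The column clause `p, p` is the only one that is falsified after `zeroFullAsg`. -/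
theorem zeroFullAsg_unique (hdb : DB n LS db) {p : ℕ} {Y : ℕ → Prop} (hp : 2 ≤ p)
    (hLS : ∀ m, LS 0 m → p ≤ m) (hY : ∀ x, Y x → 2 ≤ x ∧ x < p) {j r : ℕ} (hjr : LS j r)
    (hall : ∀ x ≤ r, x ≠ j → zeroFullAsg p Y x j false) : j = p ∧ r = p := by
  have hr := hdb.range j r hjr
  by_cases hj0 : j = 0
  · subst hj0
    have h1 := hall p (hLS r hjr) (by omega)
    simp only [zeroFullAsg, zeroUnitAsg, zeroAsg] at h1
    grind
  · by_cases hj1 : j = 1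
    · subst hj1
      have h1 := hall 0 (by omega) (by omega)
      have := hY 0
      simp only [zeroFullAsg, zeroUnitAsg, zeroAsg] at h1
      grind
    · by_cases hjp : j = p
      · subst hjp
        refine ⟨rfl, ?_⟩
        by_contra hne
        have h1 := hall (j + 1) (by omega) (by omega)
        simp only [zeroFullAsg, zeroUnitAsg, zeroAsg] at h1
        grind
      · obtain ⟨x, hx, hxj⟩ := hdb.ne hjr
        have h1 := hall x hx hxj
        simp only [zeroFullAsg, zeroUnitAsg, zeroAsg] at h1
        grind

theorem zeroFullAsg_column {p : ℕ} {Y : ℕ → Prop} : ∀ x ≤ p, x ≠ p → zeroFullAsg p Y x p false :=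
  fun _ hx hxp => Or.inr (Or.inr ⟨rfl, rfl, by omega⟩)

/-- Analysis goes from column `p` to column `0`. There only `P_{p-1,0}` was falsified at the newest
level, the others earlier, so it stops. It does not matter whether `¬ P_{p-1,0}` was decided or
implied by a decision in column 1. -/
theorem ZeroChain.learns (hE : Env n δ D LS db vars sc) {s₀ : Local} {p lvl : ℕ} {Y : ℕ → Prop}
    {tr : List Entry} (h : ZeroChain n δ D db vars sc s₀ p Y lvl tr) (hlvl : lvl ≠ 0) (hp : 2 ≤ p)
    (hLS : ∀ m, LS 0 m → p ≤ m) (hm : LS 0 p) (hLSp : LS p p) (hY : ∀ x, Y x → 2 ≤ x ∧ x < p) :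
    Learns n δ D db vars sc s₀ 0 (p - 1) := by
  have hn6 := hE.n6
  have hpn := (hE.dbs.range 0 p hm).2.1
  have hYp := hY p
  obtain ⟨X, batch, h1, hS1, hX, hf⟩ := h.unit hE hp hLS hm hY
  refine learns_of_conflict hE h1 hS1 hlvl hLSp zeroFullAsg_column ?_ ?_
    (fun _ _ h h' => zeroFullAsg_unique hE.dbs hp hLS hY h h') (by omega) ?_
  · simp only [zeroFullAsg, zeroUnitAsg, zeroAsg]; grind
  · simp only [zeroFullAsg, zeroUnitAsg, zeroAsg]; grind
  · intro E hnd hEm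
    obtain ⟨top, old, rfl, hold, hmem⟩ := h.split
    obtain ⟨E', e1, e2, e3⟩ := analyze_column (full' := []) (tr₁ := batch) (tr₀ := top ++ old)
      (lvl := lvl) hE.dbs hS1.rep.nodup (p := p) (k := 0) ⟨hpn, by omega, by omega⟩ rfl
      (B := fun x => x < p)
      (by
        intro x hx
        refine ⟨by omega, by omega, (hf.mem _).2 ⟨x, p, false, ⟨by omega, hpn, by omega⟩, rfl,
          Or.inr ⟨rfl, rfl, hx⟩⟩, fun hx0 => ?_⟩
        exact (h.st.rep.mem_iff ⟨by omega, by omega, hx0⟩).2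
          (Or.inr (Or.inl ⟨rfl, rfl, by omega, hx⟩)))
      (by
        intro e he
        obtain ⟨hl, C, hC, hr, hn, hm, -⟩ := hf.info e he
        exact ⟨hl, fun x _ _ => ⟨C, hC, hr, Or.inl hn, hm⟩⟩)
      (x₁ := 0) (x₂ := 1) (y := p - 1) (by omega) (by omega) (by omega) (by omega) (by omega)
      (by
        obtain ⟨e, he, h⟩ := h.last
        exact ⟨e, List.mem_append_right _ (List.mem_cons_of_mem _ he), h⟩)
      hX hnd
      (by
        intro l
        rw [hEm]
        constructor
        · rintro ⟨x, hx, hxp, rfl⟩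
          exact ⟨x, by omega, rfl⟩
        · rintro ⟨x, hx, rfl⟩
          exact ⟨x, by omega, by omega, rfl⟩)
    rw [e3, analyze_uip (old := old)
      (new := batch ++ ⟨(opVar n p 0, true), lvl, some X⟩ :: top) hS1.rep.nodup (by simp) hold e1
      (a := (opVar n (p - 1) 0, true))]
    · refine ⟨e1, fun l => ?_⟩
      rw [e2]
      constructor
      · rintro ⟨x, hx, hxk, rfl⟩
        exact ⟨x, by omega, hxk, rfl⟩
      · rintro ⟨x, hx, hxk, rfl⟩
        exact ⟨x, by omega, hxk, rfl⟩
    · intro l hl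
      obtain ⟨x, hx, hx0, rfl⟩ := (e2 l).1 hl
      by_cases hxp : x = p - 1
      · exact Or.inl (by rw [hxp])
      · exact Or.inr (hmem x (by omega) (by omega))

/-- The same conflict, reached without any decision, proves unsatisfiability. -/
theorem ZeroChain.refutes (hE : Env n δ D LS db vars sc) {s₀ : Local} {p : ℕ} {Y : ℕ → Prop}
    {tr : List Entry} (h : ZeroChain n δ D db vars sc s₀ p Y 0 tr) (hp : 2 ≤ p)
    (hLS : ∀ m, LS 0 m → p ≤ m) (hm : LS 0 p) (hLSp : LS p p) (hY : ∀ x, Y x → 2 ≤ x ∧ x < p) :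
    ∃ s, Steps δ (stepCost D) db (scList vars sc) s₀ s ∧
      (searchStep δ (mkSearch db (scList vars sc) s)).val = .unsat ∧
      (searchStep δ (mkSearch db (scList vars sc) s)).cost ≤ stepCost D ∧
      s.2.1.length ≤ n * n := by
  have hpn := (hE.dbs.range 0 p hm).2.1
  obtain ⟨X, batch, h1, hS1, -, -⟩ := h.unit hE hp hLS hm hY
  obtain ⟨Cs, hsplit, -, hC2⟩ := hE.dbs.split
  obtain ⟨C, hC, hCcol⟩ := hC2 p p hLSp
  obtain ⟨C', -, -, hs⟩ := findConflict_some hS1.rep.nodup (Γ := db)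
    ⟨C, by rw [hsplit]; exact List.mem_append_right _ hC, fun l hl => by
      obtain ⟨x, hx, hxp, rfl⟩ := (hCcol.mem l).1 hl
      exact (hS1.rep.mem_iff ⟨by omega, hpn, hxp⟩).2 (zeroFullAsg_column x hx hxp)⟩
  refine ⟨_, h1, ?_, searchStep_cost (hE.bounded hS1) fun h => absurd rfl h, hS1.rep.length_le⟩
  simp [searchStep, mkSearch, hs]

end runs

/-! ### Scores -/

theorem IsCol.mem_iff {n j m : ℕ} {L : Clause} (h : IsCol n j m L) (hm : m < n) {i k : ℕ}
    (hi : i < n) : (∃ l ∈ L, l.1 = opVar n i k) ↔ k = j ∧ i ≤ m ∧ i ≠ j := by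
  constructor
  · rintro ⟨l, hl, he⟩
    obtain ⟨x, hx, hxj, rfl⟩ := (h.mem l).1 hl
    obtain ⟨rfl, rfl⟩ := (opVar_inj (by omega) hi).1 he
    exact ⟨rfl, hx, hxj⟩
  · rintro ⟨rfl, hi', hik⟩
    exact ⟨_, (h.mem _).2 ⟨i, hi', hik, rfl⟩, rfl⟩

/-- The properties of the scores that persist when column clauses are learned. -/
structure Scores (n : ℕ) (δ : ℚ) (c : ℕ) (sc : ℕ → ℚ) : Prop where
  anti : ∀ k x i, Valid n x k → Valid n i k → x < i → sc (opVar n i k) ≤ sc (opVar n x k)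
  nonneg : ∀ y, 0 ≤ sc y
  lt_two : ∀ y, sc y < 2
  den : ∀ y, (sc y).den ∣ δ.den ^ c

theorem scores_zero (n : ℕ) (δ : ℚ) : Scores n δ 0 fun _ => 0 :=
  ⟨by simp, by simp, by simp, by simp⟩

theorem bump_of_mem {δ : ℚ} {L : Clause} {sc : ℕ → ℚ} {x : ℕ} (h : ∃ l ∈ L, l.1 = x) :
    bump δ L sc x = 1 + δ * sc x := by
  simp only [bump, if_pos h]

theorem bump_of_notMem {δ : ℚ} {L : Clause} {sc : ℕ → ℚ} {x : ℕ} (h : ¬ ∃ l ∈ L, l.1 = x) :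
    bump δ L sc x = δ * sc x := by
  simp only [bump, if_neg h, zero_add]

theorem bump_mono {δ : ℚ} (hδ : 0 < δ) {L : Clause} {sc : ℕ → ℚ} {x y : ℕ} (h : sc y ≤ sc x)
    (hxy : (∃ l ∈ L, l.1 = y) → ∃ l ∈ L, l.1 = x) : bump δ L sc y ≤ bump δ L sc x := by
  have h1 : δ * sc y ≤ δ * sc x := mul_le_mul_of_nonneg_left h hδ.le
  by_cases hy : ∃ l ∈ L, l.1 = y
  · rw [bump_of_mem hy, bump_of_mem (hxy hy)]
    linarith
  · rw [bump_of_notMem hy]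
    by_cases hx : ∃ l ∈ L, l.1 = x
    · rw [bump_of_mem hx]; linarith
    · rw [bump_of_notMem hx]; exact h1

/-- An addition that reaches `x` whenever it reaches `y` cannot reverse their order, and
multiplication by `δ > 0` preserves both strict order and ties. -/
theorem Better.bump {δ : ℚ} (hδ : 0 < δ) {L : Clause} {sc : ℕ → ℚ} {x y : ℕ}
    (h : Better sc x y) (hxy : (∃ l ∈ L, l.1 = y) → ∃ l ∈ L, l.1 = x) :
    Better (bump δ L sc) x y := by
  rcases h with h | ⟨h, hlt⟩
  · left
    have h1 : δ * sc y < δ * sc x := mul_lt_mul_of_pos_left h hδ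
    by_cases hy : ∃ l ∈ L, l.1 = y
    · rw [bump_of_mem hy, bump_of_mem (hxy hy)]
      linarith
    · rw [bump_of_notMem hy]
      by_cases hx : ∃ l ∈ L, l.1 = x
      · rw [bump_of_mem hx]; linarith
      · rw [bump_of_notMem hx]; exact h1
  · rcases (bump_mono hδ h.le hxy).lt_or_eq with h' | h'
    · exact Or.inl h'
    · exact Or.inr ⟨h', hlt⟩

section scores

variable {n c : ℕ} {δ : ℚ} {sc : ℕ → ℚ} {L : Clause} {j m : ℕ}

theorem Scores.mul_lt_one (h : Scores n δ c sc) (hδ₀ : 0 < δ) (hδ : δ ≤ 1 / 2) (y : ℕ) :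
    0 ≤ δ * sc y ∧ δ * sc y < 1 := by
  have h0 := h.nonneg y
  have h2 := h.lt_two y
  refine ⟨by positivity, ?_⟩
  calc δ * sc y ≤ 1 / 2 * sc y := mul_le_mul_of_nonneg_right hδ h0
    _ < 1 := by linarith

/-- Learned clauses are initial segments of a column, which keeps scores antitone in the row index.
The bound 2 reproduces itself: 1 + δ q < 2 if q < 2 and δ ≤ 1/2. -/
theorem Scores.bump (h : Scores n δ c sc) (hδ₀ : 0 < δ) (hδ : δ ≤ 1 / 2) (hL : IsCol n j m L)
    (hm : m < n) : Scores n δ (c + 1) (bump δ L sc) where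
  anti k x i hx hi hxi := bump_mono hδ₀ (h.anti k x i hx hi hxi) fun hiL => by
    rw [hL.mem_iff hm hi.1] at hiL
    rw [hL.mem_iff hm hx.1]
    exact ⟨hiL.1, by omega, hiL.1 ▸ hx.2.2⟩
  nonneg y := by
    have := (h.mul_lt_one hδ₀ hδ y).1
    unfold SatSep.bump
    split_ifs <;> linarith
  lt_two y := by
    have := (h.mul_lt_one hδ₀ hδ y).2
    unfold SatSep.bump
    split_ifs <;> linarith
  den y := by
    have h1 : (δ * sc y).den ∣ δ.den ^ (c + 1) := by
      rw [pow_succ']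
      exact (Rat.mul_den_dvd _ _).trans (mul_dvd_mul_left _ (h.den y))
    refine (Rat.add_den_dvd _ _).trans ?_
    split_ifs <;> simpa using h1

/-- The variables of the learned clause are preferred. -/
theorem Scores.prefers_bump (h : Scores n δ c sc) (hδ₀ : 0 < δ) (hδ : δ ≤ 1 / 2)
    (hL : IsCol n j m L) (hj : j < n) (hm : m < n) : Prefers n (SatSep.bump δ L sc) j m := by
  intro x hx hxj i k hv hcase
  have hxL := (hL.mem_iff hm (show x < n by omega)).2 ⟨rfl, hx, hxj⟩
  by_cases hiL : ∃ l ∈ L, l.1 = opVar n i k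
  · obtain ⟨rfl, hi, -⟩ := (hL.mem_iff hm hv.1).1 hiL
    have hxi : x < i := by simpa using hcase
    rcases (bump_mono hδ₀ (h.anti k x i ⟨by omega, hj, hxj⟩ hv hxi) fun _ => hxL).lt_or_eq
      with h' | h'
    · exact Or.inl h'
    · exact Or.inr ⟨h', by simp only [opVar]; omega⟩
  · left
    rw [bump_of_mem hxL, bump_of_notMem hiL]
    have h1 := (h.mul_lt_one hδ₀ hδ (opVar n i k)).2
    have h2 := (h.mul_lt_one hδ₀ hδ (opVar n x j)).1
    linarith

/-- Later clauses of the same column may be shorter than `M`, but bumping an initial segment never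
moves a later variable ahead of an earlier one. So the whole range that was preferred when the
column was entered stays preferred; `learns_jump` needs this, as it decides up to `n - 2`. -/
theorem Prefers.bump {M : ℕ} (h : Prefers n sc j M) (hδ₀ : 0 < δ) (hL : IsCol n j m L)
    (hm : m < n) (hM : M < n) : Prefers n (SatSep.bump δ L sc) j M := by
  intro x hx hxj i k hv hcase
  refine (h x hx hxj i k hv hcase).bump hδ₀ fun hiL => ?_
  rw [hL.mem_iff hm hv.1] at hiL
  rw [hL.mem_iff hm (show x < n by omega)]
  exact ⟨rfl, by omega, hxj⟩

/-- With all scores tied, the column-major order alone decides, and it starts with column 0. -/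
theorem prefers_zero {M : ℕ} (hM : M < n) : Prefers n (fun _ => 0) 0 M := by
  intro x hx hx0 i j hv hcase
  refine Or.inr ⟨rfl, ?_⟩
  simp only [opVar, Nat.zero_mul, Nat.zero_add]
  rcases Nat.eq_zero_or_pos j with rfl | hj
  · simp only [ne_eq, not_true_eq_false, false_or] at hcase
    omega
  · have := Nat.mul_le_mul_right n hj
    omega

end scores

/-! ### The states after a restart -/

/-- A bound for the numbers and lengths that occur in the run of the solver. -/
def sizeBound (δ : ℚ) (n : ℕ) : ℕ :=
  4 * n ^ 3 + 6 * n ^ 2 + n + 7 + 2 * ((n ^ 2 + 1) * δ.den.size) + bits δ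

/-- The variables of the solver. -/
structure Vars (n : ℕ) (vars : List ℕ) : Prop where
  mem : ∀ x, x ∈ vars ↔ ∃ i j, Valid n i j ∧ x = opVar n i j
  length_le : vars.length ≤ 4 * n ^ 3 + 4 * n ^ 2 + n

/-- The solver has learned `c` clauses, its column clauses are given by `LS`, and it prefers the
variables `P_{x,k}` with `x ≤ M`. -/
structure Stage (n : ℕ) (δ : ℚ) (LS : ℕ → ℕ → Prop) (k M c : ℕ) (db : List Clause)
    (sc : ℕ → ℚ) : Prop where
  dbs : DB n LS db
  len : db.length ≤ 4 * n ^ 3 + 4 * n ^ 2 + n + c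
  scores : Scores n δ c sc
  prefers : Prefers n sc k M

section stages

variable {n c k M : ℕ} {δ : ℚ} {sc : ℕ → ℚ} {L : Clause} {LS LS' : ℕ → ℕ → Prop}
  {db : List Clause} {vars : List ℕ} {j m : ℕ}

/-- Since at most `n ^ 2` clauses are ever learned, one size bound serves for the whole run. -/
theorem Stage.env (h : Stage n δ LS k M c db sc) (hδ₀ : 0 < δ) (hδ : δ ≤ 1 / 2) (hn : 6 ≤ n)
    (hc : c ≤ n ^ 2) (hvars : Vars n vars) : Env n δ (sizeBound δ n) LS db vars sc where
  n6 := hn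
  dbs := h.dbs
  vars_mem := hvars.mem
  clause_len := by
    intro C hC
    unfold sizeBound
    rcases h.dbs.cases hC with ⟨i, j, k, hi, hj, hk, h1, h2, h3, rfl⟩ | ⟨i, j, hi, hj, h1, rfl⟩ |
      ⟨j, m, hLS, hcol⟩
    · simp; omega
    · simp; omega
    · have := hcol.length_le (h.dbs.range j m hLS).2.1
      omega
  len := by
    have := h.len
    have h2 : n * n = n ^ 2 := (sq n).symm
    unfold sizeBound
    omega
  vars_len := by
    have := hvars.length_le
    unfold sizeBound
    omega
  bits_δ := by unfold sizeBound; omega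
  bits_sc := by
    intro x
    have hd := h.scores.den x
    have h0 := h.scores.nonneg x
    have h2 := (h.scores.lt_two x).le
    obtain ⟨h3, h4⟩ := h.scores.mul_lt_one hδ₀ hδ x
    have hc' : c + 1 ≤ n ^ 2 + 1 := by omega
    have hle : ∀ e, e ≤ n ^ 2 + 1 → 2 * (e * δ.den.size) + 3 ≤ sizeBound δ n := by
      intro e he
      have := Nat.mul_le_mul_right δ.den.size he
      unfold sizeBound
      omega
    refine ⟨(bits_le δ.den_pos h0 h2 hd).trans (hle c (by omega)),
      (bits_le (c := c + 1) δ.den_pos h3 (by linarith) ?_).trans (hle _ hc')⟩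
    rw [pow_succ']
    exact (Rat.mul_den_dvd _ _).trans (mul_dvd_mul_left _ hd)

theorem DB.learn (h : DB n LS db) (hL : IsCol n j m L) (hjm : j ≤ m ∧ m < n ∧ 1 ≤ m)
    (hLS : ∀ a b, LS' a b ↔ LS a b ∨ (a = j ∧ b = m)) : DB n LS' (db ++ [L]) where
  split := by
    obtain ⟨Cs, rfl, h1, h2⟩ := h.split
    refine ⟨Cs ++ [L], by simp, ?_, ?_⟩
    · intro C hC
      rcases List.mem_append.1 hC with hC | hC
      · obtain ⟨a, b, hab, hcol⟩ := h1 C hC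
        exact ⟨a, b, (hLS a b).2 (Or.inl hab), hcol⟩
      · rw [List.mem_singleton.1 hC]
        exact ⟨j, m, (hLS j m).2 (Or.inr ⟨rfl, rfl⟩), hL⟩
    · intro a b hab
      rcases (hLS a b).1 hab with hab | ⟨rfl, rfl⟩
      · obtain ⟨C, hC, hcol⟩ := h2 a b hab
        exact ⟨C, List.mem_append_left _ hC, hcol⟩
      · exact ⟨L, by simp, hL⟩
  range := by
    intro a b hab
    rcases (hLS a b).1 hab with hab | ⟨rfl, rfl⟩
    · exact h.range a b hab
    · exact hjm
  full := fun a ha => (hLS _ _).2 (Or.inl (h.full a ha))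

theorem Stage.learn (h : Stage n δ LS k M c db sc) (hδ₀ : 0 < δ) (hδ : δ ≤ 1 / 2)
    (hL : IsCol n j m L) (hjm : j ≤ m ∧ m < n ∧ 1 ≤ m)
    (hLS : ∀ a b, LS' a b ↔ LS a b ∨ (a = j ∧ b = m)) :
    Stage n δ LS' j m (c + 1) (db ++ [L]) (bump δ L sc) where
  dbs := h.dbs.learn hL hjm hLS
  len := by
    have := h.len
    simp only [List.length_append, List.length_singleton]
    omega
  scores := h.scores.bump hδ₀ hδ hL hjm.2.1
  prefers := h.scores.prefers_bump hδ₀ hδ hL (by omega) hjm.2.1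

theorem Stage.learn_same (h : Stage n δ LS k M c db sc) (hδ₀ : 0 < δ) (hδ : δ ≤ 1 / 2)
    (hL : IsCol n k m L) (hjm : k ≤ m ∧ m < n ∧ 1 ≤ m) (hM : M < n)
    (hLS : ∀ a b, LS' a b ↔ LS a b ∨ (a = k ∧ b = m)) :
    Stage n δ LS' k M (c + 1) (db ++ [L]) (bump δ L sc) :=
  { h.learn hδ₀ hδ hL hjm hLS with prefers := h.prefers.bump hδ₀ hL hjm.2.1 hM }

/-- From the restart, the solver reports unsatisfiability within time `B`. -/
def Reaches (δ : ℚ) (vars : List ℕ) (db : List Clause) (sc : ℕ → ℚ) (B : ℕ) : Prop :=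
  ∃ t ≤ B, (cdcl δ).Run (restart db (scList vars sc)).val t .unsat

theorem Reaches.mono {B B' : ℕ} (h : Reaches δ vars db sc B) (hB : B ≤ B') :
    Reaches δ vars db sc B' :=
  h.imp fun _ ht => ⟨ht.1.trans hB, ht.2⟩

/-- A bound for the time between two conflicts. -/
def roundBound (δ : ℚ) (n : ℕ) : ℕ := stepCost (sizeBound δ n) * (2 * n ^ 2 + 2)

/-- By the potential argument the conflict-free steps cost at most `2 n ^ 2 + 1` times the step
bound, as the trail has at most `n ^ 2` entries and the initial queue at most one; one more step
handles the conflict. -/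
theorem run_round {D : ℕ} {s₀ s : Local} {st : CDCLState}
    (h : Steps δ (stepCost D) db (scList vars sc) s₀ s)
    (hv : (searchStep δ (mkSearch db (scList vars sc) s)).val = st)
    (hc : (searchStep δ (mkSearch db (scList vars sc) s)).cost ≤ stepCost D)
    (hl : s.2.1.length ≤ n * n) (hq : s₀.2.2.length ≤ 1) :
    ∃ t ≤ stepCost D * (2 * n ^ 2 + 2),
      (cdcl δ).Run (.search (mkSearch db (scList vars sc) s₀)) t st := by
  obtain ⟨t, ht, hr⟩ := h.run
  refine ⟨_, ?_, hr.trans (Solver.Run.single (S := cdcl δ) (cdcl_step_search hv))⟩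
  have h1 : stepCost D * (2 * s.2.1.length + s₀.2.2.length) ≤ stepCost D * (2 * n ^ 2 + 1) :=
    Nat.mul_le_mul_left _ (by rw [sq]; omega)
  have h2 : stepCost D * (2 * n ^ 2 + 2) = stepCost D * (2 * n ^ 2 + 1) + stepCost D := by ring
  omega

theorem Learns.reaches {s₀ : Local} {B : ℕ}
    (h : Learns n δ (sizeBound δ n) db vars sc s₀ j m)
    (hs₀ : (restart db (scList vars sc)).val = .search (mkSearch db (scList vars sc) s₀))
    (hq : s₀.2.2.length ≤ 1)
    (hnext : ∀ L, IsCol n j m L → Reaches δ vars (db ++ [L]) (bump δ L sc) B) :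
    Reaches δ vars db sc (B + roundBound δ n) := by
  obtain ⟨s, L, hL, h1, h2, h3, h4⟩ := h
  obtain ⟨t, ht, hr⟩ := run_round h1 h2 h3 h4 hq
  obtain ⟨u, hu, hr'⟩ := hnext L hL
  refine ⟨t + u, by unfold roundBound; omega, ?_⟩
  rw [hs₀]
  exact hr.trans hr'

/-- Without unit clauses the trail is empty after a restart. -/
theorem restart_empty (hdb : DB n LS db) (h2 : ∀ j m, LS j m → 2 ≤ m) (sc : List (ℕ × ℚ)) :
    (restart db sc).val = .search (mkSearch db sc (0, [], [])) := by
  obtain ⟨new, h1, hS⟩ := saturate_none hdb noAsg (by simp [noAsg])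
    (by
      intro j m hm w hw hwj hall
      have := h2 j m hm
      obtain ⟨x, hx, hxj, hxw⟩ : ∃ x, x ≤ m ∧ x ≠ j ∧ x ≠ w := by
        by_cases h0 : 0 ≠ j ∧ 0 ≠ w
        · exact ⟨0, by omega, h0⟩
        · by_cases h1 : 1 ≠ j ∧ 1 ≠ w
          · exact ⟨1, by omega, h1⟩
          · exact ⟨2, by omega, by omega, by omega⟩
      exact absurd (hall x hx hxj hxw) (by simp [noAsg, Asg.union]))
    (by simp [noAsg])
  have : new = [] := by
    cases new with
    | nil => rfl
    | cons e new =>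
      obtain ⟨i, j, b, -, -, hf⟩ := (hS.rep.mem e.lit).1 (by simp)
      exact hf.elim
  subst this
  rw [restart_val, h1]
  rfl

/-- If `P_{0,1}` is the only unit clause, then it is on the trail after a restart. -/
theorem restart_unit (hdb : DB n LS db) (hn : 2 ≤ n) (h11 : LS 1 1)
    (h2 : ∀ j m, LS j m → 2 ≤ m ∨ (j = 1 ∧ m = 1)) (sc : List (ℕ × ℚ)) :
    ∃ tr, (restart db sc).val = .search (mkSearch db sc (0, tr, [(opVar n 0 1, true)])) ∧
      St n db (zeroAsg 1 fun _ => False) (0, tr, [(opVar n 0 1, true)]) := by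
  obtain ⟨new, h1, hS⟩ := saturate_none hdb (fun i j c => c = true ∧ i = 0 ∧ j = 1)
    (by simp)
    (by
      intro j m hm w hw hwj hall
      rcases h2 j m hm with hm2 | ⟨rfl, rfl⟩
      · obtain ⟨x, hx, hxj, hxw⟩ : ∃ x, x ≤ m ∧ x ≠ j ∧ x ≠ w := by
          by_cases h0 : 0 ≠ j ∧ 0 ≠ w
          · exact ⟨0, by omega, h0⟩
          · by_cases h1 : 1 ≠ j ∧ 1 ≠ w
            · exact ⟨1, by omega, h1⟩
            · exact ⟨2, by omega, by omega, by omega⟩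
        exact absurd (hall x hx hxj hxw) (by simp [noAsg, Asg.union])
      · exact Or.inr ⟨rfl, by omega, rfl⟩)
    (by
      rintro i j c _ ⟨rfl, rfl, rfl⟩
      exact ⟨rfl, 1, h11, by omega, fun x hx hx1 => by omega⟩)
  have hlits : lits new = [(opVar n 0 1, true)] := by
    have hnd : (lits new).Nodup := by
      refine List.Nodup.of_map Prod.fst ?_
      rw [List.map_map]
      exact hS.rep.nodup
    refine List.perm_singleton.1 ((List.perm_ext_iff_of_nodup hnd (List.nodup_singleton _)).2 ?_)
    intro l
    rw [hS.rep.mem, List.mem_singleton]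
    constructor
    · rintro ⟨i, j, b, -, rfl, rfl, rfl, rfl⟩
      rfl
    · rintro rfl
      exact ⟨0, 1, true, ⟨by omega, by omega, by omega⟩, rfl, rfl, rfl, rfl⟩
  rw [hlits, List.reverse_singleton] at h1 hS
  refine ⟨new, by rw [restart_val, h1], hS.rep.congr ?_, hS.reason, hS.queue, hS.level⟩
  intro i j b _
  simp only [zeroAsg]
  grind

end stages

/-! ### The whole run -/

/-- The column clauses in the first stages, in which the column `0` is processed. -/
def firstClauses (n m j r : ℕ) : Prop := j < n ∧ (r = n - 1 ∨ (j = 0 ∧ m ≤ r ∧ r < n))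

/-- The column clauses when the clause `k, m` was learned last. -/
def middleClauses (n k m j r : ℕ) : Prop :=
  j < n ∧ (r = n - 1 ∨ (j = 0 ∧ n - 3 ≤ r ∧ r < n) ∨ (j = k ∧ m ≤ r ∧ r < n) ∨
    (k < j ∧ j + 3 ≤ n ∧ j ≤ r ∧ r < n))

/-- The column clauses in the last stages, when the clause `0, m` was learned last. -/
def lastClauses (n m j r : ℕ) : Prop :=
  j < n ∧ (r = n - 1 ∨ (j = 0 ∧ m ≤ r ∧ r < n) ∨ (1 ≤ j ∧ j + 3 ≤ n ∧ j ≤ r ∧ r < n))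

section stages

variable {n c : ℕ} {δ : ℚ} {sc : ℕ → ℚ} {db : List Clause} {vars : List ℕ}

/-- Every conflict shortens the clause of column 0 by one. For `m = 2` the chain `P_{0,1}`, `¬
P_{1,0}`, `P_{2,0}` needs no decision and falsifies the clause `2, 2`. -/
theorem reaches_last (hδ₀ : 0 < δ) (hδ : δ ≤ 1 / 2) (hn : 6 ≤ n) (hvars : Vars n vars) (m : ℕ)
    (hm : 2 ≤ m) : m + 4 ≤ n → ∀ c db sc, Stage n δ (lastClauses n m) 0 m c db sc →
      c + m ≤ n ^ 2 → Reaches δ vars db sc (m * roundBound δ n) := by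
  induction m, hm using Nat.le_induction with
  | base =>
    intro _ c db sc h hc
    have hE := h.env hδ₀ hδ hn (by omega) hvars
    obtain ⟨tr, h1, hS⟩ := restart_unit h.dbs (by omega) (by unfold lastClauses; omega)
      (by unfold lastClauses; omega) (scList vars sc)
    have hLS : ∀ r, lastClauses n 2 0 r → 2 ≤ r := by unfold lastClauses; omega
    obtain ⟨tr', hz⟩ := zeroChain_start hE le_rfl hLS hS
    obtain ⟨s, e1, e2, e3, e4⟩ := hz.refutes hE le_rfl hLS (by unfold lastClauses; omega)
      (by unfold lastClauses; omega) (by simp)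
    obtain ⟨t, ht, hr⟩ := run_round e1 e2 e3 e4 (by simp)
    refine ⟨t, by unfold roundBound; omega, ?_⟩
    rw [h1]
    exact hr
  | succ p hp ih =>
    intro hpn c db sc h hc
    have hE := h.env hδ₀ hδ hn (by omega) hvars
    obtain ⟨tr, h1, hS⟩ := restart_unit h.dbs (by omega) (by unfold lastClauses; omega)
      (by unfold lastClauses; omega) (scList vars sc)
    have hLS : ∀ r, lastClauses n (p + 1) 0 r → p + 1 ≤ r := by unfold lastClauses; omega
    -- The chain begins with `t = 2` at level 0; the first decision leads to `t = 3` and to a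
    -- positive level, at which conflicts are learned from.
    have hchain : ∀ t, 3 ≤ t → t ≤ p + 1 → ∃ lvl tr', lvl ≠ 0 ∧
        ZeroChain n δ (sizeBound δ n) db vars sc (0, tr, [(opVar n 0 1, true)]) t
          (fun _ => False) lvl tr' := by
      intro t ht
      induction t, ht using Nat.le_induction with
      | base =>
        intro _
        obtain ⟨tr', hz⟩ := zeroChain_start hE (by omega) hLS hS
        obtain ⟨tr'', hz⟩ := hz.decide hE le_rfl (by omega) hLS (by omega)
          (show 2 ≤ p + 1 by omega) h.prefers
        exact ⟨_, _, by omega, hz⟩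
      | succ t ht ih =>
        intro htp
        obtain ⟨lvl, tr', -, hz⟩ := ih (by omega)
        obtain ⟨tr'', hz⟩ := hz.decide hE (by omega) (by omega) hLS (by omega) (by omega) h.prefers
        exact ⟨_, _, by omega, hz⟩
    obtain ⟨lvl, tr', hlvl, hz⟩ := hchain (p + 1) (by omega) le_rfl
    rw [Nat.succ_mul]
    refine (hz.learns hE hlvl (by omega) hLS (by unfold lastClauses; omega)
      (by unfold lastClauses; omega) (by simp)).reaches h1 (by simp) fun L hL =>
      ih (by omega) (c + 1) _ _ (h.learn hδ₀ hδ hL (by omega) ?_) (by omega)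
    intro a b
    unfold lastClauses
    omega

/-- The clause `1, 1` is now a unit clause, but VSIDS still prefers column 1. With `P_{0,1}` on the
trail, each decision `¬ P_{t,1}` is copied to column 0, so column 0 gets its next clause, `0, n -
4`, and the preference returns to it. -/
theorem reaches_turn (hδ₀ : 0 < δ) (hδ : δ ≤ 1 / 2) (hn : 6 ≤ n) (hvars : Vars n vars)
    (h : Stage n δ (lastClauses n (n - 3)) 1 (n - 2) c db sc) (hc : c + n ≤ n ^ 2) :
    Reaches δ vars db sc (n * roundBound δ n) := by
  have hE := h.env hδ₀ hδ hn (by omega) hvars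
  obtain ⟨tr, h1, hS⟩ := restart_unit h.dbs (by omega) (by unfold lastClauses; omega)
    (by unfold lastClauses; omega) (scList vars sc)
  have hLS : ∀ r, lastClauses n (n - 3) 0 r → n - 3 ≤ r := by unfold lastClauses; omega
  have hchain : ∀ t, 3 ≤ t → t ≤ n - 3 → ∃ lvl tr', lvl ≠ 0 ∧
      ZeroChain n δ (sizeBound δ n) db vars sc (0, tr, [(opVar n 0 1, true)]) t
        (fun x => 2 ≤ x ∧ x < t) lvl tr' := by
    intro t ht
    induction t, ht using Nat.le_induction with
    | base =>
      intro _
      obtain ⟨tr', hz⟩ := zeroChain_start hE (by omega) hLS hS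
      have hY : (fun _ => False) = fun x : ℕ => 2 ≤ x ∧ x < 2 := by
        funext x; rw [eq_iff_iff, false_iff]; omega
      rw [hY] at hz
      obtain ⟨tr'', hz⟩ := hz.decide_one hE le_rfl (by omega) hLS (by omega)
        (show 2 ≤ n - 2 by omega) h.prefers
      exact ⟨_, _, by omega, hz⟩
    | succ t ht ih =>
      intro htp
      obtain ⟨lvl, tr', -, hz⟩ := ih (by omega)
      obtain ⟨tr'', hz⟩ := hz.decide_one hE (by omega) (by omega) hLS (by omega)
        (show t ≤ n - 2 by omega) h.prefers
      exact ⟨_, _, by omega, hz⟩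
  obtain ⟨lvl, tr', hlvl, hz⟩ := hchain (n - 3) (by omega) le_rfl
  refine ((hz.learns hE hlvl (by omega) hLS (by unfold lastClauses; omega)
    (by unfold lastClauses; omega) (fun _ h => h)).reaches h1 (by simp) fun L hL =>
    reaches_last (m := n - 4) hδ₀ hδ hn hvars (by omega) (by omega) (c + 1) _ _
      (h.learn hδ₀ hδ hL (by omega) ?_) (by omega)).mono ?_
  · intro a b
    unfold lastClauses
    omega
  · rw [← Nat.succ_mul]
    exact Nat.mul_le_mul_right _ (by omega)

theorem Stage.congr {LS LS' : ℕ → ℕ → Prop} {k M : ℕ} (h : Stage n δ LS k M c db sc)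
    (hLS : ∀ a b, LS' a b ↔ LS a b) : Stage n δ LS' k M c db sc := by
  have : LS' = LS := by funext a b; exact propext (hLS a b)
  rw [this]; exact h

/-- Each conflict moves the last learned clause `k, m` down in lexicographic order: within the
column to `k, m - 1`, and from `k, k` to `k - 1, n - 2`. The number `r` encodes this order and
bounds the remaining conflicts; its final summand `n` is reserved for the return to column 0. -/
theorem reaches_middle (hδ₀ : 0 < δ) (hδ : δ ≤ 1 / 2) (hn : 6 ≤ n) (hvars : Vars n vars) (r : ℕ) :
    ∀ k m c db sc, k * n + m + n = r → 1 ≤ k → k ≤ m → m + 2 ≤ n → k + 3 ≤ n →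
      Stage n δ (middleClauses n k m) k (n - 2) c db sc → c + r ≤ n ^ 2 →
      Reaches δ vars db sc (r * roundBound δ n) := by
  induction r using Nat.strong_induction_on with
  | _ r ih =>
    intro k m c db sc hr hk hkm hmn hkn h hc
    have hE := h.env hδ₀ hδ hn (by omega) hvars
    by_cases h11 : m = 1
    · obtain ⟨rfl, rfl⟩ : k = 1 ∧ m = 1 := by omega
      refine (reaches_turn hδ₀ hδ hn hvars (h.congr ?_) (by omega)).mono
        (Nat.mul_le_mul_right _ (by omega))
      intro a b
      unfold lastClauses middleClauses
      omega
    have hemp := restart_empty h.dbs (by unfold middleClauses; omega) (scList vars sc)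
    rcases Nat.lt_or_ge k m with hkm' | hkm'
    · have hl : Learns n δ (sizeBound δ n) db vars sc (0, [], []) k (m - 1) := by
        obtain ⟨d, hdm, hdk, hd⟩ : ∃ d, d < m ∧ d ≠ k ∧ ∀ x < m, x ≠ k → x ≤ d := by
          by_cases h1 : k = m - 1
          · exact ⟨m - 2, by omega, by omega, by omega⟩
          · exact ⟨m - 1, by omega, by omega, by omega⟩
        by_cases hm2 : m + 2 = n
        · exact learns_second hE hm2 hkm' hdm hdk (by unfold middleClauses; omega)
            (by unfold middleClauses; omega) hd (by unfold middleClauses; omega)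
            (show d ≤ n - 2 by omega) h.prefers
        · exact learns_learned hE hkm' hdm hdk (by unfold middleClauses; omega)
            (by unfold middleClauses; omega) hd (by unfold middleClauses; omega)
            (show d ≤ n - 2 by omega) h.prefers
      refine (hl.reaches hemp (by simp) fun L hL => ih (r - 1) (by omega) k (m - 1) (c + 1) _ _
        (by omega) hk (by omega) (by omega) hkn (h.learn_same hδ₀ hδ hL (by omega) (by omega) ?_)
        (by omega)).mono ?_
      · intro a b
        unfold middleClauses
        omega
      · rw [← Nat.succ_mul]
        exact Nat.mul_le_mul_right _ (by omega)
    · obtain rfl : k = m := by omega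
      obtain ⟨k, rfl⟩ : ∃ k', k = k' + 1 := ⟨k - 1, by omega⟩
      rw [Nat.succ_mul] at hr
      have hl : Learns n δ (sizeBound δ n) db vars sc (0, [], []) k (n - 2) :=
        -- The column that is left is `k + 1`, with shortest clause `k + 1, k + 1`. Its largest
        -- possible predecessor is `k`, which becomes the next column, and the second largest is `k
        -- - 1`.
        learns_jump hE (d := k - 1) (m := k + 1) (by omega) le_rfl (by omega) (by omega) (by omega)
          (by omega) (by unfold middleClauses; omega) (by unfold middleClauses; omega) (by omega)
          (by unfold middleClauses; omega) h.prefers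
      refine (hl.reaches hemp (by simp) fun L hL => ih (k * n + (n - 2) + n) (by omega) k (n - 2)
        (c + 1) _ _ rfl (by omega) (by omega) (by omega) (by omega)
        (h.learn hδ₀ hδ hL (by omega) ?_) (by omega)).mono ?_
      · intro a b
        unfold middleClauses
        omega
      · rw [← Nat.succ_mul]
        exact Nat.mul_le_mul_right _ (by omega)

/-- Column 0 loses two candidates before the solver leaves it: `n - 1`, whose input clause is
already `n - 1, n - 1`, and `n - 2`, which is ruled out through column `n - 1`. The third conflict
jumps to column `n - 3`. -/
theorem reaches_first (hδ₀ : 0 < δ) (hδ : δ ≤ 1 / 2) (hn : 6 ≤ n) (hvars : Vars n vars)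
    (h : Stage n δ (firstClauses n (n - 1)) 0 (n - 2) 0 db sc) :
    Reaches δ vars db sc (n ^ 2 * roundBound δ n) := by
  -- Leaves room for the three conflicts of this stage within the total of `n ^ 2`.
  have hpow : (n - 3) * n + (n - 2) + n + 3 ≤ n ^ 2 := by
    obtain ⟨u, rfl⟩ : ∃ u, n = u + 3 := ⟨n - 3, by omega⟩
    simp only [Nat.add_sub_cancel]
    ring_nf
    omega
  have hemp : ∀ m, 2 ≤ m → ∀ {c db sc}, Stage n δ (firstClauses n m) 0 (n - 2) c db sc →
      (restart db (scList vars sc)).val = .search (mkSearch db (scList vars sc) (0, [], [])) :=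
    fun m hm _ _ _ h => restart_empty h.dbs (by unfold firstClauses; omega) _
  refine Reaches.mono (B := (((n - 3) * n + (n - 2) + n) * roundBound δ n + roundBound δ n +
    roundBound δ n) + roundBound δ n) ?_ (by
      have := Nat.mul_le_mul_right (roundBound δ n) hpow
      rw [Nat.add_mul _ 3] at this
      omega)
  have hE := h.env hδ₀ hδ hn (by omega) hvars
  refine (learns_learned hE (p := n - 1) (d := n - 2) (by omega) (by omega) (by omega)
    (by unfold firstClauses; omega) (by unfold firstClauses; omega) (by omega)
    (by unfold firstClauses; omega) le_rfl h.prefers).reaches (hemp _ (by omega) h) (by simp)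
    fun L hL => ?_
  have h' := h.learn_same (LS' := firstClauses n (n - 2)) hδ₀ hδ hL (by omega) (by omega)
    (by intro a b; unfold firstClauses; omega)
  have hE := h'.env hδ₀ hδ hn (by omega) hvars
  refine (learns_second hE (p := n - 2) (d := n - 3) (by omega) (by omega) (by omega) (by omega)
    (by unfold firstClauses; omega) (by unfold firstClauses; omega) (by omega)
    (by unfold firstClauses; omega) (show n - 3 ≤ n - 2 by omega) h'.prefers).reaches
    (hemp _ (by omega) h') (by simp) fun L hL => ?_
  have h'' := h'.learn_same (LS' := firstClauses n (n - 3)) hδ₀ hδ hL (by omega) (by omega)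
    (by intro a b; unfold firstClauses; omega)
  have hE := h''.env hδ₀ hδ hn (by omega) hvars
  refine (learns_jump hE (k := 0) (p := n - 3) (m := n - 3) (d := n - 4) (by omega) (by omega)
    (by omega) (by omega) (by omega) (by omega)
    (by unfold firstClauses; omega) (by unfold firstClauses; omega) (by omega)
    (by unfold firstClauses; omega) h''.prefers).reaches
    (hemp _ (by omega) h'') (by simp) fun L hL => ?_
  refine reaches_middle hδ₀ hδ hn hvars _ (n - 3) (n - 2) _ _ _ rfl (by omega) (by omega) (by omega)
    (by omega) (h''.learn hδ₀ hδ hL (by omega) ?_) (by omega)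
  intro a b
  unfold firstClauses middleClauses
  omega

end stages

/-! ### The input formula and the total time -/

theorem isCol_opNonMin {n j : ℕ} (hn : 1 ≤ n) : IsCol n j (n - 1)
    (((List.range n).filter fun i => i ≠ j).map fun i => (opVar n i j, true)) where
  nodup := by
    refine (List.nodup_range.filter _).map_on ?_
    intro x hx y hy hxy
    simp only [List.mem_filter, List.mem_range] at hx hy
    exact ((opVar_inj hx.1 hy.1).1 (Prod.mk.inj hxy).1).1
  mem l := by
    simp only [List.mem_map, List.mem_filter, List.mem_range, decide_eq_true_eq]
    constructor
    · rintro ⟨x, ⟨hx, hxj⟩, rfl⟩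
      exact ⟨x, by omega, hxj, rfl⟩
    · rintro ⟨x, hx, hxj, rfl⟩
      exact ⟨x, ⟨by omega, hxj⟩, rfl⟩

theorem db_OP {n : ℕ} (hn : 6 ≤ n) : DB n (firstClauses n (n - 1)) (OP n) where
  split := by
    refine ⟨opNonMin n, rfl, ?_, ?_⟩
    · intro C hC
      obtain ⟨j, hj, rfl⟩ := mem_opNonMin.1 hC
      exact ⟨j, n - 1, ⟨hj, Or.inl rfl⟩, isCol_opNonMin (by omega)⟩
    · rintro j m ⟨hj, hm⟩
      obtain rfl : m = n - 1 := by omega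
      exact ⟨_, mem_opNonMin.2 ⟨j, hj, rfl⟩, isCol_opNonMin (by omega)⟩
  range := by unfold firstClauses; omega
  full := fun j hj => ⟨hj, Or.inl rfl⟩

theorem length_le_size (F : CNF) : F.length ≤ size F := by
  induction F with
  | nil => simp
  | cons C F ih => simp only [size, List.length_cons, List.map_cons, List.sum_cons] at ih ⊢; omega

theorem mem_vars_OP {n : ℕ} (hn : 6 ≤ n) (x : ℕ) :
    (∃ C ∈ OP n, ∃ l ∈ C, l.1 = x) ↔ ∃ i j, Valid n i j ∧ x = opVar n i j := by
  constructor
  · rintro ⟨C, hC, l, hl, rfl⟩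
    rcases (db_OP hn).cases hC with ⟨i, j, k, hi, hj, hk, h1, h2, h3, rfl⟩ |
      ⟨i, j, hi, hj, h1, rfl⟩ | ⟨j, m, hLS, hcol⟩
    · simp only [List.mem_cons, List.not_mem_nil, or_false] at hl
      rcases hl with rfl | rfl | rfl
      exacts [⟨i, j, ⟨hi, hj, h1⟩, rfl⟩, ⟨j, k, ⟨hj, hk, h3⟩, rfl⟩, ⟨i, k, ⟨hi, hk, h2.symm⟩, rfl⟩]
    · simp only [List.mem_cons, List.not_mem_nil, or_false] at hl
      rcases hl with rfl | rfl
      exacts [⟨i, j, ⟨hi, hj, h1⟩, rfl⟩, ⟨j, i, ⟨hj, hi, h1.symm⟩, rfl⟩]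
    · obtain ⟨x, hx, hxj, rfl⟩ := (hcol.mem l).1 hl
      have := (db_OP hn).range j m hLS
      exact ⟨x, j, ⟨by omega, by omega, hxj⟩, rfl⟩
  · rintro ⟨i, j, ⟨hi, hj, hij⟩, rfl⟩
    exact ⟨_, mem_OP.2 (Or.inr (Or.inl (mem_opAnti.2 ⟨i, j, hi, hj, hij, rfl⟩))),
      (opVar n i j, false), by simp, rfl⟩

/-- The solver refutes the ordering principle in polynomial time. -/
theorem cdcl_polynomial {δ : ℚ} (hδ₀ : 0 < δ) (hδ : δ ≤ 1 / 2) :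
    ∃ p : Polynomial ℕ, ∀ n : ℕ, 6 ≤ n → ∃ t : ℕ, t ≤ p.eval n ∧ (cdcl δ).Refutes (OP n) t := by
  let D : Polynomial ℕ := 4 * .X ^ 3 + 6 * .X ^ 2 + .X + 7 +
    2 * ((.X ^ 2 + 1) * .C δ.den.size) + .C (bits δ)
  have hD : ∀ n, D.eval n = sizeBound δ n := fun n => by simp [D, sizeBound]
  -- The three summands pay for listing the variables, for the initial pass over the database, and
  -- for at most `n ^ 2` rounds from a restart to a conflict.
  refine ⟨(D + 1) * ((D + 1) * (D + 3)) + (D + 1) * (1 + D + D * D) +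
    .X ^ 2 * (200 * (D + 1) ^ 5 * (2 * .X ^ 2 + 2)), fun n hn => ?_⟩
  obtain ⟨vars, h1, h2, h3⟩ := addVars_val (OP n) []
  have hsize := size_OP_le n
  have hlen := length_le_size (OP n)
  simp only [List.map_nil] at h1
  have hvars : Vars n vars := ⟨fun x => by
    rw [h2, ← mem_vars_OP hn]; simp, by simp only [List.length_nil] at h3; omega⟩
  have hst : Stage n δ (firstClauses n (n - 1)) 0 (n - 2) 0 (OP n) fun _ => 0 :=
    ⟨db_OP hn, by omega, scores_zero n δ, prefers_zero (by omega)⟩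
  obtain ⟨t, ht, hr⟩ := reaches_first hδ₀ hδ hn hvars hst
  have hE := hst.env hδ₀ hδ hn (by omega) hvars
  have hDge : size (OP n) + 3 ≤ sizeBound δ n := by unfold sizeBound; omega
  have c1 : (addVars (OP n) []).cost ≤
      (sizeBound δ n + 1) * ((sizeBound δ n + 1) * (sizeBound δ n + 3)) := by
    refine (addVars_cost (OP n) []).trans ?_
    simp only [List.length_nil]
    gcongr <;> omega
  have c2 : ((restart (OP n) (scList vars fun _ => 0))).cost ≤
      (sizeBound δ n + 1) * (1 + sizeBound δ n + sizeBound δ n * sizeBound δ n) := by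
    simp only [restart, cost_bind, cost_pure, Nat.add_zero]
    refine (saturate_cost none 0 (D := sizeBound δ n) (OP n) (fun C hC => ?_) [] ?_).trans
      (Nat.mul_le_mul_right _ (by omega))
    · have := hE.clause_len C hC
      omega
    · simp only [List.length_nil]
      omega
  have hstep : (cdcl δ).step (.start (OP n))
      ((addVars (OP n) []).cost + (restart (OP n) (scList vars fun _ => 0)).cost)
      (restart (OP n) (scList vars fun _ => 0)).val := by
    change some _ = some _
    rw [← show (addVars (OP n) []).val = scList vars fun _ => 0 from h1]
    rfl
  refine ⟨_, ?_, .unsat, (Solver.Run.single hstep).trans hr, rfl⟩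
  simp only [Polynomial.eval_add, Polynomial.eval_mul, Polynomial.eval_pow, Polynomial.eval_X,
    Polynomial.eval_one, Polynomial.eval_ofNat, hD]
  unfold roundBound stepCost at ht
  omega

end SatSep

theorem corollary6 (δ : ℚ) (hδ₀ : 0 < δ) (hδ : δ ≤ 1 / 2) :
    -- the CDCL solver is deterministic and refutes the ordering principle in polynomial time
    (SatSep.cdcl δ).Deterministic ∧
    (∃ p : Polynomial ℕ, ∀ n : ℕ, 6 ≤ n →
      ∃ t : ℕ, t ≤ p.eval n ∧ (SatSep.cdcl δ).Refutes (SatSep.OP n) t) ∧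
    -- tree-like resolution needs exponential size
    (∃ ε : ℝ, 0 < ε ∧ ∀ᶠ n : ℕ in Filter.atTop, ∀ s : ℕ,
      SatSep.TreeRefutes (SatSep.OP n) s → (2 : ℝ) ^ (ε * (n : ℝ)) ≤ (s : ℝ)) ∧
    -- so does every solver that is polynomially equivalent to tree-like resolution
    (∀ S : SatSep.Solver, S.PolyEquivTreeLike →
      ∃ ε : ℝ, 0 < ε ∧ ∀ᶠ n : ℕ in Filter.atTop, ∀ t : ℕ,
        S.Refutes (SatSep.OP n) t → (2 : ℝ) ^ (ε * (n : ℝ)) ≤ (t : ℝ)) ∧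
    -- DPLL with nondeterministic branching is such a solver
    SatSep.dpll.PolyEquivTreeLike := by
  exact ⟨SatSep.cdcl_deterministic δ, SatSep.cdcl_polynomial hδ₀ hδ, SatSep.treeLike_exponential,
    SatSep.Solver.exponential_of_treeLike, SatSep.dpll_polyEquivTreeLike⟩
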